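/- Let $p$ be a prime and let $0\le d\le h$ be integers. For a $p$-adically complete (and separated) commutative ring $R$ let $W(R)$ be the ring of $p$-typical Witt vectors with Frobenius $\phi$ and Verschiebung $V$, and $I_R=V(W(R))$. *Rees--Witt stack.* Put $\mathrm{Fil}^j=W(R)$ for $j\le 0$ and $\mathrm{Fil}^j=I_R$ for $j>0$, with transition maps $t\colon \mathrm{Fil}^{j+1}\to\mathrm{Fil}^j$ given by the identity for $j<0$, the inclusion for $j=0$ and multiplication by $p$ for $j\ge1$. Let $B_R=\mathrm{Rees}(W(R))=\bigoplus_{j\in\mathbb Z}\mathrm{Fil}^j$ be the associated $\mathbb Z$-graded commutative ring, where for $i,j>0$ the product $\mathrm{Fil}^i\times\mathrm{Fil}^j\to\mathrm{Fil}^{i+j}$ is $V(x)\cdot V(y)=V(xy)$, where $\mathrm{Fil}^0=W(R)$ acts on $\mathrm{Fil}^j$ by multiplication, and where multiplication by $t=1\in \mathrm{Fil}^{-1}$ is the transition map. Let $\mathrm{Re}(W(R))=[\mathbb G_m\backslash\operatorname{Spec}B_R]$; its quasi-coherent modules are the $\mathbb Z$-graded $B_R$-modules $N$ (with degree-preserving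 $B_R$-linear maps), and $N$ is a vector bundle of rank $h$ if it is finite projective of constant rank $h$ over $B_R$. It is *of type $\mu_d$* if it is étale locally on $\mathrm{Re}(W(R))$ isomorphic to $\mathcal O^{d}\oplus\mathcal O(1)^{h-d}$, that is, if $B'\otimes_{B_R}N\cong B'^{\,d}\oplus B'(1)^{h-d}$ as graded modules for some $\mathbb Z$-graded étale faithfully flat $B_R$-algebra $B'$, where $B'(1)_j=B'_{j+1}$. Let $\mathrm{Vec}^h(\mathrm{Re}(W(R)))^{\mu_d}$ be the category of vector bundles of rank $h$ and type $\mu_d$. *The maps $\tau,\sigma$ and $R^{\mathrm{Disp}}$.* Let $\tau,\sigma\colon \operatorname{Spec}W(R)\to\mathrm{Re}(W(R))$ be given by the ring homomorphisms $B_R\to W(R)$ sending $x\in\mathrm{Fil}^j$ to $x$ for $j\le 0$ and to $p^{j-1}x$ for $j\ge1$ (for $\tau$), respectively $x\in\mathrm{Fil}^j$ to $p^{-j}\phi(x)$ for $j\le0$ and $V(x)\in\mathrm{Fil}^j$ to $x$ for $j\ge1$ (for $\sigma$). Pullbacks are given by extension of scalars. Let $R^{\mathrm{Disp}}$ be the coequalizer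 of $\sigma$ and $\tau$ (in Adams stacks); thus $\mathrm{Vec}^h(R^{\mathrm{Disp}})^{\mu_d}$ is the category of pairs $(N,\Phi)$ with $N\in \mathrm{Vec}^h(\mathrm{Re}(W(R)))^{\mu_d}$ and $\Phi\colon\sigma^*N\cong\tau^*N$. *Pairs and displays.* A pair of type $(h,d)$ over $R$ is $(M,M_1)$ with $M$ a finite projective $W(R)$-module of rank $h$ and $I_RM\subseteq M_1\subseteq M$ a submodule such that $M_1/I_RM$ is a direct summand of rank $d$ of the $R$-module $M/I_RM$; morphisms are linear maps $f\colon M\to M'$ with $f(M_1)\subseteq M_1'$. Write $(-)^\phi=W(R)\otimes_{\phi,W(R)}(-)$, and let $\widetilde M_1$ be the quotient of $M_1^\phi\oplus M^\phi$ by the relations $1\otimes V(x)m= x\otimes m$ ($x\in W(R)$, $m\in M$, with $V(x)m\in M_1$ on the left and $m\in M$ on the right). A display of type $(h,d)$ is $(M,M_1,\Psi)$ with $(M,M_1)$ a pair of type $(h,d)$ and $\Psi\colon\widetilde M_1\cong M$; morphisms are the morphisms of pairs that are compatible with $\Psi$. Denote the categories by $\mathrm{Pair}^{h,d}(R)$ and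 $\mathrm{Disp}^{h,d}(R)$. **Statement.** (0) Every pair has a normal decomposition $M=L\oplus T$, $M_1=L\oplus I_RT$. Each normal decomposition induces an isomorphism $\widetilde M_1\cong L^\phi\oplus T^\phi$ sending the class of $1\otimes l$ for $l\in L\subseteq M_1$ to $1\otimes l$ and the class of $1\otimes t$ for $t\in T\subseteq M$ to $1\otimes t$. In these coordinates a morphism $\begin{pmatrix}a&b\\c&e\end{pmatrix}\colon L\oplus T\to L'\oplus T'$ of pairs induces $\begin{pmatrix}a^\phi&pb^\phi\\\dot c&e^\phi\end{pmatrix}$ on $\widetilde M_1\to\widetilde M_1'$, where $\dot c(1\otimes l)=\sum_i y_i\otimes x_i$ if $c(l)=\sum_i V(y_i)x_i$ with $x_i\in T'$. (1) There are equivalences of categories, functorial in $R$, $$\mathrm{Vec}^h(\mathrm{Re}(W(R)))^{\mu_d}\simeq\mathrm{Pair}^{h,d}(R),\qquad \mathrm{Vec}^h(R^{\mathrm{Disp}})^{\mu_d}\simeq\mathrm{Disp}^{h,d}(R).$$ (2) Under these equivalences, pullback along $\mathrm{Re}(W(R))\to R^{\mathrm{Disp}}$ is identified with $(M,M_1,\Psi)\mapsto(M,M_1)$,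 pullback along $\tau$ with $(M,M_1)\mapsto M$, and pullback along $\sigma$ with $(M,M_1)\mapsto\widetilde M_1$; moreover $\Phi$ corresponds to $\Psi$. Functorial in $R$ means: for a ring homomorphism $R\to R'$ between $p$-adically complete rings, vector bundles as above on $\mathrm{Re}(W(R))$ and on $R^{\mathrm{Disp}}$ have base changes to $R'$ of the same kind; every semilinear map over $R\to R'$ between such bundles (degree-preserving and, for $R^{\mathrm{Disp}}$, compatible with the $\Phi$'s) induces, via the identifications in (2), a semilinear map between the associated pairs (respectively displays); and base changes induce base changes, where $(M',M_1')$ is the base change of $(M,M_1)$ if $M'=W(R')\otimes_{W(R)}M$ and $M_1'$ is generated by the image of $M_1$ and $I_{R'}M'$. -/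

import Mathlib

open CategoryTheory TensorProduct DirectSum

universe u

noncomputable section

namespace WittDisplay

section ReesAlgebra

variable (p : ℕ) [Fact p.Prime] (R : Type u) [CommRing R]

/-- The ideal `I_R = V(W(R))` of the ring `W(R)` of `p`-typical Witt vectors. -/
def augIdeal : Ideal (WittVector p R) where
  carrier := Set.range fun y : WittVector p R => WittVector.verschiebung y
  zero_mem' := ⟨0, map_zero _⟩
  add_mem' := by
    rintro _ _ ⟨a, rfl⟩ ⟨b, rfl⟩
    exact ⟨a + b, map_add _ a b⟩
  smul_mem' := by
    rintro c _ ⟨a, rfl⟩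
    refine ⟨a * WittVector.frobenius c, ?_⟩
    simp only [WittVector.verschiebung_mul_frobenius, smul_eq_mul, mul_comm]

/-- The filtration `Fil^j` of `W(R)`: it is `W(R)` for `j ≤ 0` and `I_R` for `j > 0`. -/
def fil (j : ℤ) : Ideal (WittVector p R) := if j ≤ 0 then ⊤ else augIdeal p R

variable {p R}

/-- The inverse of the (injective) Verschiebung on its image `I_R`. -/
def verInv (x : WittVector p R) : WittVector p R :=
  Function.invFun (fun y : WittVector p R => WittVector.verschiebung y) x

theorem verInv_verschiebung (y : WittVector p R) : verInv (WittVector.verschiebung y) = y :=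
  Function.leftInverse_invFun (WittVector.verschiebung_injective p R) y

theorem verschiebung_mem_fil (j : ℤ) (y : WittVector p R) :
    WittVector.verschiebung y ∈ fil p R j := by
  unfold fil
  split_ifs
  · trivial
  · exact ⟨y, rfl⟩

theorem mem_fil_of_nonpos {j : ℤ} (hj : j ≤ 0) (x : WittVector p R) : x ∈ fil p R j := by
  simp [fil, hj]

theorem exists_of_mem_fil {j : ℤ} (hj : 0 < j) {x : WittVector p R} (hx : x ∈ fil p R j) :
    ∃ y, WittVector.verschiebung y = x := by
  rw [fil, if_neg (not_le.mpr hj)] at hx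
  exact hx

/-- The multiplication `Fil^i × Fil^j → Fil^{i+j}`. If `i, j > 0` it is `V(a) · V(b) = V(ab)`.
If `i ≤ 0` (or `j ≤ 0`), it is the product of Witt vectors in `Fil^j` (in `Fil^i`), followed by
the transition maps `⋯ → Fil^2 → Fil^1 → Fil^0 = Fil^{-1} = ⋯` down to `Fil^{i+j}`, where
`Fil^{k+1} → Fil^k` is multiplication by `p` for `k ≥ 1` and the inclusion for `k ≤ 0`. -/
def filMulVal (i j : ℤ) (x y : WittVector p R) : WittVector p R :=
  if 0 < i ∧ 0 < j then WittVector.verschiebung (verInv x * verInv y)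
  else (p : WittVector p R) ^ ((i - 1).toNat + (j - 1).toNat - (i + j - 1).toNat) * (x * y)

theorem filMulVal_mem {i j : ℤ} {x y : WittVector p R} (hx : x ∈ fil p R i)
    (hy : y ∈ fil p R j) : filMulVal i j x y ∈ fil p R (i + j) := by
  unfold filMulVal
  split_ifs with h
  · exact verschiebung_mem_fil _ _
  · refine Ideal.mul_mem_left _ _ ?_
    rcases le_or_gt (i + j) 0 with h0 | h0
    · exact mem_fil_of_nonpos h0 _
    · rcases lt_or_ge 0 i with hi | hi
      · obtain ⟨a, rfl⟩ := exists_of_mem_fil hi hx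
        rw [← WittVector.verschiebung_mul_frobenius]
        exact verschiebung_mem_fil _ _
      · obtain ⟨b, rfl⟩ := exists_of_mem_fil (by omega) hy
        rw [mul_comm, ← WittVector.verschiebung_mul_frobenius]
        exact verschiebung_mem_fil _ _

/-- The natural map `Fil^j → W(R)` (composite of the transition maps): the inclusion for `j ≤ 1`
and `p^{j-1}` times the inclusion for `j ≥ 1`. -/
def tauVal (j : ℤ) (x : WittVector p R) : WittVector p R :=
  (p : WittVector p R) ^ (j - 1).toNat * x

/-- The divided Frobenius `Fil^j → W(R)`: `x ↦ p^{-j} φ(x)` for `j ≤ 0`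
and `V(x) ↦ x` for `j > 0`. -/
def sigmaVal (j : ℤ) (x : WittVector p R) : WittVector p R :=
  if 0 < j then verInv x else (p : WittVector p R) ^ (-j).toNat * WittVector.frobenius x

theorem verschiebung_mul_verschiebung (a b : WittVector p R) :
    WittVector.verschiebung a * WittVector.verschiebung b =
      (p : WittVector p R) * WittVector.verschiebung (a * b) := by
  have h : WittVector.verschiebung (a * b * WittVector.frobenius (p : WittVector p R)) =
      WittVector.verschiebung (a * b) * p := WittVector.verschiebung_mul_frobenius _ _
  rw [map_natCast] at h
  rw [← WittVector.verschiebung_mul_frobenius, WittVector.frobenius_verschiebung, ← mul_assoc, h,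
    mul_comm]

theorem pow_mul_verschiebung (n : ℕ) (a : WittVector p R) :
    (p : WittVector p R) ^ n * WittVector.verschiebung a =
      WittVector.verschiebung ((p : WittVector p R) ^ n * a) := by
  have h := WittVector.verschiebung_mul_frobenius a ((p : WittVector p R) ^ n)
  rw [map_pow, map_natCast] at h
  rw [mul_comm, ← h, mul_comm a]

theorem tauVal_mul {i j : ℤ} {x y : WittVector p R} (hx : x ∈ fil p R i) (hy : y ∈ fil p R j) :
    tauVal (i + j) (filMulVal i j x y) = tauVal i x * tauVal j y := by
  unfold tauVal filMulVal
  split_ifs with h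
  · obtain ⟨a, rfl⟩ := exists_of_mem_fil h.1 hx
    obtain ⟨b, rfl⟩ := exists_of_mem_fil h.2 hy
    rw [verInv_verschiebung, verInv_verschiebung]
    have e : (i + j - 1).toNat = (i - 1).toNat + (j - 1).toNat + 1 := by omega
    rw [e, mul_mul_mul_comm, verschiebung_mul_verschiebung]
    ring
  · have e : (i - 1).toNat + (j - 1).toNat =
        (i + j - 1).toNat + ((i - 1).toNat + (j - 1).toNat - (i + j - 1).toNat) := by omega
    rw [mul_mul_mul_comm, ← pow_add, e, pow_add, Nat.add_sub_cancel_left]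
    ring

theorem filMulVal_comm (i j : ℤ) (x y : WittVector p R) :
    filMulVal i j x y = filMulVal j i y x := by
  unfold filMulVal
  rw [mul_comm (verInv x), mul_comm x, add_comm (i - 1).toNat, add_comm i j]
  exact if_congr and_comm rfl rfl

theorem sigmaVal_mul_aux {i j : ℤ} {x y : WittVector p R} (hi : i ≤ 0) (hy : y ∈ fil p R j) :
    sigmaVal (i + j) (filMulVal i j x y) = sigmaVal i x * sigmaVal j y := by
  have h : ¬ (0 < i ∧ 0 < j) := by omega
  unfold sigmaVal filMulVal
  rw [if_neg h, if_neg (not_lt.mpr hi)]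
  rcases lt_or_ge 0 j with hj | hj
  · obtain ⟨b, rfl⟩ := exists_of_mem_fil hj hy
    rw [if_pos hj, verInv_verschiebung]
    rcases lt_or_ge 0 (i + j) with hij | hij
    · rw [if_pos hij, mul_comm x, ← WittVector.verschiebung_mul_frobenius, pow_mul_verschiebung,
        verInv_verschiebung]
      have e : (i - 1).toNat + (j - 1).toNat - (i + j - 1).toNat = (-i).toNat := by omega
      rw [e]; ring
    · rw [if_neg (not_lt.mpr hij)]
      have e : (-i).toNat = (-(i + j)).toNat +
        ((i - 1).toNat + (j - 1).toNat - (i + j - 1).toNat) + 1 := by omega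
      rw [map_mul, map_mul, map_pow, map_natCast, WittVector.frobenius_verschiebung, e]
      ring
  · rw [if_neg (not_lt.mpr hj), if_neg (by omega)]
    have e : (i - 1).toNat + (j - 1).toNat - (i + j - 1).toNat = 0 := by omega
    have e' : (-(i + j)).toNat = (-i).toNat + (-j).toNat := by omega
    rw [e, e', map_mul, map_mul, map_pow]
    ring

theorem sigmaVal_mul {i j : ℤ} {x y : WittVector p R} (hx : x ∈ fil p R i) (hy : y ∈ fil p R j) :
    sigmaVal (i + j) (filMulVal i j x y) = sigmaVal i x * sigmaVal j y := by
  rcases le_or_gt i 0 with hi | hi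
  · exact sigmaVal_mul_aux hi hy
  · rcases le_or_gt j 0 with hj | hj
    · rw [filMulVal_comm, add_comm, sigmaVal_mul_aux hj hx, mul_comm]
    · obtain ⟨a, rfl⟩ := exists_of_mem_fil hi hx
      obtain ⟨b, rfl⟩ := exists_of_mem_fil hj hy
      simp only [sigmaVal, filMulVal, hi, hj, add_pos hi hj, and_self, if_true,
        verInv_verschiebung]

theorem fil_ext {j : ℤ} {x y : WittVector p R} (hx : x ∈ fil p R j) (hy : y ∈ fil p R j)
    (ht : tauVal j x = tauVal j y) (hs : sigmaVal j x = sigmaVal j y) : x = y := by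
  rcases le_or_gt j 0 with hj | hj
  · have e : (j - 1).toNat = 0 := by omega
    simpa [tauVal, e] using ht
  · obtain ⟨a, rfl⟩ := exists_of_mem_fil hj hx
    obtain ⟨b, rfl⟩ := exists_of_mem_fil hj hy
    simp only [sigmaVal, if_pos hj, verInv_verschiebung] at hs
    rw [hs]

theorem sigmaVal_add {j : ℤ} {x y : WittVector p R} (hx : x ∈ fil p R j) (hy : y ∈ fil p R j) :
    sigmaVal j (x + y) = sigmaVal j x + sigmaVal j y := by
  unfold sigmaVal
  split_ifs with h
  · obtain ⟨a, rfl⟩ := exists_of_mem_fil h hx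
    obtain ⟨b, rfl⟩ := exists_of_mem_fil h hy
    rw [← map_add, verInv_verschiebung, verInv_verschiebung, verInv_verschiebung]
  · rw [map_add, mul_add]

theorem tauVal_add (j : ℤ) (x y : WittVector p R) :
    tauVal j (x + y) = tauVal j x + tauVal j y := mul_add _ _ _

theorem filMulVal_add (i j : ℤ) {x y z : WittVector p R} (hx : x ∈ fil p R i)
    (hy : y ∈ fil p R j) (hz : z ∈ fil p R j) :
    filMulVal i j x (y + z) = filMulVal i j x y + filMulVal i j x z := by
  have hm := filMulVal_mem hx hy
  have hm' := filMulVal_mem hx hz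
  refine fil_ext (filMulVal_mem hx (add_mem hy hz)) (add_mem hm hm') ?_ ?_
  · rw [tauVal_mul hx (add_mem hy hz), tauVal_add, tauVal_add, tauVal_mul hx hy, tauVal_mul hx hz,
      mul_add]
  · rw [sigmaVal_mul hx (add_mem hy hz), sigmaVal_add hy hz, sigmaVal_add hm hm',
      sigmaVal_mul hx hy, sigmaVal_mul hx hz, mul_add]

theorem filMulVal_one (i : ℤ) (x : WittVector p R) :
    filMulVal i 0 x 1 = x := by
  have e : (i - 1).toNat + (0 - 1 : ℤ).toNat - (i + 0 - 1).toNat = 0 := by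
    rw [add_zero]; omega
  simp only [filMulVal, lt_irrefl, and_false, if_false, e, pow_zero, one_mul, mul_one]

theorem filMulVal_assoc {i j k : ℤ} {x y z : WittVector p R} (hx : x ∈ fil p R i)
    (hy : y ∈ fil p R j) (hz : z ∈ fil p R k) :
    filMulVal (i + j) k (filMulVal i j x y) z = filMulVal i (j + k) x (filMulVal j k y z) := by
  have h1 := filMulVal_mem hx hy
  have h2 := filMulVal_mem hy hz
  refine fil_ext (filMulVal_mem h1 hz) (add_assoc i j k ▸ filMulVal_mem hx h2) ?_ ?_
  · rw [tauVal_mul h1 hz, tauVal_mul hx hy, add_assoc, tauVal_mul hx h2, tauVal_mul hy hz,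
      mul_assoc]
  · rw [sigmaVal_mul h1 hz, sigmaVal_mul hx hy, add_assoc, sigmaVal_mul hx h2, sigmaVal_mul hy hz,
      mul_assoc]

theorem fil_gradedMonoid_ext {a b : GradedMonoid fun j : ℤ => fil p R j} (h : a.1 = b.1)
    (h' : (a.2 : WittVector p R) = b.2) : a = b := by
  obtain ⟨i, x⟩ := a
  obtain ⟨j, y⟩ := b
  obtain rfl : i = j := h
  obtain rfl : x = y := Subtype.ext h'
  rfl

instance filGMul : GradedMonoid.GMul fun j : ℤ => fil p R j where
  mul {i j} x y := ⟨filMulVal i j x y, filMulVal_mem x.2 y.2⟩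

instance filGOne : GradedMonoid.GOne fun j : ℤ => fil p R j where
  one := ⟨1, mem_fil_of_nonpos le_rfl 1⟩

instance filGCommRing : DirectSum.GCommRing fun j : ℤ => fil p R j where
  mul_zero {i j} x := Subtype.ext (by
    have h := filMulVal_add i j x.2 (zero_mem (fil p R j)) (zero_mem (fil p R j))
    rw [add_zero] at h
    exact left_eq_add.mp h)
  zero_mul {i j} y := Subtype.ext (by
    have h := filMulVal_add j i y.2 (zero_mem (fil p R i)) (zero_mem (fil p R i))
    rw [add_zero] at h
    exact (filMulVal_comm i j _ _).trans (left_eq_add.mp h))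
  mul_add {i j} x y z := Subtype.ext (filMulVal_add i j x.2 y.2 z.2)
  add_mul {i j} x y z := Subtype.ext (by
    have h := filMulVal_add j i z.2 x.2 y.2
    rw [filMulVal_comm, filMulVal_comm j i, filMulVal_comm j i] at h
    exact h)
  one_mul x := fil_gradedMonoid_ext (zero_add _)
    ((filMulVal_comm _ _ _ _).trans (filMulVal_one _ _))
  mul_one x := fil_gradedMonoid_ext (add_zero _) (filMulVal_one _ _)
  mul_assoc x y z := fil_gradedMonoid_ext (add_assoc _ _ _) (filMulVal_assoc x.2.2 y.2.2 z.2.2)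
  mul_comm x y := fil_gradedMonoid_ext (add_comm _ _) (filMulVal_comm _ _ _ _)
  natCast n := ⟨n, mem_fil_of_nonpos le_rfl _⟩
  natCast_zero := Subtype.ext Nat.cast_zero
  natCast_succ n := Subtype.ext (Nat.cast_succ n)
  intCast n := ⟨n, mem_fil_of_nonpos le_rfl _⟩
  intCast_ofNat n := Subtype.ext (Int.cast_natCast n)
  intCast_negSucc_ofNat n := Subtype.ext (Int.cast_negSucc n)

variable (p R)

/-- The Rees algebra `Rees(W(R)) = ⨁_{j ∈ ℤ} Fil^j`, a `ℤ`-graded commutative ring. -/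
def Rees : Type u := ⨁ j : ℤ, fil p R j

instance : CommRing (Rees p R) := inferInstanceAs (CommRing (⨁ j : ℤ, fil p R j))

/-- The inclusion of the homogeneous component `Fil^j` into the Rees algebra. -/
def Rees.of (j : ℤ) : fil p R j →+ Rees p R := DirectSum.of (fun j : ℤ => fil p R j) j

/-- The ring homomorphism `Rees(W(R)) → W(R)` obtained from the graded homomorphism
`Rees(W(R)) → W(R)[t, t⁻¹]` given by the natural maps `Fil^j → W(R)`, by setting `t = 1`. The
composite `Spec W(R) → Spec Rees(W(R)) → [𝔾_m \ Spec Rees(W(R))]` is the morphism `τ`. -/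
def tauHom : Rees p R →+* WittVector p R :=
  DirectSum.toSemiring (A := fun j : ℤ => fil p R j)
    (fun j => AddMonoidHom.mk' (fun x => tauVal j (x : WittVector p R))
      fun x y => tauVal_add j _ _)
    (by simp [tauVal, GradedMonoid.GOne.one])
    (fun x y => tauVal_mul x.2 y.2)

/-- The ring homomorphism `Rees(W(R)) → W(R)` obtained from the graded homomorphism
`Rees(W(R)) → W(R)[t, t⁻¹]` given by the divided Frobenius maps (so `t ↦ p t`), by setting `t = 1`.
The composite `Spec W(R) → Spec Rees(W(R)) → [𝔾_m \ Spec Rees(W(R))]` is the morphism `σ`. -/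
def sigmaHom : Rees p R →+* WittVector p R :=
  DirectSum.toSemiring (A := fun j : ℤ => fil p R j)
    (fun j => AddMonoidHom.mk' (fun x => sigmaVal j (x : WittVector p R))
      fun x y => sigmaVal_add x.2 y.2)
    (by simp [sigmaVal, GradedMonoid.GOne.one])
    (fun x y => sigmaVal_mul x.2 y.2)

variable {R' : Type u} [CommRing R'] {p R}

theorem map_mem_fil (f : R →+* R') {j : ℤ} {x : WittVector p R} (hx : x ∈ fil p R j) :
    WittVector.map f x ∈ fil p R' j := by
  rcases le_or_gt j 0 with hj | hj
  · exact mem_fil_of_nonpos hj _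
  · obtain ⟨a, rfl⟩ := exists_of_mem_fil hj hx
    rw [WittVector.map_verschiebung]
    exact verschiebung_mem_fil _ _

theorem map_filMulVal (f : R →+* R') {i j : ℤ} {x y : WittVector p R} (hx : x ∈ fil p R i)
    (hy : y ∈ fil p R j) : WittVector.map f (filMulVal i j x y) =
      filMulVal i j (WittVector.map f x) (WittVector.map f y) := by
  unfold filMulVal
  split_ifs with h
  · obtain ⟨a, rfl⟩ := exists_of_mem_fil h.1 hx
    obtain ⟨b, rfl⟩ := exists_of_mem_fil h.2 hy
    simp only [verInv_verschiebung, WittVector.map_verschiebung, map_mul]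
  · simp only [map_mul, map_pow, map_natCast]

/-- The graded ring homomorphism `Rees(W(R)) → Rees(W(R'))` induced by `f : R → R'`. -/
def reesMap (f : R →+* R') : Rees p R →+* Rees p R' :=
  DirectSum.toSemiring (A := fun j : ℤ => fil p R j)
    (fun j => AddMonoidHom.mk' (fun x => Rees.of p R' j ⟨WittVector.map f x, map_mem_fil f x.2⟩)
      fun x y => by
        rw [← map_add]
        congr 1
        exact Subtype.ext (map_add (WittVector.map f) _ _))
    (by
      change _ = DirectSum.of (fun j : ℤ => fil p R' j) 0 _
      refine congrArg (DirectSum.of (fun j : ℤ => fil p R' j) 0) (Subtype.ext ?_)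
      exact map_one (WittVector.map f))
    (fun {i j} x y => by
      refine Eq.trans ?_ (DirectSum.of_mul_of (A := fun j : ℤ => fil p R' j) _ _).symm
      exact congrArg (DirectSum.of (fun j : ℤ => fil p R' j) (i + j))
        (Subtype.ext (map_filMulVal f x.2 y.2)))

end ReesAlgebra

section ScalarExtension

variable {A A' : Type u} [CommRing A] [CommRing A']

/-- Extension of scalars `M ↦ A' ⊗_A M` along `f : A → A'`. -/
abbrev pull (f : A →+* A') : ModuleCat.{u} A ⥤ ModuleCat.{u} A' := ModuleCat.extendScalars f

open scoped ChangeOfRings in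
/-- The canonical map `M → A' ⊗_A M, m ↦ 1 ⊗ m`. -/
def pullUnit (f : A →+* A') (M : ModuleCat.{u} A) : M →ₛₗ[f] (pull f).obj M where
  toFun m := (1 : A') ⊗ₜ[A,f] m
  map_add' x y := (((ModuleCat.extendRestrictScalarsAdj f).unit.app M).hom.map_add x y)
  map_smul' a x := (((ModuleCat.extendRestrictScalarsAdj f).unit.app M).hom.map_smul a x)

/-- A semilinear map `g : M → M'` over `f : A → A'` that exhibits `M'` as the scalar extension
of `M`, expressed by its universal property. -/
def IsScalarExtension {f : A →+* A'} {M M' : Type u} [AddCommGroup M] [AddCommGroup M']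
    [Module A M] [Module A' M'] (g : M →ₛₗ[f] M') : Prop :=
  ∀ (Q : Type u) [AddCommGroup Q] [Module A' Q] (k : M →ₛₗ[f] Q),
    ∃! l : M' →ₗ[A'] Q, ∀ m, l (g m) = k m

end ScalarExtension

section IsoInserter

variable {C D : Type*} [Category* C] [Category* D]

/-- The category of pairs `(X, Φ)` of an object `X` of `C` and an isomorphism `Φ : S X ≅ T X`,
i.e. the (2-categorical) equalizer of the functors `S, T : C ⥤ D`. -/
structure IsoInserter (S T : C ⥤ D) where
  obj : C
  iso : S.obj obj ≅ T.obj obj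

namespace IsoInserter

variable {S T : C ⥤ D}

/-- A morphism `(X, Φ) → (Y, Φ')` is a morphism `f : X → Y` with `T(f) ∘ Φ = Φ' ∘ S(f)`. -/
@[ext]
structure Hom (X Y : IsoInserter S T) where
  hom : X.obj ⟶ Y.obj
  comm : S.map hom ≫ Y.iso.hom = X.iso.hom ≫ T.map hom

instance : Category (IsoInserter S T) where
  Hom := Hom
  id X := ⟨𝟙 _, by simp⟩
  comp f g := ⟨f.hom ≫ g.hom, by
    rw [S.map_comp, T.map_comp, Category.assoc, g.comm, ← Category.assoc, f.comm,
      Category.assoc]⟩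
  id_comp f := Hom.ext (Category.id_comp _)
  comp_id f := Hom.ext (Category.comp_id _)
  assoc f g k := Hom.ext (Category.assoc _ _ _)

variable (S T) in
/-- The forgetful functor `(X, Φ) ↦ X`. -/
def forget : IsoInserter S T ⥤ C where
  obj X := X.obj
  map f := f.hom

end IsoInserter

end IsoInserter

section ReesBundles

variable (p : ℕ) [Fact p.Prime] (R : Type u) [CommRing R]

/-- A quasi-coherent module on the Rees--Witt stack `Re(W(R)) = [𝔾_m \ Spec Rees(W(R))]`,
i.e. a `ℤ`-graded `Rees(W(R))`-module. -/
structure ReesModule where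
  carrier : Type u
  [addCommGroup : AddCommGroup carrier]
  [module : Module (Rees p R) carrier]
  deg : ℤ → AddSubgroup carrier
  isInternal : DirectSum.IsInternal deg
  smul_mem : ∀ (i j : ℤ) (b : fil p R i) (n : carrier), n ∈ deg j →
    Rees.of p R i b • n ∈ deg (i + j)

attribute [instance] ReesModule.addCommGroup ReesModule.module

namespace ReesModule

variable {p R}

/-- Morphisms of quasi-coherent modules: `Rees(W(R))`-linear maps of degree `0`. -/
@[ext]
structure Hom (N N' : ReesModule p R) where
  lin : N.carrier →ₗ[Rees p R] N'.carrier
  map_deg : ∀ (j : ℤ) (n : N.carrier), n ∈ N.deg j → lin n ∈ N'.deg j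

instance : Category (ReesModule p R) where
  Hom := Hom
  id N := ⟨LinearMap.id, fun _ _ hn => hn⟩
  comp f g := ⟨g.lin.comp f.lin, fun j n hn => g.map_deg j _ (f.map_deg j n hn)⟩

variable (p R) in
/-- The underlying `Rees(W(R))`-module, i.e. the pullback to `Spec Rees(W(R))`. -/
def toModuleCat : ReesModule p R ⥤ ModuleCat.{u} (Rees p R) where
  obj N := ModuleCat.of (Rees p R) N.carrier
  map f := ModuleCat.ofHom f.lin

/-- `N` is of type `μ_d`, i.e. étale locally on `Re(W(R))` isomorphic to `𝒪^d ⊕ 𝒪(1)^{h-d}`: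
there are a `ℤ`-graded étale faithfully flat `Rees(W(R))`-algebra `B`, that is, an étale covering `[𝔾_m \ Spec B]` of
`Re(W(R))`, and a `B`-linear isomorphism `B ⊗ N ≅ B^d ⊕ B(1)^{h-d}` of graded modules,
where `B(1)_j = B_{j+1}`. -/
def IsOfType (N : ReesModule p R) (h d : ℕ) : Prop :=
  ∃ (B : Type u) (_ : CommRing B) (_ : Algebra (Rees p R) B) (𝓑 : ℤ → AddSubgroup B),
    SetLike.GradedMonoid 𝓑 ∧ DirectSum.IsInternal 𝓑 ∧
    (∀ (i : ℤ) (b : fil p R i), algebraMap (Rees p R) B (Rees.of p R i b) ∈ 𝓑 i) ∧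
    Algebra.Etale (Rees p R) B ∧ Module.FaithfullyFlat (Rees p R) B ∧
    ∃ e : (B ⊗[Rees p R] N.carrier) ≃ₗ[B] ((Fin d → B) × (Fin (h - d) → B)),
      ∀ (j : ℤ) (n : N.carrier), n ∈ N.deg j →
        (∀ k, (e (1 ⊗ₜ n)).1 k ∈ 𝓑 j) ∧ (∀ k, (e (1 ⊗ₜ n)).2 k ∈ 𝓑 (j + 1))

/-- Vector bundles of rank `h` and of type `μ_d` on `Re(W(R))`. -/
def isBundle (h d : ℕ) : ObjectProperty (ReesModule p R) := fun N =>
  Module.Finite (Rees p R) N.carrier ∧ Module.Projective (Rees p R) N.carrier ∧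
  (∀ 𝔭 : PrimeSpectrum (Rees p R), Module.rankAtStalk N.carrier 𝔭 = h) ∧ N.IsOfType h d

end ReesModule

variable (h d : ℕ)

/-- The category of vector bundles of rank `h` and of type `μ_d` on `Re(W(R))`. -/
abbrev ReesBundle := (ReesModule.isBundle (p := p) (R := R) h d).FullSubcategory

/-- Pullback of vector bundles along `τ : Spec W(R) → Re(W(R))`. -/
def tauPull : ReesBundle p R h d ⥤ ModuleCat.{u} (WittVector p R) :=
  ObjectProperty.ι _ ⋙ ReesModule.toModuleCat p R ⋙ pull (tauHom p R)

/-- Pullback of vector bundles along `σ : Spec W(R) → Re(W(R))`. -/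
def sigmaPull : ReesBundle p R h d ⥤ ModuleCat.{u} (WittVector p R) :=
  ObjectProperty.ι _ ⋙ ReesModule.toModuleCat p R ⋙ pull (sigmaHom p R)

/-- The category of vector bundles of rank `h` and of type `μ_d` on the coequalizer `R^Disp`
of `σ` and `τ`: pairs of a vector bundle `N` on `Re(W(R))` and an isomorphism `σ^* N ≅ τ^* N`. -/
abbrev DispBundle := IsoInserter (sigmaPull p R h d) (tauPull p R h d)

end ReesBundles

section Pairs

variable (p : ℕ) [Fact p.Prime] (R : Type u) [CommRing R] (h d : ℕ)

/-- The Frobenius endomorphism `φ` of `W(R)`. -/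
abbrev frob : WittVector p R →+* WittVector p R := WittVector.frobenius

/-- A pair of type `(h, d)` over `R`. The condition on `M₁` modulo `I_R M` is stated over
`W(R)/I_R ≅ R`. -/
structure Pair where
  carrier : Type u
  [addCommGroup : AddCommGroup carrier]
  [module : Module (WittVector p R) carrier]
  finite : Module.Finite (WittVector p R) carrier
  projective : Module.Projective (WittVector p R) carrier
  rank_eq : ∀ 𝔭 : PrimeSpectrum (WittVector p R), Module.rankAtStalk carrier 𝔭 = h
  sub : Submodule (WittVector p R) carrier
  smul_le : augIdeal p R • (⊤ : Submodule (WittVector p R) carrier) ≤ sub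
  /-- `M₁ / I_R M ⊆ M / I_R M` has a complement. -/
  exists_isCompl : ∃ C : Submodule (WittVector p R ⧸ augIdeal p R)
      (carrier ⧸ augIdeal p R • (⊤ : Submodule (WittVector p R) carrier)),
    IsCompl (Submodule.span (WittVector p R ⧸ augIdeal p R)
      ((augIdeal p R • (⊤ : Submodule (WittVector p R) carrier)).mkQ '' sub)) C
  /-- `M₁ / I_R M` has rank `d`. -/
  sub_rank_eq : ∀ 𝔭 : PrimeSpectrum (WittVector p R ⧸ augIdeal p R),
    Module.rankAtStalk (Submodule.span (WittVector p R ⧸ augIdeal p R)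
      ((augIdeal p R • (⊤ : Submodule (WittVector p R) carrier)).mkQ '' sub)) 𝔭 = d

attribute [instance] Pair.addCommGroup Pair.module

namespace Pair

variable {p R h d}

/-- Morphisms `(M, M₁) → (M', M₁')`: linear maps `f : M → M'` with `f(M₁) ⊆ M₁'`. -/
@[ext]
structure Hom (P P' : Pair p R h d) where
  lin : P.carrier →ₗ[WittVector p R] P'.carrier
  map_sub : ∀ m ∈ P.sub, lin m ∈ P'.sub

instance : Category (Pair p R h d) where
  Hom := Hom
  id P := ⟨LinearMap.id, fun _ hm => hm⟩
  comp f g := ⟨g.lin.comp f.lin, fun m hm => g.map_sub _ (f.map_sub m hm)⟩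

variable (p R h d) in
/-- The functor `(M, M₁) ↦ M`. -/
def forget : Pair p R h d ⥤ ModuleCat.{u} (WittVector p R) where
  obj P := ModuleCat.of _ P.carrier
  map f := ModuleCat.ofHom f.lin

theorem verschiebung_smul_mem (P : Pair p R h d) (x : WittVector p R) (m : P.carrier) :
    WittVector.verschiebung x • m ∈ P.sub :=
  P.smul_le (Submodule.smul_mem_smul ⟨x, rfl⟩ trivial)

/-- The module `φ^* (M₁ ⊕ M) = M₁^φ ⊕ M^φ`. -/
abbrev frobSum (P : Pair p R h d) : ModuleCat.{u} (WittVector p R) :=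
  (pull (frob p R)).obj (ModuleCat.of (WittVector p R) (P.sub × P.carrier))

/-- The canonical map `M₁ ⊕ M → M₁^φ ⊕ M^φ`. -/
abbrev frobSumUnit (P : Pair p R h d) :
    (P.sub × P.carrier) →ₛₗ[frob p R] P.frobSum :=
  pullUnit (frob p R) (ModuleCat.of (WittVector p R) (P.sub × P.carrier))

/-- The submodule of relations `1 ⊗ V(x)m = x ⊗ m` in `M₁^φ ⊕ M^φ`. -/
def tildeRel (P : Pair p R h d) : Submodule (WittVector p R) P.frobSum :=
  Submodule.span _ {z | ∃ (x : WittVector p R) (m : P.carrier),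
    z = P.frobSumUnit (⟨WittVector.verschiebung x • m, P.verschiebung_smul_mem x m⟩, 0) -
      x • P.frobSumUnit (0, m)}

/-- The module `M̃₁`: the quotient of `M₁^φ ⊕ M^φ` by the relations
`1 ⊗ V(x)m = x ⊗ m` for `x ∈ W(R)` and `m ∈ M`. -/
def tildeObj (P : Pair p R h d) : ModuleCat.{u} (WittVector p R) :=
  ModuleCat.of _ (P.frobSum ⧸ P.tildeRel)

/-- The canonical `φ`-linear map `M₁ → M̃₁`. -/
def tildeOne (P : Pair p R h d) : P.sub →ₛₗ[frob p R] P.tildeObj :=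
  P.tildeRel.mkQ.comp (P.frobSumUnit.comp (LinearMap.inl (WittVector p R) P.sub P.carrier))

/-- The canonical `φ`-linear map `M → M̃₁`. -/
def tildeZero (P : Pair p R h d) : P.carrier →ₛₗ[frob p R] P.tildeObj :=
  P.tildeRel.mkQ.comp (P.frobSumUnit.comp (LinearMap.inr (WittVector p R) P.sub P.carrier))

/-- The map `M₁ ⊕ M → M₁' ⊕ M'` induced by a morphism of pairs. -/
def Hom.sumMap {P P' : Pair p R h d} (f : P ⟶ P') :
    (P.sub × P.carrier) →ₗ[WittVector p R] (P'.sub × P'.carrier) :=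
  (f.lin.restrict f.map_sub).prodMap f.lin

/-- The map `M₁^φ ⊕ M^φ → M₁'^φ ⊕ M'^φ` induced by a morphism of pairs. -/
def Hom.frobSumMap {P P' : Pair p R h d} (f : P ⟶ P') :
    P.frobSum →ₗ[WittVector p R] P'.frobSum :=
  ((pull (frob p R)).map (ModuleCat.ofHom (Hom.sumMap f))).hom

theorem Hom.frobSumMap_unit {P P' : Pair p R h d} (f : P ⟶ P') (z : P.sub × P.carrier) :
    Hom.frobSumMap f (P.frobSumUnit z) = P'.frobSumUnit (Hom.sumMap f z) := rfl

theorem Hom.tildeRel_le {P P' : Pair p R h d} (f : P ⟶ P') :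
    P.tildeRel ≤ P'.tildeRel.comap (Hom.frobSumMap f) := by
  refine Submodule.span_le.mpr ?_
  rintro _ ⟨x, m, rfl⟩
  refine Submodule.subset_span ⟨x, f.lin m, ?_⟩
  rw [_root_.map_sub, map_smul, Hom.frobSumMap_unit, Hom.frobSumMap_unit]
  refine congrArg₂ (fun a b => a - x • b) (congrArg P'.frobSumUnit (Prod.ext (Subtype.ext ?_) ?_))
    (congrArg P'.frobSumUnit (Prod.ext ?_ rfl))
  · exact map_smul f.lin _ _
  · exact map_zero f.lin
  · exact map_zero (f.lin.restrict f.map_sub)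

variable (p R h d) in
/-- The functor `(M, M₁) ↦ M̃₁`. -/
def tilde : Pair p R h d ⥤ ModuleCat.{u} (WittVector p R) where
  obj P := P.tildeObj
  map {P P'} f := ModuleCat.ofHom
    (P.tildeRel.mapQ P'.tildeRel (Hom.frobSumMap f) (Hom.tildeRel_le f))
  map_id P := by
    refine ModuleCat.hom_ext (Submodule.linearMap_qext _ (LinearMap.ext fun x => ?_))
    exact congrArg P.tildeRel.mkQ (congrArg (fun k => k.hom x)
      ((pull (frob p R)).map_id (ModuleCat.of (WittVector p R) (P.sub × P.carrier))))
  map_comp {P P' P''} f g := by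
    refine ModuleCat.hom_ext (Submodule.linearMap_qext _ (LinearMap.ext fun x => ?_))
    exact congrArg P''.tildeRel.mkQ (congrArg (fun k => k.hom x)
      ((pull (frob p R)).map_comp (ModuleCat.ofHom (Hom.sumMap f))
        (ModuleCat.ofHom (Hom.sumMap g))))

end Pair

end Pairs

section NormalDecomposition

variable {p : ℕ} [Fact p.Prime] {R : Type u} [CommRing R] {h d : ℕ}

/-- A normal decomposition `M = L ⊕ T`, `M₁ = L ⊕ I_R T` of a pair `(M, M₁)`. -/
structure Pair.IsNormal (P : Pair p R h d) (L T : Submodule (WittVector p R) P.carrier) :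
    Prop where
  isCompl : IsCompl L T
  sub_eq : P.sub = L ⊔ augIdeal p R • T

/-- The Frobenius twist `L^φ = W(R) ⊗_{φ, W(R)} L` of a submodule. -/
abbrev frobTwist {M : Type u} [AddCommGroup M] [Module (WittVector p R) M]
    (L : Submodule (WittVector p R) M) : ModuleCat.{u} (WittVector p R) :=
  (pull (frob p R)).obj (ModuleCat.of (WittVector p R) L)

/-- The canonical map `L → L^φ, l ↦ 1 ⊗ l`. -/
abbrev twistUnit {M : Type u} [AddCommGroup M] [Module (WittVector p R) M]
    (L : Submodule (WittVector p R) M) : L →ₛₗ[frob p R] frobTwist L :=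
  pullUnit (frob p R) (ModuleCat.of (WittVector p R) L)

/-- `θ : M̃₁ ≅ L^φ ⊕ T^φ` is the identification given by a normal decomposition: it sends the
image of `l ∈ L ⊆ M₁` to `1 ⊗ l` and the image of `t ∈ T ⊆ M` to `1 ⊗ t`. -/
def Pair.IsNormalCoord (P : Pair p R h d) (L T : Submodule (WittVector p R) P.carrier)
    (θ : P.tildeObj ≃ₗ[WittVector p R] (frobTwist L × frobTwist T)) : Prop :=
  (∀ (l : L) (hl : (l : P.carrier) ∈ P.sub), θ (P.tildeOne ⟨l, hl⟩) = (twistUnit L l, 0)) ∧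
  ∀ t : T, θ (P.tildeZero t) = (0, twistUnit T t)

/-- In the coordinates `θ, θ'` given by normal decompositions, the map `M̃₁ → M̃₁'` induced by a
morphism of pairs with matrix `(a b; c e)` has the matrix `(a^φ  p b^φ; ċ  e^φ)`, where
`ċ(1 ⊗ l) = ∑ yᵢ ⊗ xᵢ` if `c(l) = ∑ V(yᵢ) xᵢ` with `xᵢ ∈ T'`. -/
def Pair.HasMatrix {P P' : Pair p R h d} (f : P ⟶ P')
    {L T : Submodule (WittVector p R) P.carrier} {L' T' : Submodule (WittVector p R) P'.carrier}
    (θ : P.tildeObj ≃ₗ[WittVector p R] (frobTwist L × frobTwist T))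
    (θ' : P'.tildeObj ≃ₗ[WittVector p R] (frobTwist L' × frobTwist T')) : Prop :=
  (∀ (l : L) (a : L') (n : ℕ) (y : Fin n → WittVector p R) (x : Fin n → T'),
    f.lin l = a + ∑ i, WittVector.verschiebung (y i) • (x i : P'.carrier) →
    θ' (((Pair.tilde p R h d).map f).hom (θ.symm (twistUnit L l, 0))) =
      (twistUnit L' a, ∑ i, y i • twistUnit T' (x i))) ∧
  ∀ (t : T) (b : L') (e : T'), f.lin t = b + e →
    θ' (((Pair.tilde p R h d).map f).hom (θ.symm (0, twistUnit T t))) =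
      ((p : WittVector p R) • twistUnit L' b, twistUnit T' e)

end NormalDecomposition

section Comparison

variable (p : ℕ) [Fact p.Prime] (R : Type u) [CommRing R] (h d : ℕ)

/-- The category of displays `(M, M₁, Ψ : M̃₁ ≅ M)` of type `(h, d)` over `R`. -/
abbrev Display := IsoInserter (Pair.tilde p R h d) (Pair.forget p R h d)

/-- The data of functors from vector bundles on `Re(W(R))` to pairs and from vector bundles on
`R^Disp` to displays, together with identifications of the pullback along `τ` with
`(M, M₁) ↦ M`, of the pullback along `σ` with `(M, M₁) ↦ M̃₁`, and of the pullback along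
`Re(W(R)) → R^Disp` with `(M, M₁, Ψ) ↦ (M, M₁)`. -/
structure Comparison where
  toPair : ReesBundle p R h d ⥤ Pair p R h d
  toDisplay : DispBundle p R h d ⥤ Display p R h d
  tau : tauPull p R h d ≅ toPair ⋙ Pair.forget p R h d
  sigma : sigmaPull p R h d ≅ toPair ⋙ Pair.tilde p R h d
  under : IsoInserter.forget (sigmaPull p R h d) (tauPull p R h d) ⋙ toPair ≅
    toDisplay ⋙ IsoInserter.forget (Pair.tilde p R h d) (Pair.forget p R h d)

variable {p R h d}

/-- Under the identifications, the gluing isomorphism `Φ : σ^* N ≅ τ^* N` of a vector bundle on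
`R^Disp` corresponds to `Ψ : M̃₁ ≅ M`. -/
def Comparison.IsGluingCompatible (C : Comparison p R h d) : Prop :=
  ∀ X : DispBundle p R h d,
    X.iso.hom ≫ C.tau.hom.app X.obj ≫ (Pair.forget p R h d).map (C.under.hom.app X) =
      C.sigma.hom.app X.obj ≫ (Pair.tilde p R h d).map (C.under.hom.app X) ≫
        (C.toDisplay.obj X).iso.hom

/-- The map `N → M, n ↦ 1 ⊗ n` via `τ^* N ≅ M`, for `(M, M₁)` the pair attached to `N`. -/
def Comparison.tauPt (C : Comparison p R h d) (N : ReesBundle p R h d) (n : N.obj.carrier) :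
    (C.toPair.obj N).carrier :=
  (C.tau.hom.app N).hom
    (pullUnit (tauHom p R) ((ReesModule.toModuleCat p R).obj N.obj) n)

/-- The map `N → M̃₁, n ↦ 1 ⊗ n` via `σ^* N ≅ M̃₁`, for `(M, M₁)` the pair attached to `N`. -/
def Comparison.sigmaPt (C : Comparison p R h d) (N : ReesBundle p R h d) (n : N.obj.carrier) :
    (C.toPair.obj N).tildeObj :=
  (C.sigma.hom.app N).hom
    (pullUnit (sigmaHom p R) ((ReesModule.toModuleCat p R).obj N.obj) n)

/-- The map `N → M, n ↦ 1 ⊗ n`, for `(M, M₁, Ψ)` the display attached to `(N, Φ)`. -/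
def Comparison.dispPt (C : Comparison p R h d) (X : DispBundle p R h d)
    (n : X.obj.obj.carrier) : (C.toDisplay.obj X).obj.carrier :=
  (C.under.hom.app X).lin (C.tauPt X.obj n)

variable {R' : Type u} [CommRing R'] {f : R →+* R'}

/-- A semilinear map `N → N'` over `Rees(W(R)) → Rees(W(R'))` is a map from `N` to `N'` over the
morphism `Re(W(R')) → Re(W(R))` if it preserves degrees. -/
def IsBundleMap {N : ReesBundle p R h d} {N' : ReesBundle p R' h d}
    (g : N.obj.carrier →ₛₗ[reesMap (p := p) f] N'.obj.carrier) : Prop :=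
  ∀ (j : ℤ) (n : N.obj.carrier), n ∈ N.obj.deg j → g n ∈ N'.obj.deg j

/-- A map `(N, Φ) → (N', Φ')` of vector bundles over `R'^Disp → R^Disp`: a map `g : N → N'` whose
pullbacks along `σ` and `τ` commute with `Φ` and `Φ'`. -/
def IsDispBundleMap {X : DispBundle p R h d} {X' : DispBundle p R' h d}
    (g : X.obj.obj.carrier →ₛₗ[reesMap (p := p) f] X'.obj.obj.carrier) : Prop :=
  IsBundleMap g ∧
  ∃ (s : (sigmaPull p R h d).obj X.obj →ₛₗ[WittVector.map (p := p) f]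
        (sigmaPull p R' h d).obj X'.obj)
    (t : (tauPull p R h d).obj X.obj →ₛₗ[WittVector.map (p := p) f]
        (tauPull p R' h d).obj X'.obj),
    (∀ n, s (pullUnit (sigmaHom p R) ((ReesModule.toModuleCat p R).obj X.obj.obj) n) =
      pullUnit (sigmaHom p R') ((ReesModule.toModuleCat p R').obj X'.obj.obj) (g n)) ∧
    (∀ n, t (pullUnit (tauHom p R) ((ReesModule.toModuleCat p R).obj X.obj.obj) n) =
      pullUnit (tauHom p R') ((ReesModule.toModuleCat p R').obj X'.obj.obj) (g n)) ∧
    ∀ z, X'.iso.hom.hom (s z) = t (X.iso.hom.hom z)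

/-- A semilinear map `γ : M → M'` with `γ(M₁) ⊆ M₁'`, and the map `k : M̃₁ → M̃₁'` induced by it. -/
def IsPairMap {P : Pair p R h d} {P' : Pair p R' h d}
    (γ : P.carrier →ₛₗ[WittVector.map (p := p) f] P'.carrier)
    (k : P.tildeObj →ₛₗ[WittVector.map (p := p) f] P'.tildeObj) : Prop :=
  (∀ m : P.sub, ∃ hm : γ m ∈ P'.sub, k (P.tildeOne m) = P'.tildeOne ⟨γ m, hm⟩) ∧
  ∀ m : P.carrier, k (P.tildeZero m) = P'.tildeZero (γ m)

/-- `γ` exhibits `(M', M₁')` as the base change of `(M, M₁)`: `M' = W(R') ⊗ M`, and `M₁'` is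
generated by the image of `M₁` and by `I_{R'} M'`. -/
def IsPairBaseChange {P : Pair p R h d} {P' : Pair p R' h d}
    (γ : P.carrier →ₛₗ[WittVector.map (p := p) f] P'.carrier) : Prop :=
  IsScalarExtension γ ∧
  P'.sub = Submodule.span (WittVector p R') (γ '' P.sub) ⊔
    augIdeal p R' • (⊤ : Submodule (WittVector p R') P'.carrier)

variable (f) in
/-- Compatibility of the comparisons for `R` and `R'` with base change along `f : R → R'`: every map
between vector bundles over `f` induces, via the identifications along `τ` and `σ`, a map between
the associated pairs (displays), and base changes correspond to base changes. -/
def Comparison.IsNatural (C : Comparison p R h d) (C' : Comparison p R' h d) : Prop :=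
  (∀ (N : ReesBundle p R h d) (N' : ReesBundle p R' h d)
    (g : N.obj.carrier →ₛₗ[reesMap (p := p) f] N'.obj.carrier), IsBundleMap g →
    ∃ (γ : (C.toPair.obj N).carrier →ₛₗ[WittVector.map (p := p) f] (C'.toPair.obj N').carrier)
      (k : (C.toPair.obj N).tildeObj →ₛₗ[WittVector.map (p := p) f]
        (C'.toPair.obj N').tildeObj),
      IsPairMap γ k ∧
      (∀ n, γ (C.tauPt N n) = C'.tauPt N' (g n)) ∧
      (∀ n, k (C.sigmaPt N n) = C'.sigmaPt N' (g n)) ∧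
      (IsScalarExtension g → IsPairBaseChange γ)) ∧
  ∀ (X : DispBundle p R h d) (X' : DispBundle p R' h d)
    (g : X.obj.obj.carrier →ₛₗ[reesMap (p := p) f] X'.obj.obj.carrier), IsDispBundleMap g →
    ∃ (γ : (C.toDisplay.obj X).obj.carrier →ₛₗ[WittVector.map (p := p) f]
        (C'.toDisplay.obj X').obj.carrier)
      (k : (C.toDisplay.obj X).obj.tildeObj →ₛₗ[WittVector.map (p := p) f]
        (C'.toDisplay.obj X').obj.tildeObj),
      IsPairMap γ k ∧
      (∀ z, (C'.toDisplay.obj X').iso.hom.hom (k z) = γ ((C.toDisplay.obj X).iso.hom.hom z)) ∧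
      (∀ n, γ (C.dispPt X n) = C'.dispPt X' (g n)) ∧
      (IsScalarExtension g → IsPairBaseChange γ)

end Comparison

end WittDisplay

end

/-! Write W = W(R), I = I_R and B for the Rees algebra. The core of the proof is a structure
statement: a vector bundle of type μ_d is a graded module (B ⊗ L) ⊕ (B ⊗ T)(1), with L and T finite
projective over W of ranks d and h - d, so that L is placed in degree 0 and T in degree -1. Then
τ^*N = L ⊕ T, and the image of N_0 in it is L ⊕ I T, because the elements of degree 1 of B are the
V(y). Thus (τ^*N, N_0) is a pair. A graded map between two such modules is a block matrix whose
entries have degrees 0, 1 and -1 in B, that is, lie in W, I and W; these are exactly the morphisms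
of pairs.

Projective modules are handled by dual bases and their idempotent Gram matrices (`Frame`). The input
on Witt vectors is that W is I-adically complete: V(a)V(b) = pV(ab) gives I^{n+1} = p^n I, and p^n
tends to 0 in each W_m(R/p^k). Hence idempotent matrices lift from W/I to W, and I lies in the
Jacobson radical. The graded map B → W/I that kills the nonzero degrees detects invertibility of
degree-preserving matrices, since their determinants lie in B_0 = W. So the Gram matrix of a graded
bundle can be conjugated to one with entries in W that is block diagonal by degree
(`GradedFrame.exists_blockDiagonal`).

The type condition enters only at residue fields k of W, seen as B-algebras on which the nonzero
degrees act by zero. There an étale graded cover becomes a finite reduced k-algebra, on which the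
connected group 𝔾_m can only act trivially (`one_tmul_eq_zero_of_mem`). Hence only the degrees 0 and
-1 survive, with ranks d and h - d, and these ranks spread out from the residue fields
(`HasResidualRank.isLocRank`). On the side of pairs, a complement modulo I lifts to a normal
decomposition, again by lifting an idempotent.

For σ one compares formulas: on B_0, B_{-1} and B_1 the map σ is φτ, pφτ and V^{-1}τ. These are the
coefficients that express the canonical maps M₁ → M̃₁ and M → M̃₁ in a normal decomposition, so
there is a unique isomorphism σ^*N ≅ M̃₁ with prescribed values on N_0 and N_{-1}
(`NormalFrame.exists_sigmaEquiv`). Uniqueness makes it natural, also for semilinear maps over R →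
R'. The equivalence with displays is then formal: an equivalence compatible with two functors
induces one on the categories of objects with a gluing isomorphism. -/

noncomputable section
namespace WittDisplay

/-! ### Completeness of W(R) along I_R. -/

section WittComplete

variable (p : ℕ) [Fact p.Prime] {R : Type u} [CommRing R]

/-- The reduction map `W(R) → W_m(R / p^k)`. -/
def redHom (k m : ℕ) :
    WittVector p R →+* TruncatedWittVector p m (R ⧸ Ideal.span {(p : R)} ^ k) :=
  (WittVector.truncate m).comp (WittVector.map (Ideal.Quotient.mk (Ideal.span {(p : R)} ^ k)))

variable {p}

theorem redHom_eq_iff {k m : ℕ} {x y : WittVector p R} :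
    redHom p k m x = redHom p k m y ↔
      ∀ i < m, x.coeff i - y.coeff i ∈ Ideal.span {(p : R)} ^ k := by
  constructor
  · intro h i hi
    have h' := congrArg (TruncatedWittVector.coeff ⟨i, hi⟩) h
    simp only [redHom, RingHom.comp_apply, WittVector.coeff_truncate, WittVector.map_coeff] at h'
    exact Ideal.Quotient.eq.mp h'
  · intro h
    refine TruncatedWittVector.ext fun i => ?_
    simp only [redHom, RingHom.comp_apply, WittVector.coeff_truncate, WittVector.map_coeff]
    exact Ideal.Quotient.eq.mpr (h i i.2)

theorem redHom_verschiebung {k m : ℕ} {x y : WittVector p R}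
    (h : redHom p k m x = redHom p k m y) :
    redHom p k m (WittVector.verschiebung x) = redHom p k m (WittVector.verschiebung y) := by
  rw [redHom_eq_iff] at h ⊢
  rintro (_ | i) hi
  · simp
  · simpa using h i (by omega)

/-- The Witt vector p^k has zeroth coefficient p^k = 0, hence is of the form V(c), and then p^k y =
V(c φ(y)). As V commutes with multiplication by p, this can be repeated m times. -/
theorem exists_pow_mul_eq_iterate_verschiebung {A : Type u} [CommRing A] {k : ℕ}
    (hk : (p : A) ^ k = 0) (m : ℕ) (y : WittVector p A) :
    ∃ z : WittVector p A,
      (p : WittVector p A) ^ (k * m) * y = WittVector.verschiebung^[m] z := by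
  have key : ∀ y : WittVector p A, ∃ z : WittVector p A,
      (p : WittVector p A) ^ k * y = WittVector.verschiebung z := by
    intro y
    have h0 : ((p : WittVector p A) ^ k).coeff 0 = 0 := by
      have := map_pow (WittVector.constantCoeff (p := p) (R := A)) (p : WittVector p A) k
      rw [map_natCast, hk] at this
      exact this
    have h1 : (p : WittVector p A) ^ k =
        WittVector.verschiebung (((p : WittVector p A) ^ k).shift 1) := by
      simpa using WittVector.eq_iterate_verschiebung (x := (p : WittVector p A) ^ k) (n := 1)
        (by simp [h0])
    rw [h1, ← WittVector.verschiebung_mul_frobenius]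
    exact ⟨_, rfl⟩
  induction m generalizing y with
  | zero => exact ⟨y, by simp⟩
  | succ m ih =>
    obtain ⟨z, hz⟩ := key y
    obtain ⟨z', hz'⟩ := ih z
    refine ⟨z', ?_⟩
    rw [Nat.mul_succ, pow_add, mul_assoc, hz, pow_mul_verschiebung, hz',
      Function.iterate_succ_apply']

theorem redHom_pow_mul {k m n : ℕ} (h : k * m ≤ n) (y : WittVector p R) :
    redHom p k m ((p : WittVector p R) ^ n * y) = 0 := by
  obtain ⟨c, rfl⟩ := Nat.exists_eq_add_of_le h
  rw [pow_add, mul_assoc]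
  generalize (p : WittVector p R) ^ c * y = y
  have hk : (p : R ⧸ Ideal.span {(p : R)} ^ k) ^ k = 0 := by
    rw [← map_natCast (Ideal.Quotient.mk (Ideal.span {(p : R)} ^ k)), ← map_pow]
    exact Ideal.Quotient.eq_zero_iff_mem.mpr
      (Ideal.pow_mem_pow (Ideal.mem_span_singleton_self _) _)
  obtain ⟨z, hz⟩ := exists_pow_mul_eq_iterate_verschiebung hk m
    (WittVector.map (Ideal.Quotient.mk (Ideal.span {(p : R)} ^ k)) y)
  refine TruncatedWittVector.ext fun i => ?_
  rw [redHom, RingHom.comp_apply, map_mul, map_pow, map_natCast, hz, WittVector.coeff_truncate,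
    WittVector.iterate_verschiebung_coeff_eq_zero _ i.2, TruncatedWittVector.coeff_zero]

/-- Each further factor V(b) costs one factor p because V(a)V(b) = pV(ab). Together with
`pow_mul_verschiebung_mem` this identifies I_R^{n+1} with p^n I_R, so I_R-adic questions become
p-adic ones. -/
theorem augIdeal_pow_succ_le (n : ℕ) :
    augIdeal p R ^ (n + 1) ≤ Ideal.span {(p : WittVector p R) ^ n} * augIdeal p R := by
  induction n with
  | zero => simp
  | succ n ih =>
    rw [pow_succ (augIdeal p R)]
    refine (Ideal.mul_mono_left ih).trans ?_
    rw [mul_assoc, pow_succ, ← Ideal.span_singleton_mul_span_singleton, mul_assoc]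
    refine Ideal.mul_mono_right (Ideal.mul_le.mpr ?_)
    rintro _ ⟨a, rfl⟩ _ ⟨b, rfl⟩
    simp only [verschiebung_mul_verschiebung]
    exact Ideal.mul_mem_mul (Ideal.mem_span_singleton_self _) ⟨_, rfl⟩

theorem exists_of_mem_augIdeal_pow {n : ℕ} {x : WittVector p R}
    (hx : x ∈ augIdeal p R ^ (n + 1)) :
    ∃ z, x = (p : WittVector p R) ^ n * WittVector.verschiebung z := by
  obtain ⟨_, ⟨z, rfl⟩, hz⟩ := Ideal.mem_span_singleton_mul.mp (augIdeal_pow_succ_le n hx)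
  exact ⟨z, hz.symm⟩

/-- Multiplication by p on I_R is multiplication by V(1). -/
theorem pow_mul_verschiebung_mem (n : ℕ) (z : WittVector p R) :
    (p : WittVector p R) ^ n * WittVector.verschiebung z ∈ augIdeal p R ^ (n + 1) := by
  have : (p : WittVector p R) ^ n * WittVector.verschiebung z =
      WittVector.verschiebung 1 ^ n * WittVector.verschiebung z := by
    induction n with
    | zero => simp
    | succ n ih =>
      rw [pow_succ, mul_assoc, pow_succ', mul_assoc, ← ih, mul_left_comm (WittVector.verschiebung 1),
        verschiebung_mul_verschiebung, one_mul]
  rw [this, pow_succ (augIdeal p R)]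
  have hV : ∀ y : WittVector p R, WittVector.verschiebung y ∈ augIdeal p R := fun y => ⟨y, rfl⟩
  exact Ideal.mul_mem_mul (Ideal.pow_mem_pow (hV 1) n) (hV z)

variable [IsAdicComplete (Ideal.span {(p : R)}) R]

/-- Each Witt coefficient is determined by its residues modulo all p^k, as R is p-adically
separated. -/
theorem eq_of_redHom_eq {x y : WittVector p R}
    (h : ∀ k m, redHom p k m x = redHom p k m y) : x = y := by
  ext i
  rw [IsHausdorff.eq_iff_smodEq (I := Ideal.span {(p : R)})]
  intro k
  rw [SModEq.sub_mem, smul_eq_mul, Ideal.mul_top]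
  exact redHom_eq_iff.mp (h k (i + 1)) i (Nat.lt_succ_self i)

/-- In W_m(R/p^k) the terms with n ≥ km vanish, so the partial sums become stationary there. Each
Witt coefficient of the partial sums therefore converges p-adically in R, and s is assembled from
the limits. -/
theorem exists_padic_sum (y : ℕ → WittVector p R) :
    ∃ s : WittVector p R, ∀ k m N, k * m ≤ N →
      redHom p k m s = redHom p k m (∑ n ∈ Finset.range N, (p : WittVector p R) ^ n * y n) := by
  set S : ℕ → WittVector p R := fun N => ∑ n ∈ Finset.range N, (p : WittVector p R) ^ n * y n
  have hS : ∀ k m N N', k * m ≤ N → N ≤ N' → redHom p k m (S N) = redHom p k m (S N') := by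
    intro k m N N' h h'
    simp only [S]
    rw [← Finset.sum_range_add_sum_Ico _ h', map_add, map_sum _ _ (Finset.Ico N N')]
    rw [Finset.sum_eq_zero (s := Finset.Ico N N'), add_zero]
    intro n hn
    exact redHom_pow_mul (h.trans (Finset.mem_Ico.mp hn).1) _
  -- The coefficient i is visible in W_{i+1}, where modulo p^N the sums are stationary from index
  -- N(i+1) on; along this subsequence the Cauchy condition holds with the exact exponents.
  have hL : ∀ i, ∃ l : R, ∀ N, (S (N * (i + 1))).coeff i - l ∈ Ideal.span {(p : R)} ^ N := by
    intro i
    have := IsPrecomplete.prec (I := Ideal.span {(p : R)}) (M := R) inferInstance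
      (f := fun N => (S (N * (i + 1))).coeff i) (by
        intro m n hmn
        rw [SModEq.sub_mem, smul_eq_mul, Ideal.mul_top]
        exact redHom_eq_iff.mp (hS m (i + 1) _ _ le_rfl (Nat.mul_le_mul_right _ hmn)) i
          (Nat.lt_succ_self i))
    obtain ⟨l, hl⟩ := this
    refine ⟨l, fun N => ?_⟩
    have := hl N
    rwa [SModEq.sub_mem, smul_eq_mul, Ideal.mul_top] at this
  choose l hl using hL
  refine ⟨WittVector.mk p l, fun k m N hN => redHom_eq_iff.mpr fun i hi => ?_⟩
  have h1 := redHom_eq_iff.mp (hS k (i + 1) (k * (i + 1)) N le_rfl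
    ((Nat.mul_le_mul_left k hi).trans hN)) i (Nat.lt_succ_self i)
  have h2 := hl i k
  have := sub_mem h1 h2
  rw [WittVector.coeff_mk]
  convert this using 1
  simp only [S]
  ring

/-- If `R` is `p`-adically complete, then `W(R)` is complete for the ideal `I_R`. -/
instance isAdicComplete_augIdeal : IsAdicComplete (augIdeal p R) (WittVector p R) where
  haus' x hx := by
    refine eq_of_redHom_eq fun k m => ?_
    -- An element of I_R^{km+1} is p^{km}V(z), which dies in W_m(R/p^k).
    have h := hx (k * m + 1)
    rw [SModEq.zero, smul_eq_mul, Ideal.mul_top] at h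
    obtain ⟨z, rfl⟩ := exists_of_mem_augIdeal_pow h
    rw [redHom_pow_mul le_rfl, map_zero]
  prec' f hf := by
    -- The sequence is started at `f 1`: the differences from there on lie in I_R^{n+1} = p^n I_R,
    -- whereas `f 1 - f 0` carries no information.
    have h1 : ∀ n, ∃ z, f (n + 2) - f (n + 1) =
        (p : WittVector p R) ^ n * WittVector.verschiebung z := by
      intro n
      have h := (hf (Nat.le_succ (n + 1))).symm
      rw [SModEq.sub_mem, smul_eq_mul, Ideal.mul_top] at h
      exact exists_of_mem_augIdeal_pow h
    choose z hz using h1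
    obtain ⟨s, hs⟩ := exists_padic_sum fun n => WittVector.verschiebung (z n)
    refine ⟨f 1 + s, fun n => ?_⟩
    rw [SModEq.sub_mem, smul_eq_mul, Ideal.mul_top]
    rcases n with _ | n
    · simp
    -- The tail of the series from index n on is p^n V(s'), so it lies in I_R^{n+1}.
    obtain ⟨s', hs'⟩ := exists_padic_sum fun j => z (n + j)
    have hfn : f (n + 1) = f 1 + ∑ j ∈ Finset.range n,
        (p : WittVector p R) ^ j * WittVector.verschiebung (z j) := by
      clear hs'
      induction n with
      | zero => simp
      | succ n ih => rw [Finset.sum_range_succ, ← add_assoc, ← ih, ← hz]; ring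
    have key : s = ∑ j ∈ Finset.range n, (p : WittVector p R) ^ j * WittVector.verschiebung (z j)
        + (p : WittVector p R) ^ n * WittVector.verschiebung s' := by
      refine eq_of_redHom_eq fun k m => ?_
      rw [hs k m (n + k * m) (Nat.le_add_left _ _), Finset.sum_range_add, map_add, map_add,
        map_mul _ _ (WittVector.verschiebung s'), redHom_verschiebung (hs' k m _ le_rfl),
        ← map_mul]
      congr 2
      rw [map_sum, Finset.mul_sum]
      refine Finset.sum_congr rfl fun j _ => ?_
      rw [← pow_mul_verschiebung, pow_add, mul_assoc]
    rw [hfn, key]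
    have := pow_mul_verschiebung_mem n s'
    convert neg_mem this using 1
    ring

theorem augIdeal_le_jacobson : augIdeal p R ≤ (⊥ : Ideal (WittVector p R)).jacobson :=
  IsAdicComplete.le_jacobson_bot _

end WittComplete

/-! ### Lifting idempotent matrices along a complete ideal. -/

section IdempotentLift

variable {A : Type u} [CommRing A] {ι : Type*}

/-- The additive group of matrices with entries in an ideal. -/
def entriesIn (ι : Type*) (J : Ideal A) : AddSubgroup (Matrix ι ι A) where
  carrier := {M | ∀ i j, M i j ∈ J}
  zero_mem' _ _ := J.zero_mem
  add_mem' h h' i j := J.add_mem (h i j) (h' i j)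
  neg_mem' h i j := J.neg_mem (h i j)

theorem entriesIn_mono {J J' : Ideal A} (h : J ≤ J') : entriesIn ι J ≤ entriesIn ι J' :=
  fun _ hM i j => h (hM i j)

variable [Fintype ι]

theorem mul_mem_entriesIn {J J' : Ideal A} {M M' : Matrix ι ι A} (h : M ∈ entriesIn ι J)
    (h' : M' ∈ entriesIn ι J') : M * M' ∈ entriesIn ι (J * J') := fun i j => by
  rw [Matrix.mul_apply]
  exact Ideal.sum_mem _ fun k _ => Ideal.mul_mem_mul (h i k) (h' k j)

theorem mul_mem_entriesIn_left {J : Ideal A} (M : Matrix ι ι A) {M' : Matrix ι ι A}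
    (h' : M' ∈ entriesIn ι J) : M * M' ∈ entriesIn ι J := fun i j => by
  rw [Matrix.mul_apply]
  exact Ideal.sum_mem _ fun k _ => Ideal.mul_mem_left _ _ (h' k j)

theorem mul_mem_entriesIn_right {J : Ideal A} {M : Matrix ι ι A} (M' : Matrix ι ι A)
    (h : M ∈ entriesIn ι J) : M * M' ∈ entriesIn ι J := fun i j => by
  rw [Matrix.mul_apply]
  exact Ideal.sum_mem _ fun k _ => Ideal.mul_mem_right _ _ (h i k)

variable [DecidableEq ι]

/-- Idempotent matrices lift along an adically complete ideal; the lift can be chosen in the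
bicommutant of the given matrix. -/
theorem exists_idempotent_lift (I : Ideal A) [IsAdicComplete I A] (x : Matrix ι ι A)
    (hx : x * x - x ∈ entriesIn ι I) :
    ∃ e : Matrix ι ι A, e * e = e ∧ e - x ∈ entriesIn ι I ∧
      ∀ y, y * x = x * y → y * e = e * y := by
  -- Newton iteration z ↦ 3z² - 2z³ for the equation z² = z. If δ = z² - z, the new defect is δ²(4δ
  -- - 3), so the defect gains at least one power of I in each step. Each iterate is a polynomial in
  -- x, which is the source of the commutation statement.
  set s : ℕ → Matrix ι ι A := fun n => (fun z => 3 * (z * z) - 2 * (z * z * z))^[n] x with hs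
  have s_succ : ∀ n, s (n + 1) = 3 * (s n * s n) - 2 * (s n * s n * s n) := fun n => by
    simp only [hs, Function.iterate_succ_apply']
  have hδ : ∀ n, s n * s n - s n ∈ entriesIn ι (I ^ (n + 1)) := by
    intro n
    induction n with
    | zero => simpa [hs] using hx
    | succ n ih =>
      have h1 : s (n + 1) * s (n + 1) - s (n + 1) =
          (s n * s n - s n) * (s n * s n - s n) * (4 * (s n * s n - s n) - 3) := by
        rw [s_succ]; noncomm_ring
      rw [h1]
      refine mul_mem_entriesIn_right _ (entriesIn_mono ?_ (mul_mem_entriesIn ih ih))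
      rw [← pow_add]
      exact Ideal.pow_le_pow_right (by omega)
  have hstep : ∀ n, s (n + 1) - s n ∈ entriesIn ι (I ^ (n + 1)) := by
    intro n
    have h1 : s (n + 1) - s n = -(2 * s n - 1) * (s n * s n - s n) := by
      rw [s_succ]; noncomm_ring
    rw [h1]
    exact mul_mem_entriesIn_left _ (hδ n)
  have hcauchy : ∀ m n, m ≤ n → s n - s m ∈ entriesIn ι (I ^ (m + 1)) := by
    intro m n hmn
    induction n, hmn using Nat.le_induction with
    | base => rw [sub_self]; exact zero_mem _
    | succ n hmn ih =>
      rw [← sub_add_sub_cancel _ (s n)]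
      exact add_mem (entriesIn_mono (Ideal.pow_le_pow_right (by omega)) (hstep n)) ih
  have hlim : ∀ i j, ∃ l : A, ∀ n, s n i j - l ∈ I ^ n := by
    intro i j
    obtain ⟨l, hl⟩ := IsPrecomplete.prec (I := I) (M := A) inferInstance
      (f := fun n => s n i j) (by
        intro m n hmn
        have h := entriesIn_mono (Ideal.pow_le_pow_right (Nat.le_succ m)) (hcauchy m n hmn) i j
        refine (SModEq.sub_mem.mpr ?_).symm
        rw [smul_eq_mul, Ideal.mul_top]
        exact h)
    refine ⟨l, fun n => ?_⟩
    have := hl n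
    rwa [SModEq.sub_mem, smul_eq_mul, Ideal.mul_top] at this
  choose l hl using hlim
  set e : Matrix ι ι A := Matrix.of l
  have he : ∀ n, e - s n ∈ entriesIn ι (I ^ n) := fun n i j => by
    have := neg_mem (hl i j n)
    rwa [neg_sub] at this
  have eq_of : ∀ M : Matrix ι ι A, (∀ n, M ∈ entriesIn ι (I ^ n)) → M = 0 := by
    intro M hM
    ext i j
    refine IsHausdorff.haus (I := I) inferInstance _ fun n => ?_
    rw [SModEq.zero, smul_eq_mul, Ideal.mul_top]
    exact hM n i j
  refine ⟨e, sub_eq_zero.mp (eq_of _ fun n => ?_), ?_, fun y hy =>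
    sub_eq_zero.mp (eq_of _ fun n => ?_)⟩
  · have h1 : e * e - e = (s n * s n - s n) + (s n * (e - s n) + (e - s n) * e - (e - s n)) := by
      noncomm_ring
    rw [h1]
    exact add_mem (entriesIn_mono (Ideal.pow_le_pow_right (Nat.le_succ n)) (hδ n))
      (sub_mem (add_mem (mul_mem_entriesIn_left _ (he n)) (mul_mem_entriesIn_right _ (he n)))
        (he n))
  -- The bound `he 0` is vacuous (I^0 is the whole ring), so the comparison with x = `s 0` goes
  -- through `s 1`.
  · have h1 : e - x = (e - s 1) + (s 1 - s 0) := by simp [hs]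
    rw [h1]
    refine add_mem ?_ ?_
    · simpa using he 1
    · simpa using hstep 0
  · have hc : ∀ n, Commute y (s n) := by
      intro n
      induction n with
      | zero => exact hy
      | succ n ih =>
        rw [s_succ]
        refine ((Nat.cast_commute 3 y).symm.mul_right (ih.mul_right ih)).sub_right
          ((Nat.cast_commute 2 y).symm.mul_right ((ih.mul_right ih).mul_right ih))
    have h1 : y * e - e * y = y * (e - s n) - (e - s n) * y := by
      have := (hc n).eq
      rw [mul_sub, sub_mul, this]; abel
    rw [h1]
    exact sub_mem (mul_mem_entriesIn_left _ (he n)) (mul_mem_entriesIn_right _ (he n))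

/-- A square matrix which is congruent to `1` modulo an ideal in the radical is invertible. -/
theorem isUnit_of_sub_one_mem {M : Matrix ι ι A} (h : M - 1 ∈ entriesIn ι (⊥ : Ideal A).jacobson) :
    IsUnit M := by
  have h1 : M.det - 1 ∈ (⊥ : Ideal A).jacobson := by
    rw [← Ideal.Quotient.eq_zero_iff_mem, map_sub, map_one, RingHom.map_det, sub_eq_zero]
    have : (Ideal.Quotient.mk (⊥ : Ideal A).jacobson).mapMatrix M = 1 := by
      rw [← sub_eq_zero, ← map_one (Ideal.Quotient.mk (⊥ : Ideal A).jacobson).mapMatrix, ← map_sub]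
      ext i j
      exact Ideal.Quotient.eq_zero_iff_mem.mpr (h i j)
    rw [this, Matrix.det_one]
  rw [Matrix.isUnit_iff_isUnit_det]
  have := Ideal.mem_jacobson_bot.mp h1 1
  simpa using this

/-- An idempotent matrix with entries in the Jacobson radical is zero. -/
theorem idempotent_eq_zero_of_mem_jacobson {e : Matrix ι ι A} (he : e * e = e)
    (h : e ∈ entriesIn ι (⊥ : Ideal A).jacobson) : e = 0 := by
  have hu : IsUnit (1 - e) := isUnit_of_sub_one_mem (by simpa using neg_mem h)
  refine hu.mul_right_eq_zero.mp ?_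
  rw [sub_mul, one_mul, he, sub_self]

end IdempotentLift

/-! ### Dual bases and their Gram matrices. -/

section Frames

variable {A : Type u} [CommRing A] {ι κ σ : Type*} [Fintype ι] [Fintype κ] [Fintype σ]

/-- A dual basis of the `A`-module `Q` (elements `x i` and functionals `c i`) whose Gram matrix
`c i (x k)` is the (necessarily idempotent) matrix `e`. -/
structure Frame (Q : Type*) [AddCommGroup Q] [Module A Q] (e : Matrix ι ι A) where
  x : ι → Q
  c : ι → Q →ₗ[A] A
  repr : ∀ q, ∑ i, c i q • x i = q
  gram : ∀ i k, c i (x k) = e i k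

/-- A factorization `e = Y X` with `X Y = 1`, which identifies the image of `e` with `A^σ`. -/
def Factors [DecidableEq σ] (e : Matrix ι ι A) (X : Matrix σ ι A) (Y : Matrix ι σ A) : Prop :=
  Y * X = e ∧ X * Y = 1

theorem Factors.map [DecidableEq σ] {e : Matrix ι ι A} {X : Matrix σ ι A} {Y : Matrix ι σ A}
    (h : Factors e X Y) {C : Type*} [CommRing C] (f : A →+* C) :
    Factors (e.map f) (X.map f) (Y.map f) := by
  refine ⟨?_, ?_⟩
  · rw [← Matrix.map_mul, h.1]
  · rw [← Matrix.map_mul, h.2, Matrix.map_one _ (map_zero f) (map_one f)]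

namespace Frame

variable {Q : Type*} [AddCommGroup Q] [Module A Q] {e : Matrix ι ι A}

theorem idem (F : Frame Q e) : e * e = e := by
  ext i k
  rw [Matrix.mul_apply]
  conv_rhs => rw [← F.gram, ← F.repr (F.x k), map_sum]
  refine Finset.sum_congr rfl fun j _ => ?_
  rw [map_smul, F.gram, F.gram, smul_eq_mul, mul_comm]

theorem x_eq (F : Frame Q e) (k : ι) : ∑ i, e i k • F.x i = F.x k := by
  conv_rhs => rw [← F.repr (F.x k)]
  simp only [F.gram]

theorem c_eq (F : Frame Q e) (i : ι) (q : Q) : ∑ k, e i k * F.c k q = F.c i q := by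
  conv_rhs => rw [← F.repr q, map_sum]
  refine Finset.sum_congr rfl fun j _ => ?_
  rw [map_smul, F.gram, smul_eq_mul, mul_comm]

theorem hom_ext (F : Frame Q e) {P : Type*} [AddCommGroup P] [Module A P] {f g : Q →ₗ[A] P}
    (h : ∀ i, f (F.x i) = g (F.x i)) : f = g := by
  ext q
  rw [← F.repr q, map_sum, map_sum]
  exact Finset.sum_congr rfl fun i _ => by rw [map_smul, map_smul, h]

theorem finite (F : Frame Q e) : Module.Finite A Q := by
  refine Module.Finite.of_surjective (Fintype.linearCombination A F.x) fun q => ?_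
  exact ⟨fun i => F.c i q, by rw [Fintype.linearCombination_apply, F.repr]⟩

theorem projective (F : Frame Q e) : Module.Projective A Q := by
  refine Module.Projective.of_split (LinearMap.pi F.c) (Fintype.linearCombination A F.x) ?_
  ext q
  simp [Fintype.linearCombination_apply, F.repr]

/-- The base change of a frame. -/
def baseChange (F : Frame Q e) (C : Type*) [CommRing C] [Algebra A C] :
    Frame (C ⊗[A] Q) (e.map (algebraMap A C)) where
  x i := 1 ⊗ₜ F.x i
  c i := (TensorProduct.AlgebraTensorModule.rid A C C).toLinearMap ∘ₗ (F.c i).baseChange C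
  repr q := by
    induction q using TensorProduct.induction_on with
    | zero => simp
    | add x y hx hy =>
      simp only [map_add, add_smul, Finset.sum_add_distrib, hx, hy]
    | tmul b q =>
      conv_rhs => rw [← F.repr q, TensorProduct.tmul_sum]
      refine Finset.sum_congr rfl fun i _ => ?_
      simp [TensorProduct.smul_tmul']
  gram i k := by simp [F.gram, Algebra.smul_def]

theorem baseChange_c_tmul (F : Frame Q e) (C : Type*) [CommRing C] [Algebra A C] (i : ι) (b : C)
    (q : Q) : (F.baseChange C).c i (b ⊗ₜ q) = F.c i q • b := by
  simp [baseChange]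

/-- The isomorphism `Q ≅ A^σ` given by a factorization of the Gram matrix. -/
def equivOfFactors [DecidableEq σ] (F : Frame Q e) {X : Matrix σ ι A} {Y : Matrix ι σ A}
    (h : Factors e X Y) : Q ≃ₗ[A] (σ → A) :=
  LinearEquiv.ofLinearMap
    (X.mulVecLin ∘ₗ LinearMap.pi F.c) (Fintype.linearCombination A F.x ∘ₗ Y.mulVecLin)
    (by
      refine LinearMap.ext fun v => ?_
      have h1 : (LinearMap.pi F.c) (Fintype.linearCombination A F.x (Y.mulVec v)) =
          e.mulVec (Y.mulVec v) := by
        ext i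
        rw [LinearMap.pi_apply, Fintype.linearCombination_apply, map_sum, Matrix.mulVec, dotProduct]
        exact Finset.sum_congr rfl fun k _ => by rw [map_smul, F.gram, smul_eq_mul, mul_comm]
      simp only [LinearMap.comp_apply, Matrix.mulVecLin_apply, LinearMap.id_apply]
      rw [h1, Matrix.mulVec_mulVec, Matrix.mulVec_mulVec, ← h.1, ← Matrix.mul_assoc, h.2,
        Matrix.one_mul, h.2, Matrix.one_mulVec])
    (by
      refine LinearMap.ext fun q => ?_
      simp only [LinearMap.comp_apply, Matrix.mulVecLin_apply, LinearMap.id_apply]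
      rw [Matrix.mulVec_mulVec, h.1, Fintype.linearCombination_apply]
      conv_rhs => rw [← F.repr q]
      refine Finset.sum_congr rfl fun i _ => ?_
      rw [← F.c_eq i q]
      rfl)

theorem equivOfFactors_apply [DecidableEq σ] (F : Frame Q e) {X : Matrix σ ι A}
    {Y : Matrix ι σ A} (h : Factors e X Y) (q : Q) (s : σ) :
    F.equivOfFactors h q s = ∑ i, X s i * F.c i q := rfl

/-- Converse of `equivOfFactors`: the two matrices express the frame in the basis and the basis in
the frame, and the relations between them are the two reconstruction formulas. -/
theorem factors_of_basis [DecidableEq σ] (F : Frame Q e) (b : Module.Basis σ A Q) :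
    Factors e (Matrix.of fun s i => b.repr (F.x i) s) (Matrix.of fun i s => F.c i (b s)) := by
  refine ⟨?_, ?_⟩
  · ext i k
    rw [Matrix.mul_apply, ← F.gram i k]
    conv_rhs => rw [← b.sum_repr (F.x k), map_sum]
    exact Finset.sum_congr rfl fun s _ => by
      rw [map_smul, smul_eq_mul, Matrix.of_apply, Matrix.of_apply, mul_comm]
  · ext s s'
    rw [Matrix.mul_apply]
    have h := congrArg (fun q => b.repr q s) (F.repr (b s'))
    simp only [map_sum, map_smul, Finsupp.coe_finsetSum, Finset.sum_apply, Finsupp.smul_apply,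
      smul_eq_mul, Module.Basis.repr_self] at h
    have h' : (1 : Matrix σ σ A) s s' = Finsupp.single s' (1 : A) s := by
      rw [Matrix.one_apply, Finsupp.single_apply]
      exact if_congr eq_comm rfl rfl
    rw [h', ← h]
    exact Finset.sum_congr rfl fun i _ => mul_comm _ _

end Frame

theorem exists_frame (Q : Type*) [AddCommGroup Q] [Module A Q] [Module.Finite A Q]
    [Module.Projective A Q] :
    ∃ (n : ℕ) (e : Matrix (Fin n) (Fin n) A), Nonempty (Frame Q e) := by
  obtain ⟨n, f, g, -, -, h⟩ := Module.Finite.exists_comp_eq_id_of_projective A Q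
  refine ⟨n, _, ⟨⟨fun i => f (Pi.single i 1), fun i => LinearMap.proj i ∘ₗ g, fun q => ?_,
    fun i k => rfl⟩⟩⟩
  conv_rhs => rw [← LinearMap.id_apply (R := A) q, ← h, LinearMap.comp_apply]
  conv_rhs => rw [pi_eq_sum_univ' (g q), map_sum]
  refine Finset.sum_congr rfl fun i _ => ?_
  rw [map_smul]
  congr 2

/-- The frame of the image of an idempotent matrix, given by the columns and coordinates. -/
def rangeFrame [DecidableEq ι] (e : Matrix ι ι A) (he : e * e = e) :
    Frame (LinearMap.range e.mulVecLin) e where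
  x i := ⟨e.mulVec (Pi.single i 1), ⟨Pi.single i 1, rfl⟩⟩
  c i := LinearMap.proj i ∘ₗ Submodule.subtype _
  repr := by
    rintro ⟨_, v, rfl⟩
    refine Subtype.ext ?_
    ext j
    have : e.mulVec (e.mulVec v) = e.mulVec v := by rw [Matrix.mulVec_mulVec, he]
    have h2 := congrFun this j
    simp only [Submodule.coe_sum, Submodule.coe_smul, Finset.sum_apply, Pi.smul_apply,
      smul_eq_mul, LinearMap.comp_apply, Submodule.subtype_apply, LinearMap.proj_apply,
      Matrix.mulVecLin_apply]
    rw [← h2]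
    conv_rhs => rw [Matrix.mulVec, dotProduct]
    exact Finset.sum_congr rfl fun i _ => by simp [mul_comm]
  gram i k := by simp

end Frames


/-! ### Étale local rank of idempotent matrices. -/

section LocalRank

variable {A : Type u} [CommRing A] {ι κ : Type*} [Fintype ι] [Fintype κ]

/-- The idempotent matrix `e` has rank `d` étale locally. -/
def IsLocRank (e : Matrix ι ι A) (d : ℕ) : Prop :=
  ∃ (C : Type u) (_ : CommRing C) (_ : Algebra A C), Algebra.Etale A C ∧
    Module.FaithfullyFlat A C ∧ ∃ (X : Matrix (Fin d) ι C) (Y : Matrix ι (Fin d) C),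
      Factors (e.map (algebraMap A C)) X Y

theorem IsLocRank.map {e : Matrix ι ι A} {d : ℕ} (h : IsLocRank e d) {A' : Type u} [CommRing A']
    (f : A →+* A') : IsLocRank (e.map f) d := by
  obtain ⟨C, _, _, _, _, X, Y, hXY⟩ := h
  algebraize [f]
  refine ⟨A' ⊗[A] C, inferInstance, inferInstance, inferInstance, inferInstance, ?_, ?_,
    ?_⟩
  · exact X.map (Algebra.TensorProduct.includeRight : C →ₐ[A] A' ⊗[A] C).toRingHom
  · exact Y.map (Algebra.TensorProduct.includeRight : C →ₐ[A] A' ⊗[A] C).toRingHom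
  · convert hXY.map (Algebra.TensorProduct.includeRight : C →ₐ[A] A' ⊗[A] C).toRingHom using 1
    ext i j
    simp only [Matrix.map_apply]
    change algebraMap A' (A' ⊗[A] C) (algebraMap A A' (e i j)) =
      Algebra.TensorProduct.includeRight (algebraMap A C (e i j))
    rw [AlgHom.commutes, ← IsScalarTower.algebraMap_apply]

/-- Two matrices which are locally of constant rank can be trivialized over the same covering. -/
theorem IsLocRank.exists_common {e : Matrix ι ι A} {e' : Matrix κ κ A} {d d' : ℕ}
    (h : IsLocRank e d) (h' : IsLocRank e' d') :
    ∃ (C : Type u) (_ : CommRing C) (_ : Algebra A C), Algebra.Etale A C ∧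
      Module.FaithfullyFlat A C ∧
      (∃ (X : Matrix (Fin d) ι C) (Y : Matrix ι (Fin d) C),
        Factors (e.map (algebraMap A C)) X Y) ∧
      ∃ (X : Matrix (Fin d') κ C) (Y : Matrix κ (Fin d') C),
        Factors (e'.map (algebraMap A C)) X Y := by
  obtain ⟨C, _, _, _, _, X, Y, hXY⟩ := h
  obtain ⟨D, _, _, _, _, X', Y', hXY'⟩ := h'
  refine ⟨C ⊗[A] D, inferInstance, inferInstance, .comp A C (C ⊗[A] D),
    .trans A C (C ⊗[A] D), ⟨?_, ?_, ?_⟩, ⟨?_, ?_, ?_⟩⟩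
  · exact X.map (algebraMap C (C ⊗[A] D))
  · exact Y.map (algebraMap C (C ⊗[A] D))
  · convert hXY.map (algebraMap C (C ⊗[A] D)) using 1
    ext i j
    simp only [Matrix.map_apply]
    rw [← IsScalarTower.algebraMap_apply]
  · exact X'.map (Algebra.TensorProduct.includeRight : D →ₐ[A] C ⊗[A] D).toRingHom
  · exact Y'.map (Algebra.TensorProduct.includeRight : D →ₐ[A] C ⊗[A] D).toRingHom
  · convert hXY'.map (Algebra.TensorProduct.includeRight : D →ₐ[A] C ⊗[A] D).toRingHom using 1
    ext i j
    simp only [Matrix.map_apply]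
    change _ = Algebra.TensorProduct.includeRight (algebraMap A D (e' i j))
    rw [AlgHom.commutes]

theorem Factors.fromBlocks {σ τ : Type*} [Fintype σ] [Fintype τ] [DecidableEq σ] [DecidableEq τ]
    {e : Matrix ι ι A} {X : Matrix σ ι A} {Y : Matrix ι σ A} (h : Factors e X Y)
    {e' : Matrix κ κ A} {X' : Matrix τ κ A} {Y' : Matrix κ τ A} (h' : Factors e' X' Y') :
    Factors (Matrix.fromBlocks e 0 0 e') (Matrix.fromBlocks X 0 0 X')
      (Matrix.fromBlocks Y 0 0 Y') := by
  refine ⟨?_, ?_⟩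
  · rw [Matrix.fromBlocks_multiply, ← h.1, ← h'.1]; simp
  · rw [Matrix.fromBlocks_multiply, h.2, h'.2]; simp

theorem IsLocRank.fromBlocks {e : Matrix ι ι A} {e' : Matrix κ κ A} {d d' : ℕ}
    (h : IsLocRank e d) (h' : IsLocRank e' d') :
    IsLocRank (Matrix.fromBlocks e 0 0 e') (d + d') := by
  obtain ⟨C, _, _, hC, hC', ⟨X, Y, hXY⟩, X', Y', hXY'⟩ := h.exists_common h'
  obtain ⟨h1, h2⟩ := hXY.fromBlocks hXY'
  refine ⟨C, _, _, hC, hC', (Matrix.fromBlocks X 0 0 X').submatrix finSumFinEquiv.symm id,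
    (Matrix.fromBlocks Y 0 0 Y').submatrix id finSumFinEquiv.symm, ?_, ?_⟩
  · rw [Matrix.submatrix_mul_equiv, h1, Matrix.submatrix_id_id, Matrix.fromBlocks_map]
    simp
  · rw [Matrix.submatrix_mul _ _ _ _ _ Function.bijective_id |>.symm, h2]
    exact Matrix.submatrix_one_equiv _

variable {Q : Type*} [AddCommGroup Q] [Module A Q] {e : Matrix ι ι A}

/-- A faithfully flat covering is surjective on spectra and the rank at a prime can be computed at a
prime above it, where the module has become free. -/
theorem Frame.rankAtStalk_eq (F : Frame Q e) {d : ℕ} (h : IsLocRank e d) (𝔭 : PrimeSpectrum A) :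
    Module.rankAtStalk Q 𝔭 = d := by
  obtain ⟨C, _, _, _, _, X, Y, hXY⟩ := h
  obtain ⟨𝔮, rfl⟩ := PrimeSpectrum.comap_surjective_of_faithfullyFlat (A := A) (B := C) 𝔭
  have := F.finite
  have := F.projective
  have : Nontrivial C := 𝔮.nontrivial
  rw [← Module.rankAtStalk_baseChange,
    Module.rankAtStalk_eq_of_equiv ((F.baseChange C).equivOfFactors hXY),
    Module.rankAtStalk_eq_finrank_of_free]
  simp

/-- The residual criterion for constant rank: at each maximal ideal, the matrix has the given
rank after some nontrivial extension of the residue field. -/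
def HasResidualRank (e : Matrix ι ι A) (d : ℕ) : Prop :=
  ∀ 𝔪 : Ideal A, 𝔪.IsMaximal → ∃ (C : Type u) (_ : CommRing C) (_ : Nontrivial C) (φ : A →+* C),
    (∀ a ∈ 𝔪, φ a = 0) ∧ ∃ (X : Matrix (Fin d) ι C) (Y : Matrix ι (Fin d) C),
      Factors (e.map φ) X Y

/-- Over the local ring at the maximal ideal the module is free; a basis there is reduced to the
residue field. -/
theorem Frame.hasResidualRank (F : Frame Q e) {d : ℕ}
    (h : ∀ 𝔭 : PrimeSpectrum A, 𝔭.asIdeal.IsMaximal → Module.rankAtStalk Q 𝔭 = d) :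
    HasResidualRank e d := by
  intro 𝔪 h𝔪
  have := F.finite
  have := F.projective
  set 𝔭 : PrimeSpectrum A := ⟨𝔪, h𝔪.isPrime⟩
  have hr := h 𝔭 h𝔪
  rw [Module.rankAtStalk_eq_finrank_tensorProduct] at hr
  have : Module.Free (Localization.AtPrime 𝔭.asIdeal) (Localization.AtPrime 𝔭.asIdeal ⊗[A] Q) :=
    Module.free_of_flat_of_isLocalRing
  have b := (Module.finBasis (Localization.AtPrime 𝔭.asIdeal)
    (Localization.AtPrime 𝔭.asIdeal ⊗[A] Q)).reindex (finCongr hr)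
  refine ⟨𝔭.asIdeal.ResidueField, inferInstance, inferInstance,
    algebraMap A 𝔭.asIdeal.ResidueField, fun a ha => Ideal.algebraMap_residueField_eq_zero.mpr ha,
    ?_, ?_, ?_⟩
  · exact (Matrix.of fun s i => b.repr ((F.baseChange _).x i) s).map
      (algebraMap (Localization.AtPrime 𝔭.asIdeal) 𝔭.asIdeal.ResidueField)
  · exact (Matrix.of fun i s => (F.baseChange _).c i (b s)).map
      (algebraMap (Localization.AtPrime 𝔭.asIdeal) 𝔭.asIdeal.ResidueField)
  · convert ((F.baseChange _).factors_of_basis b).map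
      (algebraMap (Localization.AtPrime 𝔭.asIdeal) 𝔭.asIdeal.ResidueField) using 1
    ext i j
    simp only [Matrix.map_apply]
    rw [← IsScalarTower.algebraMap_apply]

theorem exists_factors_of_field {k : Type*} [Field k] [DecidableEq ι] (e : Matrix ι ι k)
    (he : e * e = e) :
    ∃ (r : ℕ) (X : Matrix (Fin r) ι k) (Y : Matrix ι (Fin r) k), Factors e X Y :=
  ⟨_, _, _, (rangeFrame e he).factors_of_basis (Module.finBasis k _)⟩

/-- The products X Y' and X' Y are mutually inverse, so they are square over a nonzero ring. -/
theorem Factors.card_eq [Nontrivial A] {r d : ℕ} {X : Matrix (Fin r) ι A}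
    {Y : Matrix ι (Fin r) A} (h : Factors e X Y) {X' : Matrix (Fin d) ι A}
    {Y' : Matrix ι (Fin d) A} (h' : Factors e X' Y') : r = d := by
  have h1 : (X * Y') * (X' * Y) = 1 := by
    rw [Matrix.mul_assoc, ← Matrix.mul_assoc Y', h'.1, ← h.1, Matrix.mul_assoc, h.2,
      Matrix.mul_one, h.2]
  have h2 : (X' * Y) * (X * Y') = 1 := by
    rw [Matrix.mul_assoc, ← Matrix.mul_assoc Y, h.1, ← h'.1, Matrix.mul_assoc, h'.2,
      Matrix.mul_one, h'.2]
  have := Matrix.square_of_invertible _ _ h1 h2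
  simpa using this

/-- The rank spreads out from a closed point. The factorization is lifted arbitrarily to X₁, Y₁;
once G = X₁ e Y₁ is invertible it yields a projector P of rank d with eP = Pe = P, and e - P is an
idempotent that vanishes at 𝔪, hence is zero wherever 1 - (e - P) is invertible. Both conditions
amount to inverting a single element of the complement of 𝔪. -/
theorem exists_factors_away [DecidableEq ι] (he : e * e = e) {d : ℕ} (𝔪 : Ideal A)
    [h𝔪 : 𝔪.IsMaximal] {X : Matrix (Fin d) ι (A ⧸ 𝔪)} {Y : Matrix ι (Fin d) (A ⧸ 𝔪)}
    (h : Factors (e.map (Ideal.Quotient.mk 𝔪)) X Y) :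
    ∃ s ∉ 𝔪, ∀ {S : Type u} [CommRing S] (α : A →+* S), IsUnit (α s) →
      ∃ (X : Matrix (Fin d) ι S) (Y : Matrix ι (Fin d) S), Factors (e.map α) X Y := by
  set q := Ideal.Quotient.mk 𝔪
  have hq : Function.Surjective q := Ideal.Quotient.mk_surjective
  choose g hg using hq
  obtain ⟨X₁, hX₁⟩ : ∃ X₁ : Matrix (Fin d) ι A, X₁.map q = X :=
    ⟨X.map g, by ext; simp [hg]⟩
  obtain ⟨Y₁, hY₁⟩ : ∃ Y₁ : Matrix ι (Fin d) A, Y₁.map q = Y :=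
    ⟨Y.map g, by ext; simp [hg]⟩
  set G : Matrix (Fin d) (Fin d) A := X₁ * e * Y₁ with hG
  have hGq : q.mapMatrix G = 1 := by
    rw [RingHom.mapMatrix_apply, hG, Matrix.map_mul, Matrix.map_mul, hX₁, hY₁, ← h.1,
      ← Matrix.mul_assoc, h.2, Matrix.one_mul, h.2]
  -- This is det G times the projector e Y₁ G⁻¹ X₁ e, written with the adjugate so that it exists
  -- before localization.
  set E : Matrix ι ι A := e * Y₁ * G.adjugate * X₁ * e with hE
  set f := G.det with hf
  have hfq : q f = 1 := by rw [hf, RingHom.map_det, hGq, Matrix.det_one]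
  have hEq : q.mapMatrix E = q.mapMatrix e := by
    have hadj : G.adjugate.map q = 1 := by
      rw [← RingHom.mapMatrix_apply, RingHom.map_adjugate, hGq, Matrix.adjugate_one]
    rw [RingHom.mapMatrix_apply, RingHom.mapMatrix_apply, hE, Matrix.map_mul, Matrix.map_mul,
      Matrix.map_mul, Matrix.map_mul, hadj, hX₁, hY₁, Matrix.mul_one, ← h.1]
    rw [Matrix.mul_assoc Y X Y, h.2, Matrix.mul_one, ← Matrix.mul_assoc, Matrix.mul_assoc Y X Y,
      h.2, Matrix.mul_one]
  -- After division by f = det G this becomes 1 - (e - P); modulo 𝔪 it is already the identity.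
  set D : Matrix ι ι A := f • 1 - (f • e - E) with hD
  have hDq : q D.det = 1 := by
    have : q.mapMatrix D = 1 := by
      ext i j
      have := congrFun (congrFun hEq i) j
      simp only [RingHom.mapMatrix_apply, Matrix.map_apply] at this
      simp only [hD, RingHom.mapMatrix_apply, Matrix.map_apply, Matrix.sub_apply,
        Matrix.smul_apply, smul_eq_mul, map_sub, map_mul, hfq, one_mul, this, sub_self, sub_zero,
        Matrix.one_apply]
      split_ifs <;> simp
    rw [RingHom.map_det, this, Matrix.det_one]
  refine ⟨f * D.det, fun hmem => ?_, fun {S} _ α hu => ?_⟩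
  · have h0 : q (f * D.det) = 0 := Ideal.Quotient.eq_zero_iff_mem.mpr hmem
    rw [map_mul, hfq, hDq, one_mul] at h0
    exact one_ne_zero h0
  rw [map_mul] at hu
  have hfu : IsUnit (α f) := isUnit_of_mul_isUnit_left hu
  have hDu : IsUnit (α.mapMatrix D) := by
    rw [Matrix.isUnit_iff_isUnit_det, ← RingHom.map_det]
    exact isUnit_of_mul_isUnit_right hu
  obtain ⟨v, hv⟩ := hfu.exists_right_inv
  set Xf : Matrix (Fin d) ι S := v • (G.adjugate.map α * X₁.map α * e.map α)
  set Yf : Matrix ι (Fin d) S := e.map α * Y₁.map α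
  have hee : e.map α * e.map α = e.map α := by rw [← Matrix.map_mul, he]
  have hXY : Xf * Yf = 1 := by
    have hGG' : G.adjugate.map α * G.map α = α f • (1 : Matrix (Fin d) (Fin d) S) := by
      rw [← Matrix.map_mul, Matrix.adjugate_mul]
      ext i j
      simp only [Matrix.map_apply, Matrix.smul_apply, smul_eq_mul, map_mul, Matrix.one_apply]
      split_ifs <;> simp [hf]
    have : G.adjugate.map α * X₁.map α * e.map α * (e.map α * Y₁.map α) =
        G.adjugate.map α * G.map α := by
      rw [hG, Matrix.map_mul, Matrix.map_mul, Matrix.mul_assoc, ← Matrix.mul_assoc (e.map α), hee]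
      simp only [Matrix.mul_assoc]
    rw [Matrix.smul_mul, this, hGG', smul_smul, mul_comm, hv, one_smul]
  refine ⟨Xf, Yf, ?_, hXY⟩
  set P := Yf * Xf with hP
  have hPE : P = v • E.map α := by
    rw [hP, Matrix.mul_smul, hE]
    simp only [Matrix.map_mul, Yf, Matrix.mul_assoc]
  have hPP : P * P = P := by
    rw [hP, Matrix.mul_assoc, ← Matrix.mul_assoc Xf, hXY, Matrix.one_mul]
  have heP : e.map α * P = P := by
    rw [hP, ← Matrix.mul_assoc]
    congr 1
    rw [← Matrix.mul_assoc, hee]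
  have hPe : P * e.map α = P := by
    rw [hP, Matrix.mul_assoc]
    congr 1
    rw [Matrix.smul_mul, Matrix.mul_assoc _ (e.map α), hee]
  have hDv : v • α.mapMatrix D = 1 - (e.map α - P) := by
    rw [hPE]
    ext i j
    simp only [hD, RingHom.mapMatrix_apply, Matrix.smul_apply, Matrix.map_apply, Matrix.sub_apply,
      map_sub, smul_eq_mul, map_mul, Matrix.one_apply]
    split_ifs
    · simp only [map_one, mul_one]; linear_combination (1 - α (e i j)) * hv
    · simp only [map_zero, mul_zero]; linear_combination (- α (e i j)) * hv
  have hvu : IsUnit v := IsUnit.of_mul_eq_one (α f) (by rw [mul_comm, hv])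
  have hu' : IsUnit (1 - (e.map α - P)) := by
    rw [← hDv]
    obtain ⟨w, rfl⟩ := hvu
    exact hDu.smul w
  have h0 : (1 - (e.map α - P)) * (e.map α - P) = 0 := by
    simp only [sub_mul, mul_sub, one_mul, hee, hPP, heP, hPe]
    abel
  exact (sub_eq_zero.mp (hu'.mul_right_eq_zero.mp h0)).symm

/-- By `exists_factors_away` the elements s for which e has rank d over A_s generate the unit ideal.
The product of finitely many such localizations is an étale covering. -/
theorem HasResidualRank.isLocRank [DecidableEq ι] (he : e * e = e) {d : ℕ}
    (h : HasResidualRank e d) : IsLocRank e d := by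
  set good : Set A := {s | ∃ (X : Matrix (Fin d) ι (Localization.Away s))
      (Y : Matrix ι (Fin d) (Localization.Away s)),
      Factors (e.map (algebraMap A (Localization.Away s))) X Y}
  have htop : Ideal.span good = ⊤ := by
    by_contra hne
    obtain ⟨𝔪, h𝔪, hle⟩ := Ideal.exists_le_maximal _ hne
    obtain ⟨C, _, _, φ, hφ, X, Y, hXY⟩ := h 𝔪 h𝔪
    let := Ideal.Quotient.field 𝔪
    have hidem : e.map (Ideal.Quotient.mk 𝔪) * e.map (Ideal.Quotient.mk 𝔪) =
        e.map (Ideal.Quotient.mk 𝔪) := by rw [← Matrix.map_mul, he]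
    -- Over the field A/𝔪 the matrix has some rank r. The hypothesis concerns an extension C of that
    -- field only, and comparison over C forces r = d.
    obtain ⟨r, X', Y', hXY'⟩ := exists_factors_of_field _ hidem
    have h2 := hXY'.map (Ideal.Quotient.lift 𝔪 φ hφ)
    rw [Matrix.map_map] at h2
    have h3 : e.map (⇑(Ideal.Quotient.lift 𝔪 φ hφ) ∘ ⇑(Ideal.Quotient.mk 𝔪)) = e.map φ := by
      ext i j
      rfl
    rw [h3] at h2
    obtain rfl := h2.card_eq hXY
    obtain ⟨s, hs, hs'⟩ := exists_factors_away he 𝔪 hXY'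
    exact hs (hle (Ideal.subset_span
      (hs' (algebraMap A (Localization.Away s)) (IsLocalization.Away.algebraMap_isUnit s))))
  obtain ⟨t, ht, htop⟩ := (Ideal.span_eq_top_iff_finite good).mp htop
  choose X Y hXY using fun s : t => ht s.2
  have hff : Module.FaithfullyFlat A (∀ s : t, Localization.Away s.1) := by
    refine Module.FaithfullyFlat.of_comap_surjective fun 𝔭 => ?_
    have : ∃ s : t, s.1 ∉ 𝔭.asIdeal := by
      by_contra! hcon
      refine 𝔭.isPrime.ne_top (top_le_iff.mp ?_)
      rw [← htop, Ideal.span_le]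
      exact fun s hs => hcon ⟨s, hs⟩
    obtain ⟨s, hs⟩ := this
    have : 𝔭 ∈ Set.range (PrimeSpectrum.comap (algebraMap A (Localization.Away s.1))) := by
      rw [PrimeSpectrum.localization_away_comap_range _ s.1]
      exact hs
    obtain ⟨𝔮, rfl⟩ := this
    exact ⟨𝔮.comap (Pi.evalRingHom _ s), rfl⟩
  refine ⟨∀ s : t, Localization.Away s.1, inferInstance, inferInstance, inferInstance, hff,
    Matrix.of fun a i s => X s a i, Matrix.of fun i a s => Y s i a, ?_, ?_⟩
  · ext i j s
    have := congrFun (congrFun (hXY s).1 i) j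
    rw [Matrix.mul_apply] at this ⊢
    rw [Finset.sum_apply]
    exact this
  · ext i j s
    have := congrFun (congrFun (hXY s).2 i) j
    rw [Matrix.mul_apply] at this ⊢
    rw [Finset.sum_apply]
    refine this.trans ?_
    rw [Matrix.one_apply, Matrix.one_apply]
    split_ifs <;> rfl

/-- Local constancy of the rank can be tested modulo an ideal in the Jacobson radical. -/
theorem isLocRank_of_map_quotient [DecidableEq ι] (he : e * e = e) {d : ℕ} {J : Ideal A}
    (hJ : J ≤ (⊥ : Ideal A).jacobson) (h : IsLocRank (e.map (Ideal.Quotient.mk J)) d) :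
    IsLocRank e d := by
  refine HasResidualRank.isLocRank he fun 𝔪 h𝔪 => ?_
  -- Every maximal ideal contains J, so the residual criterion sees only A/J.
  have hle : J ≤ 𝔪 := hJ.trans (sInf_le ⟨bot_le, h𝔪⟩)
  obtain ⟨C, _, _, _, _, X, Y, hXY⟩ := h.map (Ideal.Quotient.factor hle)
  let := Ideal.Quotient.field 𝔪
  have : Nontrivial C := (FaithfulSMul.algebraMap_injective (A ⧸ 𝔪) C).nontrivial
  refine ⟨C, inferInstance, inferInstance, (algebraMap (A ⧸ 𝔪) C).comp (Ideal.Quotient.mk 𝔪),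
    fun a ha => ?_, X, Y, ?_⟩
  · rw [RingHom.comp_apply, Ideal.Quotient.eq_zero_iff_mem.mpr ha, map_zero]
  · convert hXY using 1
    ext i j
    rfl

end LocalRank

/-! ### Scalar extension by its universal property. -/

section ScalarExtensionLemmas

variable {A A' : Type u} [CommRing A] [CommRing A']

open scoped ChangeOfRings in
theorem isScalarExtension_pullUnit (f : A →+* A') (M : ModuleCat.{u} A) :
    IsScalarExtension (pullUnit f M) := by
  intro Q _ _ k
  let g : M ⟶ (ModuleCat.restrictScalars f).obj (ModuleCat.of A' Q) :=
    ModuleCat.ofHom (X := M) (Y := (ModuleCat.restrictScalars f).obj (ModuleCat.of A' Q))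
      { toFun := k, map_add' := map_add k, map_smul' := fun a m => map_smulₛₗ k a m }
  have h1 : ∀ m : M, (ModuleCat.ExtendRestrictScalarsAdj.HomEquiv.fromExtendScalars f g).hom
      (pullUnit f M m) = k m := by
    intro m
    exact one_smul A' (k m)
  refine ⟨(ModuleCat.ExtendRestrictScalarsAdj.HomEquiv.fromExtendScalars f g).hom, h1,
    fun l hl => ?_⟩
  let α : (pull f).obj M ⟶ ModuleCat.of A' Q :=
    ModuleCat.ofHom (X := ((pull f).obj M : ModuleCat.{u} A')) l
  exact congrArg ModuleCat.Hom.hom (ModuleCat.ExtendScalars.hom_ext (f := f) (α := α)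
    (β := ModuleCat.ExtendRestrictScalarsAdj.HomEquiv.fromExtendScalars f g) fun m =>
      (hl m).trans (h1 m).symm)

namespace IsScalarExtension

variable {f : A →+* A'} {M M' : Type u} [AddCommGroup M] [AddCommGroup M'] [Module A M]
  [Module A' M'] {g : M →ₛₗ[f] M'}

/-- The quotient map by the span and the zero map agree on the image of g, so they coincide by
uniqueness. -/
theorem span_eq_top (h : IsScalarExtension g) : Submodule.span A' (Set.range g) = ⊤ := by
  have h1 := (h (M' ⧸ Submodule.span A' (Set.range g)) 0).unique
    (y₁ := Submodule.mkQ _) (y₂ := 0)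
    (fun m => (Submodule.Quotient.mk_eq_zero _).mpr (Submodule.subset_span ⟨m, rfl⟩))
    (fun m => rfl)
  rw [← Submodule.ker_mkQ (Submodule.span A' (Set.range g)), h1, LinearMap.ker_zero]

theorem induction (h : IsScalarExtension g) {P : M' → Prop} (h0 : ∀ m, P (g m))
    (hadd : ∀ x y, P x → P y → P (x + y)) (hsmul : ∀ (a : A') x, P x → P (a • x)) (x : M') :
    P x := by
  have hx : x ∈ Submodule.span A' (Set.range g) := h.span_eq_top ▸ Submodule.mem_top
  induction hx using Submodule.span_induction with
  | mem x hx => obtain ⟨m, rfl⟩ := hx; exact h0 m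
  | zero => simpa using hsmul 0 _ (h0 0)
  | add x y _ _ hx hy => exact hadd x y hx hy
  | smul a x _ hx => exact hsmul a x hx

theorem hom_ext (h : IsScalarExtension g) {A'' : Type*} [CommRing A''] {ψ : A' →+* A''}
    {Q : Type*} [AddCommGroup Q] [Module A'' Q] {l l' : M' →ₛₗ[ψ] Q}
    (hl : ∀ m, l (g m) = l' (g m)) : l = l' := by
  ext x
  induction x using h.induction with
  | h0 m => exact hl m
  | hadd x y hx hy => rw [map_add, map_add, hx, hy]
  | hsmul a x hx => rw [map_smulₛₗ, map_smulₛₗ, hx]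

/-- The universal property for semilinear maps. -/
theorem exists_lift (h : IsScalarExtension g) {A'' : Type*} [CommRing A''] (ψ : A' →+* A'')
    {Q : Type u} [AddCommGroup Q] [Module A'' Q] (k : M →+ Q)
    (hk : ∀ a m, k (a • m) = ψ (f a) • k m) : ∃ l : M' →ₛₗ[ψ] Q, ∀ m, l (g m) = k m := by
  -- The universal property only speaks of A'-modules, so the target is viewed as one through ψ.
  let : Module A' Q := Module.compHom Q ψ
  obtain ⟨l, hl, -⟩ := h Q
    { toFun := k, map_add' := map_add k, map_smul' := fun a m => hk a m }
  exact ⟨{ toFun := l, map_add' := map_add l, map_smul' := fun a m => map_smul l a m }, hl⟩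

/-- The linear map given by the universal property. -/
def lift (h : IsScalarExtension g) {Q : Type u} [AddCommGroup Q] [Module A' Q]
    (k : M →ₛₗ[f] Q) : M' →ₗ[A'] Q := (h Q k).exists.choose

theorem lift_apply (h : IsScalarExtension g) {Q : Type u} [AddCommGroup Q] [Module A' Q]
    (k : M →ₛₗ[f] Q) (m : M) : h.lift k (g m) = k m := (h Q k).exists.choose_spec m

/-- Two scalar extensions of the same module are canonically isomorphic. -/
theorem exists_equiv (h : IsScalarExtension g) {M'' : Type u} [AddCommGroup M''] [Module A' M'']
    {g' : M →ₛₗ[f] M''} (h' : IsScalarExtension g') :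
    ∃ l : M' ≃ₗ[A'] M'', ∀ m, l (g m) = g' m := by
  refine ⟨LinearEquiv.ofLinearMap (h.lift g') (h'.lift g) (h'.hom_ext fun m => ?_)
    (h.hom_ext fun m => ?_), fun m => h.lift_apply g' m⟩
  · rw [LinearMap.comp_apply, h'.lift_apply, h.lift_apply, LinearMap.id_apply]
  · rw [LinearMap.comp_apply, h.lift_apply, h'.lift_apply, LinearMap.id_apply]

/-- Scalar extensions in a commutative square of rings. -/
theorem of_square (h : IsScalarExtension g) {C C' : Type u} [CommRing C] [CommRing C']
    {τ : A →+* C} {τ' : A' →+* C'} {w : C →+* C'} (hw : ∀ a, w (τ a) = τ' (f a))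
    {N N' : Type u} [AddCommGroup N] [AddCommGroup N'] [Module C N] [Module C' N']
    {u : M →ₛₗ[τ] N} {u' : M' →ₛₗ[τ'] N'} (hu : IsScalarExtension u) (hu' : IsScalarExtension u')
    {γ : N →ₛₗ[w] N'} (hγ : ∀ m, γ (u m) = u' (g m)) : IsScalarExtension γ := by
  intro Q _ _ k
  -- The composite M → N → Q is semilinear over w ∘ τ = τ' ∘ f; it is extended to M' along g and
  -- then to N' along u'.
  obtain ⟨l₁, hl₁⟩ := h.exists_lift τ'
    { toFun := fun m => k (u m), map_zero' := by rw [map_zero, map_zero],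
      map_add' := fun x y => by rw [map_add, map_add] } (Q := Q) (fun a m => by
        change k (u (a • m)) = τ' (f a) • k (u m)
        rw [map_smulₛₗ, map_smulₛₗ, hw])
  have hk : ∀ n, hu'.lift l₁ (γ n) = k n := by
    intro n
    induction n using hu.induction with
    | h0 m =>
      rw [hγ, hu'.lift_apply, hl₁]
      rfl
    | hadd x y hx hy => rw [map_add, map_add, map_add, hx, hy]
    | hsmul a x hx => rw [map_smulₛₗ, map_smul, map_smulₛₗ, hx]
  refine ⟨hu'.lift l₁, hk, fun l hl => hu'.hom_ext fun m' => ?_⟩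
  induction m' using h.induction with
  | h0 m => rw [← hγ, hl, hk]
  | hadd x y hx hy => simp only [map_add, hx, hy]
  | hsmul a x hx => simp only [map_smulₛₗ, RingHom.id_apply, hx]

end IsScalarExtension

end ScalarExtensionLemmas

/-! ### The graded ring Rees(W(R)), with τ and σ in low degrees. -/

section ReesGrading

variable (p : ℕ) [Fact p.Prime] (R : Type u) [CommRing R]

variable {p R}

theorem Rees.of_mul_of {i j : ℤ} (x : fil p R i) (y : fil p R j) :
    Rees.of p R i x * Rees.of p R j y =
      Rees.of p R (i + j) ⟨filMulVal i j x y, filMulVal_mem x.2 y.2⟩ :=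
  DirectSum.of_mul_of (A := fun j : ℤ => fil p R j) x y

theorem Rees.of_congr {i j : ℤ} (h : i = j) {x : fil p R i} {y : fil p R j}
    (hxy : (x : WittVector p R) = y) : Rees.of p R i x = Rees.of p R j y := by
  subst h
  rw [Subtype.ext hxy]

theorem filMulVal_zero_left {j : ℤ} (x y : WittVector p R) : filMulVal 0 j x y = x * y := by
  have h : ¬ ((0 : ℤ) < 0 ∧ 0 < j) := by omega
  rw [filMulVal, if_neg h]
  have e : (0 - 1 : ℤ).toNat + (j - 1).toNat - (0 + j - 1).toNat = 0 := by
    rw [zero_add]; omega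
  rw [e, pow_zero, one_mul]

variable (p R) in
/-- The inclusion `W(R) = Fil^0 → Rees(W(R))`. -/
def reesC : WittVector p R →+* Rees p R where
  toFun x := Rees.of p R 0 ⟨x, mem_fil_of_nonpos le_rfl x⟩
  map_one' := rfl
  map_zero' := map_zero (Rees.of p R 0)
  map_add' _ _ := (Rees.of p R 0).map_add ⟨_, _⟩ ⟨_, _⟩
  map_mul' x y := by
    rw [Rees.of_mul_of]
    exact Rees.of_congr (zero_add 0).symm (filMulVal_zero_left x y).symm

instance : Algebra (WittVector p R) (Rees p R) := (reesC p R).toAlgebra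

theorem Rees.algebraMap_eq (x : WittVector p R) : algebraMap (WittVector p R) (Rees p R) x =
    Rees.of p R 0 ⟨x, mem_fil_of_nonpos le_rfl x⟩ := rfl

theorem Rees.algebraMap_mul_of (x : WittVector p R) {j : ℤ} (y : fil p R j) :
    algebraMap (WittVector p R) (Rees p R) x * Rees.of p R j y =
      Rees.of p R j ⟨x * y, Ideal.mul_mem_left _ _ y.2⟩ := by
  rw [Rees.algebraMap_eq, Rees.of_mul_of]
  exact Rees.of_congr (zero_add j) (filMulVal_zero_left x _)

variable (p R) in
/-- The grading of the Rees algebra by `W(R)`-submodules. -/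
def reesGr (j : ℤ) : Submodule (WittVector p R) (Rees p R) where
  carrier := Set.range (Rees.of p R j)
  zero_mem' := ⟨0, map_zero _⟩
  add_mem' := by
    rintro _ _ ⟨x, rfl⟩ ⟨y, rfl⟩
    exact ⟨x + y, map_add _ _ _⟩
  smul_mem' := by
    rintro c _ ⟨x, rfl⟩
    rw [Algebra.smul_def, Rees.algebraMap_mul_of]
    exact ⟨_, rfl⟩

theorem Rees.of_mem (j : ℤ) (x : fil p R j) : Rees.of p R j x ∈ reesGr p R j := ⟨x, rfl⟩

theorem algebraMap_mem_reesGr (x : WittVector p R) :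
    algebraMap (WittVector p R) (Rees p R) x ∈ reesGr p R 0 := ⟨_, rfl⟩

theorem mem_reesGr_zero {b : Rees p R} (hb : b ∈ reesGr p R 0) :
    ∃ x, algebraMap (WittVector p R) (Rees p R) x = b := by
  obtain ⟨x, rfl⟩ := hb
  exact ⟨x, rfl⟩

theorem Rees.induction {P : Rees p R → Prop} (h0 : P 0) (hof : ∀ j x, P (Rees.of p R j x))
    (hadd : ∀ a b, P a → P b → P (a + b)) (b : Rees p R) : P b :=
  DirectSum.induction_on (motive := P) b h0 hof hadd

/-- The decomposition of the Rees algebra into its homogeneous parts. -/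
def reesDecompose : Rees p R →+ ⨁ j, reesGr p R j :=
  DirectSum.toAddMonoid fun j => (DirectSum.of (fun j => reesGr p R j) j).comp
    (AddMonoidHom.mk' (fun x : fil p R j => (⟨Rees.of p R j x, Rees.of_mem j x⟩ : reesGr p R j))
      fun x y => Subtype.ext (map_add (Rees.of p R j) x y))

theorem reesDecompose_of (j : ℤ) (x : fil p R j) : reesDecompose (Rees.of p R j x) =
    DirectSum.of (fun j => reesGr p R j) j ⟨Rees.of p R j x, Rees.of_mem j x⟩ := by
  exact DirectSum.toAddMonoid_of _ _ _

instance reesGradedAlgebra : GradedAlgebra (reesGr p R) where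
  one_mem := ⟨⟨1, mem_fil_of_nonpos le_rfl 1⟩, rfl⟩
  mul_mem i j a b ha hb := by
    obtain ⟨x, rfl⟩ := ha
    obtain ⟨y, rfl⟩ := hb
    rw [Rees.of_mul_of]
    exact Rees.of_mem _ _
  decompose' := reesDecompose
  left_inv b := by
    induction b using Rees.induction with
    | h0 => simp
    | hof j x => rw [reesDecompose_of, DirectSum.coeAddMonoidHom_of]
    | hadd a b ha hb => rw [map_add, map_add, ha, hb]
  right_inv b := by
    induction b using DirectSum.induction_on with
    | zero => simp
    | of j x =>
      obtain ⟨_, x, rfl⟩ := x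
      rw [DirectSum.coeAddMonoidHom_of, reesDecompose_of]
    | add a b ha hb => rw [map_add, map_add, ha, hb]

theorem tauHom_of (j : ℤ) (x : fil p R j) : tauHom p R (Rees.of p R j x) = tauVal j x := by
  unfold tauHom Rees.of
  exact DirectSum.toSemiring_of (A := fun j : ℤ => fil p R j) _ _ _ j x

theorem sigmaHom_of (j : ℤ) (x : fil p R j) : sigmaHom p R (Rees.of p R j x) = sigmaVal j x := by
  unfold sigmaHom Rees.of
  exact DirectSum.toSemiring_of (A := fun j : ℤ => fil p R j) _ _ _ j x

theorem tauHom_algebraMap (x : WittVector p R) :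
    tauHom p R (algebraMap (WittVector p R) (Rees p R) x) = x := by
  rw [Rees.algebraMap_eq, tauHom_of]
  simp [tauVal]

theorem sigmaHom_algebraMap (x : WittVector p R) :
    sigmaHom p R (algebraMap (WittVector p R) (Rees p R) x) = WittVector.frobenius x := by
  rw [Rees.algebraMap_eq, sigmaHom_of]
  simp [sigmaVal]

/-- In degrees at most 1 the map Fil^j → W(R) is the identity or the inclusion of I_R. From degree 2
on it involves multiplication by p, which need not be injective. -/
theorem tauHom_injOn {j : ℤ} (hj : j ≤ 1) {b : Rees p R} (hb : b ∈ reesGr p R j)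
    (h : tauHom p R b = 0) : b = 0 := by
  obtain ⟨x, rfl⟩ := hb
  rw [tauHom_of, tauVal, (by omega : (j - 1).toNat = 0), pow_zero, one_mul] at h
  rw [show x = 0 from Subtype.ext h, map_zero]

/-- This and the next two lemmas express σ through τ in the degrees 0, -1 and 1. Nothing else about
σ is needed to recognize M̃₁, because normal frames live in degrees 0 and -1. -/
theorem sigmaHom_of_deg_zero {b : Rees p R} (hb : b ∈ reesGr p R 0) :
    sigmaHom p R b = WittVector.frobenius (tauHom p R b) := by
  obtain ⟨x, rfl⟩ := mem_reesGr_zero hb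
  rw [sigmaHom_algebraMap, tauHom_algebraMap]

theorem sigmaHom_of_deg_neg_one {b : Rees p R} (hb : b ∈ reesGr p R (-1)) :
    sigmaHom p R b = (p : WittVector p R) * WittVector.frobenius (tauHom p R b) := by
  obtain ⟨x, rfl⟩ := hb
  rw [sigmaHom_of, tauHom_of]
  simp [sigmaVal, tauVal]

theorem verschiebung_sigmaHom {b : Rees p R} (hb : b ∈ reesGr p R 1) :
    WittVector.verschiebung (sigmaHom p R b) = tauHom p R b := by
  obtain ⟨x, rfl⟩ := hb
  obtain ⟨y, hy⟩ := exists_of_mem_fil one_pos x.2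
  rw [sigmaHom_of, tauHom_of, sigmaVal, if_pos one_pos, ← hy, verInv_verschiebung]
  simp [tauVal]

theorem tauHom_mem_augIdeal {b : Rees p R} (hb : b ∈ reesGr p R 1) :
    tauHom p R b ∈ augIdeal p R := ⟨_, verschiebung_sigmaHom hb⟩

variable (p R) in
/-- The element `t = 1 ∈ Fil^{-1}`. -/
def reesT : Rees p R := Rees.of p R (-1) ⟨1, mem_fil_of_nonpos (by omega) 1⟩

theorem reesT_mem : reesT p R ∈ reesGr p R (-1) := Rees.of_mem _ _

theorem tauHom_reesT : tauHom p R (reesT p R) = 1 := by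
  rw [reesT, tauHom_of]; simp [tauVal]

/-- The element `V(y) ∈ Fil^1`. -/
def reesV (y : WittVector p R) : Rees p R :=
  Rees.of p R 1 ⟨WittVector.verschiebung y, verschiebung_mem_fil 1 y⟩

theorem reesV_mem (y : WittVector p R) : reesV y ∈ reesGr p R 1 := Rees.of_mem _ _

theorem tauHom_reesV (y : WittVector p R) :
    tauHom p R (reesV y) = WittVector.verschiebung y := by
  rw [reesV, tauHom_of]; simp [tauVal]

variable (p R) in
/-- The graded homomorphism from the Rees algebra to `W(R)/I_R`, concentrated in degree `0`. -/
def resHom : Rees p R →+* WittVector p R ⧸ augIdeal p R :=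
  DirectSum.toSemiring (A := fun j : ℤ => fil p R j)
    (fun j => if j = 0 then
      (Ideal.Quotient.mk (augIdeal p R)).toAddMonoidHom.comp (fil p R j).toAddSubgroup.subtype
      else 0)
    (by
      rw [if_pos rfl]
      exact map_one (Ideal.Quotient.mk (augIdeal p R)))
    (by
      intro i j x y
      rcases eq_or_ne i 0 with rfl | hi
      · rcases eq_or_ne j 0 with rfl | hj
        · rw [if_pos (add_zero 0), if_pos rfl]
          change Ideal.Quotient.mk (augIdeal p R) (filMulVal 0 0 x y) =
            Ideal.Quotient.mk (augIdeal p R) x * Ideal.Quotient.mk (augIdeal p R) y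
          rw [filMulVal_zero_left, map_mul]
        · rw [if_neg (by omega), if_neg hj]
          simp
      · rw [if_neg hi, AddMonoidHom.zero_apply, zero_mul]
        split_ifs with hij
        -- Two opposite nonzero degrees: one of them is positive, so one of the factors lies in I_R
        -- and the product vanishes in the quotient.
        · change Ideal.Quotient.mk (augIdeal p R) (filMulVal i j x y) = 0
          rw [Ideal.Quotient.eq_zero_iff_mem]
          have h : ¬ (0 < i ∧ 0 < j) := by omega
          rw [filMulVal, if_neg h]
          refine Ideal.mul_mem_left _ _ ?_
          rcases lt_or_gt_of_ne hi with hi | hi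
          · exact Ideal.mul_mem_left _ _ (exists_of_mem_fil (by omega) y.2)
          · exact Ideal.mul_mem_right _ _ (exists_of_mem_fil hi x.2)
        · rfl)

theorem resHom_algebraMap (x : WittVector p R) :
    resHom p R (algebraMap (WittVector p R) (Rees p R) x) = Ideal.Quotient.mk _ x := by
  rw [Rees.algebraMap_eq]
  unfold resHom Rees.of
  refine (DirectSum.toSemiring_of (A := fun j : ℤ => fil p R j) _ _ _ _ _).trans ?_
  rw [if_pos rfl]
  rfl

theorem resHom_of_ne {j : ℤ} (hj : j ≠ 0) {b : Rees p R} (hb : b ∈ reesGr p R j) :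
    resHom p R b = 0 := by
  obtain ⟨x, rfl⟩ := hb
  unfold resHom Rees.of
  refine (DirectSum.toSemiring_of (A := fun j : ℤ => fil p R j) _ _ _ _ _).trans ?_
  rw [if_neg hj]
  rfl

variable {R' : Type u} [CommRing R'] (f : R →+* R')

theorem map_frobenius (x : WittVector p R) :
    WittVector.map f (WittVector.frobenius x) = WittVector.frobenius (WittVector.map f x) :=
  (WittVector.frobenius_isPoly p).map f x

theorem reesMap_of (j : ℤ) (x : fil p R j) : reesMap f (Rees.of p R j x) =
    Rees.of p R' j ⟨WittVector.map f x, map_mem_fil f x.2⟩ := by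
  unfold reesMap
  conv_lhs => unfold Rees.of
  exact DirectSum.toSemiring_of (A := fun j : ℤ => fil p R j) _ _ _ j x

theorem reesMap_mem {j : ℤ} {b : Rees p R} (hb : b ∈ reesGr p R j) :
    reesMap f b ∈ reesGr p R' j := by
  obtain ⟨x, rfl⟩ := hb
  rw [reesMap_of]
  exact Rees.of_mem _ _

theorem reesMap_algebraMap (x : WittVector p R) :
    reesMap f (algebraMap (WittVector p R) (Rees p R) x) =
      algebraMap (WittVector p R') (Rees p R') (WittVector.map f x) := by
  rw [Rees.algebraMap_eq, reesMap_of, Rees.algebraMap_eq]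

theorem tauHom_reesMap (b : Rees p R) :
    tauHom p R' (reesMap f b) = WittVector.map f (tauHom p R b) := by
  induction b using Rees.induction with
  | h0 => simp
  | hof j x => rw [reesMap_of, tauHom_of, tauHom_of]; simp [tauVal]
  | hadd a b ha hb => simp only [map_add, ha, hb]

theorem sigmaHom_reesMap (b : Rees p R) :
    sigmaHom p R' (reesMap f b) = WittVector.map f (sigmaHom p R b) := by
  induction b using Rees.induction with
  | h0 => simp
  | hof j x =>
    rw [reesMap_of, sigmaHom_of, sigmaHom_of, sigmaVal, sigmaVal]
    split_ifs with hj
    · obtain ⟨y, hy⟩ := exists_of_mem_fil hj x.2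
      simp only [← hy, WittVector.map_verschiebung, verInv_verschiebung]
    · simp only [map_mul, map_pow, map_natCast, map_frobenius]
  | hadd a b ha hb => simp only [map_add, ha, hb]

end ReesGrading

/-! ### Homogeneous components in graded groups. -/

section HomogeneousParts

variable {G σ : Type*} [AddCommGroup G] [SetLike σ G] [AddSubmonoidClass σ G] (𝒢 : ℤ → σ)
  [Decomposition 𝒢]

/-- The homogeneous part of degree `j` of an element of a graded group. -/
def homPart (j : ℤ) : G →+ G where
  toFun x := (decompose 𝒢 x j : G)
  map_zero' := by simp
  map_add' x y := by simp

theorem homPart_mem (j : ℤ) (x : G) : homPart 𝒢 j x ∈ 𝒢 j := (decompose 𝒢 x j).2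

variable {𝒢}

theorem homPart_of_mem {j : ℤ} {x : G} (hx : x ∈ 𝒢 j) : homPart 𝒢 j x = x :=
  decompose_of_mem_same 𝒢 hx

theorem homPart_of_mem_ne {j k : ℤ} {x : G} (hx : x ∈ 𝒢 j) (h : j ≠ k) : homPart 𝒢 k x = 0 :=
  decompose_of_mem_ne 𝒢 hx h

theorem homogeneous_induction {P : G → Prop} (h0 : P 0) (hof : ∀ j, ∀ x ∈ 𝒢 j, P x)
    (hadd : ∀ x y, P x → P y → P (x + y)) (x : G) : P x :=
  Decomposition.inductionOn 𝒢 h0 (fun m => hof _ _ m.2) hadd x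

end HomogeneousParts

/-! ### Homogeneous frames and their reduction to block diagonal form. -/

section GradedModules

variable {p : ℕ} [Fact p.Prime] {R : Type u} [CommRing R]

instance (N : ReesModule p R) : Decomposition N.deg := N.isInternal.chooseDecomposition

theorem ReesModule.smul_mem_deg (N : ReesModule p R) {i j : ℤ} {b : Rees p R}
    (hb : b ∈ reesGr p R i) {n : N.carrier} (hn : n ∈ N.deg j) : b • n ∈ N.deg (i + j) := by
  obtain ⟨x, rfl⟩ := hb
  exact N.smul_mem i j x n hn

theorem homPart_smul_right (N : ReesModule p R) {j : ℤ} (k : ℤ) (b : Rees p R) {y : N.carrier}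
    (hy : y ∈ N.deg j) :
    homPart N.deg k (b • y) = homPart (reesGr p R) (k - j) b • y := by
  induction b using homogeneous_induction (𝒢 := reesGr p R) with
  | h0 => simp
  | hof i b hb =>
    have h := N.smul_mem_deg hb hy
    rcases eq_or_ne (i + j) k with rfl | hk
    · rw [homPart_of_mem h, add_sub_cancel_right, homPart_of_mem hb]
    · rw [homPart_of_mem_ne h hk, homPart_of_mem_ne hb (by omega), zero_smul]
  | hadd x y hx hy => rw [add_smul, map_add, map_add, add_smul, hx, hy]

theorem homPart_mul_left {i : ℤ} (k : ℤ) {b : Rees p R} (hb : b ∈ reesGr p R i) (y : Rees p R) :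
    homPart (reesGr p R) (i + k) (b * y) = b * homPart (reesGr p R) k y := by
  induction y using homogeneous_induction (𝒢 := reesGr p R) with
  | h0 => simp
  | hof j y hy =>
    have h := SetLike.mul_mem_graded hb hy
    rcases eq_or_ne j k with rfl | hk
    · rw [homPart_of_mem h, homPart_of_mem hy]
    · rw [homPart_of_mem_ne h (by omega), homPart_of_mem_ne hy hk, mul_zero]
  | hadd x y hx hy => rw [mul_add, map_add, map_add, mul_add, hx, hy]

theorem homPart_apply_of_graded (N : ReesModule p R) {s : ℤ} {c : N.carrier →ₗ[Rees p R] Rees p R}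
    (hc : ∀ j, ∀ n ∈ N.deg j, c n ∈ reesGr p R (j - s)) (j : ℤ) (y : N.carrier) :
    c (homPart N.deg j y) = homPart (reesGr p R) (j - s) (c y) := by
  induction y using homogeneous_induction (𝒢 := N.deg) with
  | h0 => simp
  | hof i y hy =>
    rcases eq_or_ne i j with rfl | hk
    · rw [homPart_of_mem hy, homPart_of_mem (hc _ _ hy)]
    · rw [homPart_of_mem_ne hy hk, homPart_of_mem_ne (hc _ _ hy) (by omega), map_zero]
  | hadd x y hx hy => rw [map_add, map_add, map_add, map_add, hx, hy]

/-- The part of degree `-s` of a functional, as an additive map. -/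
def gradedPartAux (N : ReesModule p R) (c : N.carrier →ₗ[Rees p R] Rees p R) (s : ℤ) :
    N.carrier →+ Rees p R :=
  (DirectSum.toAddMonoid fun k => (homPart (reesGr p R) (k - s)).comp
    (c.toAddMonoidHom.comp (N.deg k).subtype)).comp
    (decomposeAddEquiv N.deg).toAddMonoidHom

theorem gradedPartAux_of_mem (N : ReesModule p R) (c : N.carrier →ₗ[Rees p R] Rees p R) (s : ℤ)
    {k : ℤ} {n : N.carrier} (hn : n ∈ N.deg k) :
    gradedPartAux N c s n = homPart (reesGr p R) (k - s) (c n) := by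
  change DirectSum.toAddMonoid _ (decompose N.deg n) = _
  rw [decompose_of_mem N.deg hn, DirectSum.toAddMonoid_of]
  rfl

/-- The part of degree `-s` of a functional on a graded module. -/
def gradedPart (N : ReesModule p R) (c : N.carrier →ₗ[Rees p R] Rees p R) (s : ℤ) :
    N.carrier →ₗ[Rees p R] Rees p R where
  toFun := gradedPartAux N c s
  map_add' := map_add _
  map_smul' b n := by
    rw [RingHom.id_apply]
    induction n using homogeneous_induction (𝒢 := N.deg) with
    | h0 => simp
    | hof k n hn =>
      induction b using homogeneous_induction (𝒢 := reesGr p R) with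
      | h0 => simp
      | hof i b hb =>
        rw [gradedPartAux_of_mem N c s (N.smul_mem_deg hb hn), gradedPartAux_of_mem N c s hn,
          map_smul, smul_eq_mul, smul_eq_mul, add_sub_assoc, homPart_mul_left _ hb]
      | hadd x y hx hy => rw [add_smul, map_add, add_smul, hx, hy]
    | hadd x y hx hy => rw [smul_add, map_add, map_add, smul_add, hx, hy]

theorem gradedPart_of_mem (N : ReesModule p R) (c : N.carrier →ₗ[Rees p R] Rees p R) (s : ℤ)
    {k : ℤ} {n : N.carrier} (hn : n ∈ N.deg k) :
    gradedPart N c s n = homPart (reesGr p R) (k - s) (c n) := gradedPartAux_of_mem N c s hn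

variable {ι : Type*} [Fintype ι]

/-- A frame of a graded module that consists of homogeneous elements and functionals. -/
structure GradedFrame (N : ReesModule p R) (dg : ι → ℤ) (e : Matrix ι ι (Rees p R)) extends
    Frame N.carrier e where
  x_mem : ∀ i, x i ∈ N.deg (dg i)
  c_mem : ∀ i j, ∀ n ∈ N.deg j, c i n ∈ reesGr p R (j - dg i)

/-- Each generator of an arbitrary frame is replaced by its homogeneous components, and the
component of degree s is paired with the degree -s part of the functional. For homogeneous y,
reconstruction is the corresponding homogeneous component of the formula for the original frame. -/
theorem exists_gradedFrame (N : ReesModule p R) [Module.Finite (Rees p R) N.carrier]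
    [Module.Projective (Rees p R) N.carrier] :
    ∃ (ι : Type) (_ : Fintype ι) (dg : ι → ℤ) (e : Matrix ι ι (Rees p R)),
      Nonempty (GradedFrame N dg e) := by
  classical
  obtain ⟨n, e, ⟨F⟩⟩ := exists_frame (A := Rees p R) N.carrier
  refine ⟨Σ i : Fin n, (decompose N.deg (F.x i)).support, inferInstance, fun s => s.2.1, _,
    ⟨⟨⟨fun s => homPart N.deg s.2 (F.x s.1), fun s => gradedPart N (F.c s.1) s.2, fun y => ?_,
      fun _ _ => rfl⟩, fun s => homPart_mem _ _ _, fun s j y hy => ?_⟩⟩⟩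
  · induction y using homogeneous_induction (𝒢 := N.deg) with
    | h0 => simp
    | hof k y hy =>
      conv_rhs => rw [← homPart_of_mem hy, ← F.repr y, map_sum]
      rw [Fintype.sum_sigma]
      refine Finset.sum_congr rfl fun i _ => ?_
      conv_rhs => rw [← sum_support_decompose N.deg (F.x i), Finset.smul_sum, map_sum,
        ← Finset.sum_coe_sort]
      refine Finset.sum_congr rfl fun j _ => ?_
      rw [homPart_smul_right N k _ (decompose N.deg (F.x i) j).2, gradedPart_of_mem _ _ _ hy]
      rfl
    | hadd x y hx hy => simp only [map_add, add_smul, Finset.sum_add_distrib, hx, hy]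
  · rw [gradedPart_of_mem _ _ _ hy]
    exact homPart_mem _ _ _

variable {N : ReesModule p R} {dg : ι → ℤ}

theorem GradedFrame.gram_mem {e : Matrix ι ι (Rees p R)} (F : GradedFrame N dg e) (i k : ι) :
    e i k ∈ reesGr p R (dg k - dg i) := by
  rw [← F.gram]
  exact F.c_mem i _ _ (F.x_mem k)

theorem sum_mem_reesGr {α : Type*} (s : Finset α) {f : α → Rees p R} {j : ℤ}
    (h : ∀ a ∈ s, f a ∈ reesGr p R j) : ∑ a ∈ s, f a ∈ reesGr p R j :=
  Submodule.sum_mem _ h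

/-- The degrees dg i - dg (π i) of the factors of each summand add up to 0 for every permutation π.
-/
theorem det_mem_reesGr_zero [DecidableEq ι] {u : Matrix ι ι (Rees p R)}
    (hu : ∀ i k, u i k ∈ reesGr p R (dg k - dg i)) : u.det ∈ reesGr p R 0 := by
  rw [Matrix.det_apply]
  refine sum_mem_reesGr _ fun π _ => ?_
  have h : ∏ i, u (π i) i ∈ reesGr p R (∑ i, (dg i - dg (π i))) :=
    SetLike.prod_mem_graded (reesGr p R) (fun i => dg i - dg (π i)) _ fun i _ => hu _ _
  have h0 : ∑ i, (dg i - dg (π i)) = 0 := by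
    rw [Finset.sum_sub_distrib, Equiv.sum_comp π dg, sub_self]
  rw [h0] at h
  rcases Int.units_eq_one_or (Equiv.Perm.sign π) with hs | hs
  · rwa [hs, one_smul]
  · rw [hs, Units.neg_smul, one_smul]
    exact neg_mem h

variable [IsAdicComplete (Ideal.span {(p : R)}) R]

/-- The determinant lies in degree 0, which is W(R), and is congruent to 1 modulo I_R, an ideal in
the Jacobson radical. Thus a Nakayama type statement over the Rees algebra reduces to W(R). -/
theorem isUnit_of_resHom_eq_one [DecidableEq ι] {u : Matrix ι ι (Rees p R)}
    (hu : ∀ i k, u i k ∈ reesGr p R (dg k - dg i)) (h1 : (resHom p R).mapMatrix u = 1) :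
    IsUnit u := by
  rw [Matrix.isUnit_iff_isUnit_det]
  obtain ⟨w, hw⟩ := mem_reesGr_zero (det_mem_reesGr_zero hu)
  have h2 : resHom p R u.det = 1 := by rw [RingHom.map_det, h1, Matrix.det_one]
  rw [← hw, resHom_algebraMap, ← map_one (Ideal.Quotient.mk (augIdeal p R)),
    Ideal.Quotient.eq] at h2
  rw [← hw]
  refine IsUnit.map _ ?_
  have := Ideal.mem_jacobson_bot.mp (augIdeal_le_jacobson h2) 1
  simpa using this

/-- A graded vector bundle has a frame whose Gram matrix has entries in `W(R)` and is block
diagonal with respect to the degrees. -/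
theorem GradedFrame.exists_blockDiagonal [DecidableEq ι] {ε : Matrix ι ι (Rees p R)}
    (F : GradedFrame N dg ε) :
    ∃ e : Matrix ι ι (WittVector p R), (∀ i k, dg i ≠ dg k → e i k = 0) ∧
      Nonempty (GradedFrame N dg (e.map (algebraMap (WittVector p R) (Rees p R)))) := by
  -- The blocks of ε between equal degrees have entries in degree 0, that is, in W(R). The other
  -- entries are killed by `resHom`, so x₀ and ε have the same reduction and x₀ is idempotent modulo
  -- I_R.
  set x₀ : Matrix ι ι (WittVector p R) :=
    Matrix.of fun i k => if dg i = dg k then tauHom p R (ε i k) else 0 with hx₀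
  have hx₀q : (Ideal.Quotient.mk (augIdeal p R)).mapMatrix x₀ = (resHom p R).mapMatrix ε := by
    ext i k
    simp only [RingHom.mapMatrix_apply, Matrix.map_apply, hx₀, Matrix.of_apply]
    split_ifs with h
    · have hm := F.gram_mem i k
      rw [h, sub_self] at hm
      obtain ⟨w, hw⟩ := mem_reesGr_zero hm
      rw [← hw, resHom_algebraMap, tauHom_algebraMap]
    · rw [resHom_of_ne (sub_ne_zero.mpr (Ne.symm h)) (F.gram_mem i k), map_zero]
  have hidem : x₀ * x₀ - x₀ ∈ entriesIn ι (augIdeal p R) := by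
    have h : (Ideal.Quotient.mk (augIdeal p R)).mapMatrix (x₀ * x₀ - x₀) = 0 := by
      rw [map_sub, map_mul, hx₀q, ← map_mul, F.idem, sub_self]
    intro i k
    exact Ideal.Quotient.eq_zero_iff_mem.mp (congrFun (congrFun h i) k)
  obtain ⟨e, hee, hex, hcomm⟩ := exists_idempotent_lift (augIdeal p R) x₀ hidem
  have hblock : ∀ i k, dg i ≠ dg k → e i k = 0 := by
    intro i k hik
    -- The projector onto the indices of a given degree commutes with x₀, hence with the lift e;
    -- this keeps e block diagonal.
    have h1 := hcomm (Matrix.diagonal fun m => if dg m = dg k then 1 else 0) (by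
      ext a b
      rw [Matrix.diagonal_mul, Matrix.mul_diagonal]
      simp only [hx₀, Matrix.of_apply]
      split_ifs with h1 h2 h3 <;> first | (exfalso; omega) | simp)
    have h2 := congrFun (congrFun h1 i) k
    rw [Matrix.diagonal_mul, Matrix.mul_diagonal, if_neg hik, if_pos rfl, zero_mul, mul_one] at h2
    exact h2.symm
  refine ⟨e, hblock, ?_⟩
  set α := algebraMap (WittVector p R) (Rees p R)
  set e' := e.map α with he'
  have he'e' : e' * e' = e' := by rw [he', ← Matrix.map_mul, hee]
  have he'mem : ∀ i k, e' i k ∈ reesGr p R (dg k - dg i) := by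
    intro i k
    rcases eq_or_ne (dg i) (dg k) with h | h
    · rw [h, sub_self]
      exact algebraMap_mem_reesGr _
    · rw [he', Matrix.map_apply, hblock i k h, map_zero]
      exact zero_mem _
  have hone : ∀ i k, (1 : Matrix ι ι (Rees p R)) i k ∈ reesGr p R (dg k - dg i) := by
    intro i k
    rcases eq_or_ne i k with rfl | h
    · rw [Matrix.one_apply_eq, sub_self]
      exact SetLike.one_mem_graded _
    · rw [Matrix.one_apply_ne h]
      exact zero_mem _
  have hmul : ∀ a b : Matrix ι ι (Rees p R), (∀ i k, a i k ∈ reesGr p R (dg k - dg i)) →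
      (∀ i k, b i k ∈ reesGr p R (dg k - dg i)) →
      ∀ i k, (a * b) i k ∈ reesGr p R (dg k - dg i) := by
    intro a b ha hb i k
    rw [Matrix.mul_apply]
    refine sum_mem_reesGr _ fun m _ => ?_
    have := SetLike.mul_mem_graded (ha i m) (hb m k)
    rwa [sub_add_sub_cancel'] at this
  -- The usual intertwiner of two nearby idempotents: v ε = e' v. Its entries have the right degrees
  -- and it reduces to 1, since e' and ε have the same reduction, so it is invertible.
  set v := e' * ε + (1 - e') * (1 - ε) with hv
  have hvmem : ∀ i k, v i k ∈ reesGr p R (dg k - dg i) := by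
    intro i k
    exact add_mem (hmul _ _ he'mem F.gram_mem i k)
      (hmul _ _ (fun i k => sub_mem (hone i k) (he'mem i k))
        (fun i k => sub_mem (hone i k) (F.gram_mem i k)) i k)
  have he'q : (resHom p R).mapMatrix e' = (resHom p R).mapMatrix ε := by
    rw [← hx₀q]
    ext i k
    simp only [RingHom.mapMatrix_apply, Matrix.map_apply, he']
    rw [resHom_algebraMap]
    exact Ideal.Quotient.eq.mpr (hex i k)
  have hvq : (resHom p R).mapMatrix v = 1 := by
    have h1 : (resHom p R).mapMatrix ε * (resHom p R).mapMatrix ε = (resHom p R).mapMatrix ε := by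
      rw [← map_mul, F.idem]
    rw [hv, map_add, map_mul, map_mul, map_sub, map_sub, map_one, he'q]
    simp only [sub_mul, mul_sub, one_mul, mul_one, h1]
    abel
  obtain ⟨V, hV⟩ := isUnit_of_resHom_eq_one hvmem hvq
  set w : Matrix ι ι (Rees p R) := ↑V⁻¹
  have hvw : v * w = 1 := by rw [← hV]; exact V.mul_inv
  have hwv : w * v = 1 := by rw [← hV]; exact V.inv_mul
  have hve : v * ε = e' * v := by
    simp only [hv, add_mul, mul_add, sub_mul, mul_sub, one_mul, mul_one, mul_assoc, F.idem]
    simp only [← mul_assoc, he'e']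
    abel
  set c' : ι → N.carrier →ₗ[Rees p R] Rees p R := fun i => ∑ k, v i k • F.c k with hc'
  set y : ι → N.carrier := fun i => ∑ k, w k i • F.x k with hy
  have hc'mem : ∀ i j, ∀ n ∈ N.deg j, c' i n ∈ reesGr p R (j - dg i) := by
    intro i j n hn
    simp only [hc', LinearMap.sum_apply, LinearMap.smul_apply, smul_eq_mul]
    refine sum_mem_reesGr _ fun k _ => ?_
    have := SetLike.mul_mem_graded (hvmem i k) (F.c_mem k j n hn)
    rwa [show dg k - dg i + (j - dg k) = j - dg i by ring] at this
  have hrepr : ∀ n, ∑ i, c' i n • y i = n := by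
    intro n
    simp only [hc', hy, LinearMap.sum_apply, LinearMap.smul_apply, smul_eq_mul, Finset.smul_sum,
      Finset.sum_mul, Finset.sum_smul, smul_smul]
    rw [Finset.sum_comm]
    conv_rhs => rw [← F.repr n]
    refine Finset.sum_congr rfl fun k _ => ?_
    rw [Finset.sum_comm]
    have h1 : ∀ m, ∑ i, w k i * v i m = (1 : Matrix ι ι (Rees p R)) k m := fun m => by
      rw [← hwv, Matrix.mul_apply]
    have h2 : ∀ m, ∑ i, (v i m * F.c m n * w k i) • F.x k =
        ((1 : Matrix ι ι (Rees p R)) k m * F.c m n) • F.x k := by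
      intro m
      rw [← h1, Finset.sum_mul, Finset.sum_smul]
      exact Finset.sum_congr rfl fun i _ => by ring_nf
    simp only [h2, Matrix.one_apply, ite_mul, one_mul, zero_mul, ite_smul, zero_smul,
      Finset.sum_ite_eq, Finset.mem_univ, if_true]
  have hgram : ∀ i k, c' i (y k) = e' i k := by
    intro i k
    have h1 : e' = v * ε * w := by rw [hve, mul_assoc, hvw, mul_one]
    rw [h1, Matrix.mul_apply]
    simp only [hc', hy, LinearMap.sum_apply, LinearMap.smul_apply, smul_eq_mul, map_sum, map_smul,
      F.gram, Matrix.mul_apply]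
    exact Finset.sum_congr rfl fun a _ => mul_comm _ _
  -- No homogeneity is established for the inverse w, so the `y i` are replaced by their components
  -- of degree dg i. Because the functionals c' and the matrix e' are homogeneous, both frame
  -- identities survive on taking components.
  refine ⟨⟨⟨fun i => homPart N.deg (dg i) (y i), c', fun n => ?_, fun i k => ?_⟩,
    fun i => homPart_mem _ _ _, hc'mem⟩⟩
  · induction n using homogeneous_induction (𝒢 := N.deg) with
    | h0 => simp
    | hof j n hn =>
      conv_rhs => rw [← homPart_of_mem hn, ← hrepr n, map_sum]
      refine Finset.sum_congr rfl fun i _ => ?_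
      have hb := hc'mem i j n hn
      generalize c' i n = b at hb
      generalize y i = z
      induction z using homogeneous_induction (𝒢 := N.deg) with
      | h0 => simp
      | hof k z hz =>
        have hbz := N.smul_mem_deg hb hz
        rcases eq_or_ne k (dg i) with rfl | hk
        · rw [homPart_of_mem hz, homPart_of_mem (j := j)]
          rwa [sub_add_cancel] at hbz
        · rw [homPart_of_mem_ne hz hk, homPart_of_mem_ne hbz (by omega), smul_zero]
      | hadd x y hx hy => simp only [map_add, smul_add, hx, hy]
    | hadd x y hx hy => simp only [map_add, add_smul, Finset.sum_add_distrib, hx, hy]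
  · rw [homPart_apply_of_graded N (hc'mem i), hgram]
    exact homPart_of_mem (he'mem i k)

end GradedModules

/-! ### Triviality of the grading on étale algebras over a field. -/

section ResidualGrading

variable {B B' : Type*} [CommRing B] [CommRing B'] [Algebra B B']

open scoped LaurentPolynomial in
/-- The coaction `B' → C[T, T⁻¹]` attached to a ring homomorphism from a graded ring `B'` to `C`. -/
def coaction (𝓑 : ℤ → AddSubgroup B') [GradedRing 𝓑] {C : Type*} [CommRing C] (ψ : B' →+* C) :
    B' →+* C[T;T⁻¹] :=
  (DirectSum.toSemiring
    (fun j => ((AddMonoidAlgebra.singleAddHom j).comp ψ.toAddMonoidHom).comp (𝓑 j).subtype)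
    (by
      change AddMonoidAlgebra.single 0 (ψ 1) = 1
      rw [map_one]
      rfl)
    (fun {i j} a b => by
      change AddMonoidAlgebra.single (i + j) (ψ (a * b)) =
        AddMonoidAlgebra.single i (ψ a) * AddMonoidAlgebra.single j (ψ b)
      rw [map_mul, AddMonoidAlgebra.single_mul_single])).comp
    (decomposeRingEquiv 𝓑).toRingHom

theorem coaction_of_mem {𝓑 : ℤ → AddSubgroup B'} [GradedRing 𝓑] {C : Type*} [CommRing C]
    (ψ : B' →+* C) {j : ℤ} {b : B'} (hb : b ∈ 𝓑 j) :
    coaction 𝓑 ψ b = AddMonoidAlgebra.single j (ψ b) := by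
  rw [coaction, RingHom.comp_apply]
  have h : (decomposeRingEquiv 𝓑).toRingHom b = DirectSum.of (fun j => 𝓑 j) j ⟨b, hb⟩ :=
    decompose_of_mem 𝓑 hb
  rw [h, DirectSum.toSemiring_of]
  rfl

/-- Let `B'` be a graded étale algebra over a ring `B` and let `B → k` be a homomorphism to a field.
If the structure map of `B'` is graded and kills the elements of nonzero degree in `k`, then the
elements of nonzero degree of `B'` vanish in `k ⊗ B'`. -/
theorem one_tmul_eq_zero_of_mem {k : Type*} [Field k] [Algebra B k] [Algebra.Etale B B']
    (𝓑 : ℤ → AddSubgroup B') [GradedRing 𝓑]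
    (hB : ∀ b : B, coaction 𝓑 (Algebra.TensorProduct.includeRight : B' →ₐ[B] k ⊗[B] B').toRingHom
      (algebraMap B B' b) = algebraMap B (LaurentPolynomial (k ⊗[B] B')) b)
    {j : ℤ} (hj : j ≠ 0) {b : B'} (hb : b ∈ 𝓑 j) : (1 ⊗ₜ b : k ⊗[B] B') = 0 := by
  -- An étale algebra over a field is finite and reduced: finiteness provides a monic equation for
  -- z, and reducedness turns nilpotent into zero.
  have hred : IsReduced (k ⊗[B] B') := Algebra.FormallyUnramified.isReduced_of_field k _
  have hfin : Module.Finite k (k ⊗[B] B') := Algebra.FormallyUnramified.finite_of_free k _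
  let δ : B' →ₐ[B] LaurentPolynomial (k ⊗[B] B') := ⟨coaction 𝓑 _, hB⟩
  -- The coaction of 𝔾_m on k ⊗ B'. It is k-linear because the nonzero degrees of B act by zero, and
  -- it sends z to z T^j.
  let Δ : k ⊗[B] B' →ₐ[k] LaurentPolynomial (k ⊗[B] B') :=
    Algebra.TensorProduct.lift (Algebra.ofId k _) δ fun _ _ => Commute.all _ _
  set z : k ⊗[B] B' := 1 ⊗ₜ b with hz
  have hΔ : Δ z = AddMonoidAlgebra.single j z := by
    rw [hz]
    simp only [Δ, Algebra.TensorProduct.lift_tmul, map_one, one_mul]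
    exact coaction_of_mem _ hb
  obtain ⟨P, hP, hPz⟩ := Algebra.IsIntegral.isIntegral (R := k) z
  have h1 : Polynomial.aeval (Δ z) P = 0 := by
    rw [Polynomial.aeval_algHom_apply, Polynomial.aeval_def, hPz, map_zero]
  rw [hΔ, Polynomial.aeval_eq_sum_range] at h1
  -- With n the degree of the monic polynomial P and P(z T^j) = 0, only the leading term contributes
  -- to T^{nj}, as j ≠ 0. Hence z^n = 0.
  have h2 := congrArg (fun q : LaurentPolynomial (k ⊗[B] B') => q.coeff (P.natDegree • j)) h1
  simp only [AddMonoidAlgebra.single_pow, AddMonoidAlgebra.coeff_sum, AddMonoidAlgebra.coeff_smul,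
    AddMonoidAlgebra.coeff_single, Finsupp.coe_finsetSum, Finset.sum_apply, Finsupp.smul_apply,
    AddMonoidAlgebra.coeff_zero, Finsupp.coe_zero, Pi.zero_apply] at h2
  rw [Finset.sum_eq_single P.natDegree, Finsupp.single_eq_same, hP.coeff_natDegree, one_smul] at h2
  · exact isNilpotent_iff_eq_zero.mp ⟨_, h2⟩
  · intro i _ hi
    rw [Finsupp.single_eq_of_ne, smul_zero]
    simp [hj, hi.symm]
  · simp

end ResidualGrading

/-! ### The structure of bundles of type μ_d: generators in degrees 0 and -1. -/

section NormalFrames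

variable {p : ℕ} [Fact p.Prime] {R : Type u} [CommRing R]

/-- A frame of a graded module that consists of elements `l i` of degree `0` and elements `t i` of
degree `-1`, with Gram matrix given by idempotent matrices `e` and `e'` over `W(R)`. -/
structure NormalFrame (N : ReesModule p R) {ι κ : Type*} [Fintype ι] [Fintype κ]
    (e : Matrix ι ι (WittVector p R)) (e' : Matrix κ κ (WittVector p R)) where
  l : ι → N.carrier
  t : κ → N.carrier
  a : ι → N.carrier →ₗ[Rees p R] Rees p R
  b : κ → N.carrier →ₗ[Rees p R] Rees p R
  l_mem : ∀ i, l i ∈ N.deg 0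
  t_mem : ∀ i, t i ∈ N.deg (-1)
  a_mem : ∀ i j, ∀ n ∈ N.deg j, a i n ∈ reesGr p R j
  b_mem : ∀ i j, ∀ n ∈ N.deg j, b i n ∈ reesGr p R (j + 1)
  repr : ∀ n, ∑ i, a i n • l i + ∑ i, b i n • t i = n
  a_l : ∀ i k, a i (l k) = algebraMap _ _ (e i k)
  a_t : ∀ i k, a i (t k) = 0
  b_l : ∀ i k, b i (l k) = 0
  b_t : ∀ i k, b i (t k) = algebraMap _ _ (e' i k)

/-- The residue field at a maximal ideal of `W(R)`, as the target of a homomorphism from the Rees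
algebra that kills the elements of nonzero degree. -/
def residueHom {𝔪 : Ideal (WittVector p R)} (h𝔪 : augIdeal p R ≤ 𝔪) :
    Rees p R →+* WittVector p R ⧸ 𝔪 :=
  (Ideal.Quotient.factor h𝔪).comp (resHom p R)

variable [IsAdicComplete (Ideal.span {(p : R)}) R]

/-- The residual form of the condition on the type: at every maximal ideal, the Gram matrix factors
over a nonzero algebra, and the factors are compatible with the degrees. -/
theorem GradedFrame.exists_residual_factors {N : ReesModule p R} {h d : ℕ} (hN : N.IsOfType h d)
    {ι : Type*} [Fintype ι] {dg : ι → ℤ} {e : Matrix ι ι (WittVector p R)}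
    (F : GradedFrame N dg (e.map (algebraMap (WittVector p R) (Rees p R))))
    (𝔪 : Ideal (WittVector p R)) (h𝔪 : 𝔪.IsMaximal) :
    ∃ (C : Type u) (_ : CommRing C) (_ : Nontrivial C) (φ : WittVector p R →+* C),
      (∀ w ∈ 𝔪, φ w = 0) ∧
      ∃ (X : Matrix (Fin d ⊕ Fin (h - d)) ι C) (Y : Matrix ι (Fin d ⊕ Fin (h - d)) C),
        Factors (e.map φ) X Y ∧ (∀ s i, dg i ≠ 0 → X (.inl s) i = 0) ∧
        ∀ s i, dg i ≠ -1 → X (.inr s) i = 0 := by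
  obtain ⟨B', _, _, 𝓑, hmon, hint, hgr, _, _, E, hE⟩ := hN
  let _ : Decomposition 𝓑 := hint.chooseDecomposition
  let _ : GradedRing 𝓑 := {}
  have hle : augIdeal p R ≤ 𝔪 := augIdeal_le_jacobson.trans (sInf_le ⟨bot_le, h𝔪⟩)
  let _ : Field (WittVector p R ⧸ 𝔪) := Ideal.Quotient.field 𝔪
  let _ : Algebra (Rees p R) (WittVector p R ⧸ 𝔪) := (residueHom hle).toAlgebra
  let C := (WittVector p R ⧸ 𝔪) ⊗[Rees p R] B'
  let ψ : B' →ₐ[Rees p R] C := Algebra.TensorProduct.includeRight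
  have hres : ∀ i (b : fil p R i), i ≠ 0 → algebraMap (Rees p R) C (Rees.of p R i b) = 0 := by
    intro i b hi
    rw [IsScalarTower.algebraMap_apply (Rees p R) (WittVector p R ⧸ 𝔪) C]
    have : algebraMap (Rees p R) (WittVector p R ⧸ 𝔪) (Rees.of p R i b) = 0 := by
      change residueHom hle _ = 0
      rw [residueHom, RingHom.comp_apply, resHom_of_ne hi (Rees.of_mem _ _), map_zero]
    rw [this, map_zero]
  -- In C the grading of B' has become trivial, so a coordinate of the trivialization survives only
  -- if its degree is 0.
  have hzero : ∀ j b, b ∈ 𝓑 j → j ≠ 0 → ψ b = 0 := by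
    intro j b hb hj
    refine one_tmul_eq_zero_of_mem (k := WittVector p R ⧸ 𝔪) 𝓑 (fun b => ?_) hj hb
    induction b using Rees.induction with
    | h0 => rw [map_zero, map_zero, map_zero]
    | hof i b =>
      rw [coaction_of_mem _ (hgr i b)]
      have h1 : (algebraMap (Rees p R) (LaurentPolynomial C)) (Rees.of p R i b) =
          AddMonoidAlgebra.single 0 (algebraMap (Rees p R) C (Rees.of p R i b)) := rfl
      have h2 : ψ (algebraMap (Rees p R) B' (Rees.of p R i b)) =
          algebraMap (Rees p R) C (Rees.of p R i b) := ψ.commutes _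
      rw [h1]
      refine (congrArg (AddMonoidAlgebra.single i) h2).trans ?_
      rcases eq_or_ne i 0 with rfl | hi
      · rfl
      · rw [hres i b hi, AddMonoidAlgebra.single_zero, AddMonoidAlgebra.single_zero]
    | hadd x y hx hy => rw [map_add, map_add, map_add, hx, hy]
  let E' := E.trans (LinearEquiv.sumArrowLequivProdArrow (Fin d) (Fin (h - d)) B' B').symm
  have hfac := ((F.toFrame.baseChange B').factors_of_basis (Module.Basis.ofEquivFun E')).map
    ψ.toRingHom
  have hx : ∀ i, (F.toFrame.baseChange B').x i = 1 ⊗ₜ F.x i := fun i => rfl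
  have hCnt : Nontrivial C := inferInstance
  refine ⟨C, inferInstance, hCnt, (algebraMap (Rees p R) C).comp (algebraMap _ _), ?_,
    (Matrix.of fun s i => (Module.Basis.ofEquivFun E').repr ((F.toFrame.baseChange B').x i) s).map
      ψ.toRingHom,
    (Matrix.of fun i s => (F.toFrame.baseChange B').c i (Module.Basis.ofEquivFun E' s)).map
      ψ.toRingHom, ?_, ?_, ?_⟩
  · intro w hw
    rw [RingHom.comp_apply, IsScalarTower.algebraMap_apply (Rees p R) (WittVector p R ⧸ 𝔪) C]
    have : algebraMap (Rees p R) (WittVector p R ⧸ 𝔪) (algebraMap (WittVector p R) _ w) = 0 := by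
      change residueHom hle _ = 0
      rw [residueHom, RingHom.comp_apply, resHom_algebraMap, Ideal.Quotient.factor_mk]
      exact Ideal.Quotient.eq_zero_iff_mem.mpr hw
    rw [this, map_zero]
  · convert hfac using 1
    ext i k
    exact (ψ.commutes _).symm
  · intro s i hi
    refine hzero _ _ ?_ hi
    rw [Matrix.of_apply, Module.Basis.ofEquivFun_repr_apply, hx]
    exact (hE _ _ (F.x_mem i)).1 s
  · intro s i hi
    -- Coordinates in B'(1) have degree dg i + 1; hence the summands of 𝒪(1)^{h-d} see only
    -- generators of degree -1.
    refine hzero _ _ ?_ (show dg i + 1 ≠ 0 by omega)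
    rw [Matrix.of_apply, Module.Basis.ofEquivFun_repr_apply, hx]
    exact (hE _ _ (F.x_mem i)).2 s

theorem sum_subtype_eq_sum_ite {ι G : Type*} [Fintype ι] [AddCommMonoid G] (P : ι → Prop)
    [DecidablePred P] (f : ι → G) : ∑ i : {i // P i}, f i = ∑ i, if P i then f i else 0 := by
  rw [← Finset.sum_filter]
  exact (Finset.sum_subtype _ (by simp) f).symm

theorem sum_subtype_of_eq_zero {ι G : Type*} [Fintype ι] [AddCommMonoid G] (P : ι → Prop)
    [DecidablePred P] {f : ι → G} (h : ∀ i, ¬ P i → f i = 0) :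
    ∑ i : {i // P i}, f i = ∑ i, f i := by
  rw [sum_subtype_eq_sum_ite]
  refine Finset.sum_congr rfl fun i _ => ?_
  split_ifs with hi
  · rfl
  · exact (h i hi).symm

/-- Every vector bundle of type `μ_d` has a normal frame. -/
theorem ReesModule.exists_normalFrame {N : ReesModule p R} {h d : ℕ} (hN : N.isBundle h d) :
    ∃ (ι κ : Type) (_ : Fintype ι) (_ : Fintype κ) (_ : DecidableEq ι) (_ : DecidableEq κ)
      (e : Matrix ι ι (WittVector p R)) (e' : Matrix κ κ (WittVector p R)),
      e * e = e ∧ e' * e' = e' ∧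
      IsLocRank e d ∧ IsLocRank e' (h - d) ∧ Nonempty (NormalFrame N e e') := by
  classical
  obtain ⟨_, _, -, htype⟩ := hN
  obtain ⟨ι, _, dg, ε, ⟨F₀⟩⟩ := exists_gradedFrame N
  obtain ⟨e, hblock, ⟨F⟩⟩ := F₀.exists_blockDiagonal
  have hres := F.exists_residual_factors htype
  have hidem : e * e = e := by
    have h := F.idem
    rw [← Matrix.map_mul] at h
    refine Matrix.map_injective (f := algebraMap (WittVector p R) (Rees p R)) ?_ h
    exact Function.LeftInverse.injective (g := tauHom p R) tauHom_algebraMap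
  let blk (P : ℤ → Prop) : Matrix {i // P (dg i)} {i // P (dg i)} (WittVector p R) :=
    Matrix.of fun i k => e i k
  have hsub : ∀ (P : ℤ → Prop) [DecidablePred P], blk P * blk P = blk P := by
    intro P _
    refine Matrix.ext fun i k => ?_
    rw [Matrix.mul_apply]
    have h := congrFun (congrFun hidem i) k
    rw [Matrix.mul_apply] at h
    refine (sum_subtype_of_eq_zero (fun m => P (dg m)) (f := fun m => e i m * e m k)
      fun m hm => ?_).trans h
    rw [hblock i m (fun h => hm (h ▸ i.2)), zero_mul]
  -- The block of e in the other degrees is idempotent. At every maximal ideal its columns vanish,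
  -- because those of X do, so its entries lie in the Jacobson radical and the block is zero.
  have hvanish : ∀ k, dg k ≠ 0 → dg k ≠ -1 → ∀ i, e i k = 0 := by
    intro k h0 h1 i
    have h := idempotent_eq_zero_of_mem_jacobson (hsub fun j => j ≠ 0 ∧ j ≠ -1) (by
      rintro ⟨i, hi⟩ ⟨k, hk⟩
      refine (Submodule.mem_sInf).mpr ?_
      rintro 𝔪 ⟨-, h𝔪⟩
      obtain ⟨C, _, _, φ, hφ, X, Y, hXY, hX, hX'⟩ := hres 𝔪 h𝔪
      have h2 : φ (e i k) = 0 := by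
        have := congrFun (congrFun hXY.1 i) k
        rw [Matrix.map_apply] at this
        rw [← this, Matrix.mul_apply]
        refine Finset.sum_eq_zero ?_
        rintro (s | s) -
        · rw [hX s k hk.1, mul_zero]
        · rw [hX' s k hk.2, mul_zero]
      by_contra h3
      have h4 : RingHom.ker φ = 𝔪 := (h𝔪.eq_of_le (RingHom.ker_ne_top φ) hφ).symm
      exact h3 (h4 ▸ h2))
    rcases eq_or_ne (dg i) (dg k) with hik | hik
    · exact congrFun (congrFun h ⟨i, by rw [hik]; exact ⟨h0, h1⟩⟩) ⟨k, h0, h1⟩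
    · exact hblock i k hik
  have hcomplete : ∀ {G : Type u} [AddCommGroup G] (f : ι → G),
      (∀ i, dg i ≠ 0 → dg i ≠ -1 → f i = 0) →
      ∑ i : {i // dg i = 0}, f i + ∑ i : {i // dg i = -1}, f i = ∑ i, f i := by
    intro G _ f hf
    rw [sum_subtype_eq_sum_ite, sum_subtype_eq_sum_ite, ← Finset.sum_add_distrib]
    refine Finset.sum_congr rfl fun i _ => ?_
    rcases eq_or_ne (dg i) 0 with h0 | h0
    · rw [if_pos h0, if_neg (by omega), add_zero]
    · rw [if_neg h0, zero_add]
      split_ifs with h1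
      · rfl
      · exact (hf i h0 h1).symm
  -- At a residue field the rows of X indexed by one summand are supported on one degree.
  -- Restricting X and Y to these rows and this degree therefore factors the corresponding block of
  -- e, which gives the rank of the block; j selects the summand.
  have hfactor : ∀ (P : ℤ → Prop) [DecidablePred P] (s : ℕ) (j : Fin s → Fin d ⊕ Fin (h - d))
      (_ : Function.Injective j),
      (∀ (C : Type u) [CommRing C] (X : Matrix (Fin d ⊕ Fin (h - d)) ι C),
        (∀ s i, dg i ≠ 0 → X (.inl s) i = 0) → (∀ s i, dg i ≠ -1 → X (.inr s) i = 0) →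
        (∀ s i, ¬ P (dg i) → X (j s) i = 0) ∧ ∀ r, r ∉ Set.range j → ∀ i, P (dg i) → X r i = 0) →
      IsLocRank (blk P) s := by
    intro P _ s j hj hX₀
    refine HasResidualRank.isLocRank (hsub P) fun 𝔪 h𝔪 => ?_
    obtain ⟨C, _, hC, φ, hφ, X, Y, hXY, hX, hX'⟩ := hres 𝔪 h𝔪
    obtain ⟨h1, h2⟩ := hX₀ C X hX hX'
    refine ⟨C, inferInstance, hC, φ, hφ, Matrix.of fun s i => X (j s) i,
      Matrix.of fun i s => Y i (j s), ?_, ?_⟩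
    · ext i k
      have h := congrFun (congrFun hXY.1 i) k
      rw [Matrix.mul_apply] at h
      rw [Matrix.mul_apply]
      refine Eq.trans ?_ h
      refine Fintype.sum_of_injective j hj _ _ (fun r hr => ?_) fun s => rfl
      rw [h2 r hr k k.2, mul_zero]
    · ext s s'
      have hs := congrFun (congrFun hXY.2 (j s)) (j s')
      rw [Matrix.mul_apply] at hs
      rw [Matrix.mul_apply]
      have h3 : (1 : Matrix (Fin d ⊕ Fin (h - d)) (Fin d ⊕ Fin (h - d)) C) (j s) (j s') =
          (1 : Matrix (Fin _) (Fin _) C) s s' := by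
        rw [Matrix.one_apply, Matrix.one_apply]
        exact if_congr hj.eq_iff rfl rfl
      rw [← h3, ← hs]
      refine sum_subtype_of_eq_zero (fun m => P (dg m)) (f := fun m => X (j s) m * Y m (j s'))
        fun m hm => ?_
      rw [h1 s m hm, zero_mul]
  -- The generators in the remaining degrees are zero and can be dropped without changing the sums
  -- in `repr`.
  have hx : ∀ i, dg i ≠ 0 → dg i ≠ -1 → F.x i = 0 := by
    intro i h0 h1
    rw [← F.x_eq i]
    refine Finset.sum_eq_zero fun k _ => ?_
    rw [Matrix.map_apply, hvanish i h0 h1 k, map_zero, zero_smul]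
  refine ⟨{i // dg i = 0}, {i // dg i = -1}, inferInstance, inferInstance, inferInstance,
    inferInstance, blk (· = 0), blk (· = -1), hsub (· = 0), hsub (· = -1),
    hfactor (· = 0) d Sum.inl Sum.inl_injective fun C _ X hX hX' => ⟨hX, ?_⟩,
    hfactor (· = -1) (h - d) Sum.inr Sum.inr_injective fun C _ X hX hX' => ⟨hX', ?_⟩,
    ⟨⟨fun i => F.x i, fun i => F.x i, fun i => F.c i, fun i => F.c i, ?_, ?_, ?_, ?_, ?_, ?_,
      ?_, ?_, ?_⟩⟩⟩
  · rintro (r | r) hr i hi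
    · exact absurd ⟨r, rfl⟩ hr
    · exact hX' r i (by omega)
  · rintro (r | r) hr i hi
    · exact hX r i (by omega)
    · exact absurd ⟨r, rfl⟩ hr
  · rintro ⟨i, hi⟩
    have := F.x_mem i
    rwa [hi] at this
  · rintro ⟨i, hi⟩
    have := F.x_mem i
    rwa [hi] at this
  · rintro ⟨i, hi⟩ j n hn
    have := F.c_mem i j n hn
    rwa [hi, sub_zero] at this
  · rintro ⟨i, hi⟩ j n hn
    have := F.c_mem i j n hn
    rwa [hi, sub_neg_eq_add] at this
  · intro n
    rw [hcomplete (fun i => F.c i n • F.x i) fun i h0 h1 => by rw [hx i h0 h1, smul_zero]]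
    exact F.repr n
  · exact fun i k => F.gram i k
  · rintro ⟨i, hi⟩ ⟨k, hk⟩
    rw [F.gram, Matrix.map_apply, hblock i k (by omega), map_zero]
  · rintro ⟨i, hi⟩ ⟨k, hk⟩
    rw [F.gram, Matrix.map_apply, hblock i k (by omega), map_zero]
  · exact fun i k => F.gram i k

end NormalFrames

/-! ### Base change of modules with frames. -/

section FrameExtension

variable {A A' : Type u} [CommRing A] [CommRing A'] {f : A →+* A'} {ι : Type*} [Fintype ι]
  {Q Q' : Type u} [AddCommGroup Q] [AddCommGroup Q'] [Module A Q] [Module A' Q']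
  {e : Matrix ι ι A}

/-- The semilinear map between modules with frames whose Gram matrices correspond. -/
def Frame.semilinearMap (F : Frame Q e) (F' : Frame Q' (e.map f)) : Q →ₛₗ[f] Q' where
  toFun q := ∑ i, f (F.c i q) • F'.x i
  map_add' q q' := by simp only [map_add, add_smul, Finset.sum_add_distrib]
  map_smul' a q := by simp only [map_smul, smul_eq_mul, map_mul, mul_smul, Finset.smul_sum]

theorem Frame.semilinearMap_apply (F : Frame Q e) (F' : Frame Q' (e.map f)) (q : Q) :
    F.semilinearMap F' q = ∑ i, f (F.c i q) • F'.x i := rfl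

theorem Frame.semilinearMap_x (F : Frame Q e) (F' : Frame Q' (e.map f)) (k : ι) :
    F.semilinearMap F' (F.x k) = F'.x k := by
  rw [Frame.semilinearMap_apply, ← F'.x_eq k]
  simp only [F.gram, Matrix.map_apply]

theorem Frame.isScalarExtension_semilinearMap (F : Frame Q e) (F' : Frame Q' (e.map f)) :
    IsScalarExtension (F.semilinearMap F') := by
  intro P _ _ k
  have hx : ∀ j, ∑ i, f (e i j) • k (F.x i) = k (F.x j) := by
    intro j
    conv_rhs => rw [← F.x_eq j, map_sum]
    exact Finset.sum_congr rfl fun i _ => (map_smulₛₗ k _ _).symm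
  refine ⟨∑ i, (F'.c i).smulRight (k (F.x i)), fun m => ?_, fun l hl => ?_⟩
  · have h1 : ∀ j, (∑ i, (F'.c i).smulRight (k (F.x i))) (F'.x j) = k (F.x j) := by
      intro j
      rw [← hx j]
      simp only [LinearMap.sum_apply, LinearMap.smulRight_apply, F'.gram, Matrix.map_apply]
    rw [Frame.semilinearMap_apply, map_sum]
    conv_rhs => rw [← F.repr m, map_sum]
    exact Finset.sum_congr rfl fun i _ => by rw [map_smul, h1, map_smulₛₗ]
  · refine F'.hom_ext fun j => ?_
    have := hl (F.x j)
    rw [F.semilinearMap_x] at this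
    rw [this, ← hx j]
    simp only [LinearMap.sum_apply, LinearMap.smulRight_apply, F'.gram, Matrix.map_apply]

end FrameExtension

/-! ### Constructing bundles of type μ_d from idempotents over W(R). -/

section NormalBundles

variable {p : ℕ} [Fact p.Prime] {R : Type u} [CommRing R]

theorem of_congr_coe {G : Type*} [AddCommGroup G] {𝒢 : ℤ → AddSubgroup G} {i j : ℤ} (h : i = j)
    {x : 𝒢 i} {y : 𝒢 j} (hxy : (x : G) = y) :
    DirectSum.of (fun j => 𝒢 j) i x = DirectSum.of (fun j => 𝒢 j) j y := by
  subst h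
  rw [Subtype.ext hxy]

/-- A module with a frame over the Rees algebra carries the grading for which the frame is
homogeneous of given degrees, provided that the entries of the Gram matrix have the right degrees. -/
def ReesModule.ofFrame {Q : Type u} [AddCommGroup Q] [Module (Rees p R) Q] {ι : Type*} [Fintype ι]
    {e : Matrix ι ι (Rees p R)} (F : Frame Q e) (dg : ι → ℤ)
    (hdg : ∀ i k, e i k ∈ reesGr p R (dg k - dg i)) : ReesModule p R where
  carrier := Q
  deg j :=
    { carrier := {q | ∀ i, F.c i q ∈ reesGr p R (j - dg i)}
      zero_mem' := fun i => by rw [map_zero]; exact zero_mem _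
      add_mem' := fun hx hy i => by rw [map_add]; exact add_mem (hx i) (hy i)
      neg_mem' := fun hx i => by rw [map_neg]; exact neg_mem (hx i) }
  smul_mem i j b n hn k := by
    rw [map_smul, smul_eq_mul, add_sub_assoc]
    exact SetLike.mul_mem_graded (Rees.of_mem _ _) (hn k)
  isInternal := by
    classical
    set deg : ℤ → AddSubgroup Q := fun j =>
      { carrier := {q | ∀ i, F.c i q ∈ reesGr p R (j - dg i)}
        zero_mem' := fun i => by rw [map_zero]; exact zero_mem _
        add_mem' := fun hx hy i => by rw [map_add]; exact add_mem (hx i) (hy i)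
        neg_mem' := fun hx i => by rw [map_neg]; exact neg_mem (hx i) } with hdeg
    have hsm : ∀ i j (b : reesGr p R j), (b : Rees p R) • F.x i ∈ deg (j + dg i) := by
      intro i j b k
      rw [map_smul, smul_eq_mul, F.gram, add_sub_assoc]
      exact SetLike.mul_mem_graded b.2 (hdg k i)
    let δ : ι → Rees p R →+ ⨁ j, deg j := fun i =>
      (DirectSum.toAddMonoid fun j => (DirectSum.of (fun j => deg j) (j + dg i)).comp
        (AddMonoidHom.mk' (fun b : reesGr p R j => (⟨(b : Rees p R) • F.x i, hsm i j b⟩ :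
          deg (j + dg i))) fun b b' => Subtype.ext (add_smul _ _ _))).comp
        (decomposeAddEquiv (reesGr p R)).toAddMonoidHom
    have hδ : ∀ i j b (hb : b ∈ reesGr p R j), δ i b =
        DirectSum.of (fun j => deg j) (j + dg i) ⟨b • F.x i, hsm i j ⟨b, hb⟩⟩ := by
      intro i j b hb
      change DirectSum.toAddMonoid _ (decompose (reesGr p R) b) = _
      rw [decompose_of_mem _ hb, DirectSum.toAddMonoid_of]
      rfl
    have hδc : ∀ i b, DirectSum.coeAddMonoidHom deg (δ i b) = b • F.x i := by
      intro i b
      induction b using homogeneous_induction (𝒢 := reesGr p R) with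
      | h0 => rw [map_zero, map_zero, zero_smul]
      | hof j b hb => rw [hδ i j b hb, DirectSum.coeAddMonoidHom_of]
      | hadd x y hx hy => rw [map_add, map_add, hx, hy, add_smul]
    -- An element q = Σ c_i(q) x_i is decomposed by decomposing its coefficients; the degree j part
    -- of c_i(q) contributes to degree j + dg i.
    let D : Q →+ ⨁ j, deg j := ∑ i, (δ i).comp (F.c i).toAddMonoidHom
    have hD : ∀ q, D q = ∑ i, δ i (F.c i q) := fun q => by
      rw [AddMonoidHom.finsetSum_apply]
      rfl
    refine (Decomposition.ofAddHom deg D ?_ ?_).isInternal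
    · refine AddMonoidHom.ext fun q => ?_
      rw [AddMonoidHom.comp_apply, hD, map_sum]
      simp only [hδc, F.repr, AddMonoidHom.id_apply]
    · refine DirectSum.addHom_ext fun j q => ?_
      rw [AddMonoidHom.comp_apply, AddMonoidHom.id_apply, DirectSum.coeAddMonoidHom_of, hD]
      have h1 : ∀ i, δ i (F.c i q) = DirectSum.of (fun j => deg j) j
          ⟨F.c i q • F.x i, by
            have := hsm i _ ⟨_, q.2 i⟩
            rwa [sub_add_cancel] at this⟩ := by
        intro i
        rw [hδ i _ _ (q.2 i)]
        exact of_congr_coe (sub_add_cancel _ _) rfl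
      simp only [h1, ← map_sum]
      congr 1
      refine Subtype.ext ?_
      rw [AddSubmonoidClass.coe_finsetSum]
      exact F.repr q

theorem ReesModule.exists_of_frame {Q : Type u} [AddCommGroup Q] [Module (Rees p R) Q] {ι : Type*}
    [Fintype ι] {e : Matrix ι ι (Rees p R)} (F : Frame Q e) (dg : ι → ℤ)
    (hdg : ∀ i k, e i k ∈ reesGr p R (dg k - dg i)) :
    ∃ N : ReesModule p R, Nonempty (GradedFrame N dg e) :=
  ⟨ReesModule.ofFrame F dg hdg, ⟨⟨F, fun k i => (F.gram i k).symm ▸ hdg i k, fun i _ _ hn => hn i⟩⟩⟩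

variable {ι κ : Type} [Fintype ι] [Fintype κ] {e : Matrix ι ι (WittVector p R)}
  {e' : Matrix κ κ (WittVector p R)}

/-- The frame underlying a normal frame. -/
def NormalFrame.toFrame {N : ReesModule p R} (F : NormalFrame N e e') :
    Frame N.carrier ((Matrix.fromBlocks e 0 0 e').map (algebraMap _ (Rees p R))) where
  x := Sum.elim F.l F.t
  c := Sum.elim F.a F.b
  repr n := by
    rw [Fintype.sum_sum_type]
    exact F.repr n
  gram i k := by
    rcases i with i | i <;> rcases k with k | k
    · exact F.a_l i k
    · exact (F.a_t i k).trans (map_zero (algebraMap (WittVector p R) (Rees p R))).symm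
    · exact (F.b_l i k).trans (map_zero (algebraMap (WittVector p R) (Rees p R))).symm
    · exact F.b_t i k

theorem NormalFrame.isOfType {N : ReesModule p R} (F : NormalFrame N e e') {h d : ℕ}
    (he : IsLocRank e d) (he' : IsLocRank e' (h - d)) : N.IsOfType h d := by
  obtain ⟨C, _, _, _, _, ⟨X, Y, hXY⟩, X', Y', hXY'⟩ := he.exists_common he'
  -- The graded covering is the base change of an étale covering C of W(R) that trivializes both
  -- idempotents, with C placed in degree 0.
  let _ : Algebra (Rees p R) (C ⊗[WittVector p R] Rees p R) := Algebra.TensorProduct.rightAlgebra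
  let ψ : C →ₐ[WittVector p R] C ⊗[WittVector p R] Rees p R := Algebra.TensorProduct.includeLeft
  have hfac := (hXY.fromBlocks hXY').map ψ.toRingHom
  have hmat : ((Matrix.fromBlocks (e.map (algebraMap (WittVector p R) C)) 0 0
      (e'.map (algebraMap (WittVector p R) C))).map
      ψ.toRingHom) = ((Matrix.fromBlocks e 0 0 e').map (algebraMap _ (Rees p R))).map
        (algebraMap (Rees p R) (C ⊗[WittVector p R] Rees p R)) := by
    have h1 : ∀ w : WittVector p R, ψ (algebraMap _ C w) =
        algebraMap (Rees p R) (C ⊗[WittVector p R] Rees p R) (algebraMap _ (Rees p R) w) := by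
      intro w
      rw [AlgHom.commutes]
      exact (Algebra.TensorProduct.includeRight
        (R := WittVector p R) (A := C) (B := Rees p R)).commutes w |>.symm
    ext i k
    rcases i with i | i <;> rcases k with k | k
    · exact h1 _
    · exact (map_zero ψ).trans (by simp)
    · exact (map_zero ψ).trans (by simp)
    · exact h1 _
  rw [hmat] at hfac
  let E := ((F.toFrame.baseChange (C ⊗[WittVector p R] Rees p R)).equivOfFactors hfac).trans
    (LinearEquiv.sumArrowLequivProdArrow (Fin d) (Fin (h - d)) _ _)
  let 𝓑 : ℤ → Submodule C (C ⊗[WittVector p R] Rees p R) := fun i => (reesGr p R i).baseChange C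
  have hgr : GradedAlgebra 𝓑 := GradedAlgebra.baseChange _
  let eqv : Rees p R ⊗[WittVector p R] C ≃ₐ[Rees p R] C ⊗[WittVector p R] Rees p R :=
    AlgEquiv.ofRingEquiv (f := (Algebra.TensorProduct.comm (WittVector p R) _ _).toRingEquiv)
      fun _ => rfl
  have hmem : ∀ {j : ℤ} (c : C) {b : Rees p R}, b ∈ reesGr p R j →
      ψ.toRingHom c * b • (1 : C ⊗[WittVector p R] Rees p R) ∈ 𝓑 j := by
    intro j c b hb
    have h1 : ψ.toRingHom c * b • (1 : C ⊗[WittVector p R] Rees p R) = c ⊗ₜ b := by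
      rw [Algebra.smul_def, mul_one]
      change (c ⊗ₜ 1) * (1 ⊗ₜ b) = (c ⊗ₜ b : C ⊗[WittVector p R] Rees p R)
      rw [Algebra.TensorProduct.tmul_mul_tmul, mul_one, one_mul]
    rw [h1]
    exact Submodule.tmul_mem_baseChange_of_mem c hb
  refine ⟨C ⊗[WittVector p R] Rees p R, inferInstance, inferInstance,
    fun i => (𝓑 i).toAddSubgroup, ?_, ?_, ?_, ?_, ?_, E, ?_⟩
  · exact { one_mem := hgr.toGradedMonoid.toGradedOne.one_mem
            mul_mem := fun _ _ _ _ hx hy => hgr.toGradedMonoid.toGradedMul.mul_mem hx hy }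
  · exact hgr.toDecomposition.isInternal
  · exact fun i b => Submodule.tmul_mem_baseChange_of_mem (1 : C) (Rees.of_mem i b)
  · exact Algebra.Etale.of_equiv eqv
  · exact Module.FaithfullyFlat.of_linearEquiv _ _ eqv.toLinearEquiv.symm
  · intro j n hn
    refine ⟨fun s => ?_, fun s => ?_⟩
    · change (F.toFrame.baseChange _).equivOfFactors hfac _ (Sum.inl s) ∈ 𝓑 j
      rw [Frame.equivOfFactors_apply]
      refine Submodule.sum_mem _ ?_
      rintro (i | i) -
      · rw [Frame.baseChange_c_tmul]
        exact hmem _ (F.a_mem i j n hn)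
      · rw [Matrix.map_apply, Matrix.fromBlocks_apply₁₂, Matrix.zero_apply, map_zero, zero_mul]
        exact zero_mem _
    · change (F.toFrame.baseChange _).equivOfFactors hfac _ (Sum.inr s) ∈ 𝓑 (j + 1)
      rw [Frame.equivOfFactors_apply]
      refine Submodule.sum_mem _ ?_
      rintro (i | i) -
      · rw [Matrix.map_apply, Matrix.fromBlocks_apply₂₁, Matrix.zero_apply, map_zero, zero_mul]
        exact zero_mem _
      · rw [Frame.baseChange_c_tmul]
        exact hmem _ (F.b_mem i j n hn)

theorem NormalFrame.isBundle {N : ReesModule p R} (F : NormalFrame N e e') {h d : ℕ} (hd : d ≤ h)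
    (he : IsLocRank e d) (he' : IsLocRank e' (h - d)) : N.isBundle h d := by
  refine ⟨F.toFrame.finite, F.toFrame.projective, fun 𝔭 => ?_, F.isOfType he he'⟩
  have := (he.fromBlocks he').map (algebraMap (WittVector p R) (Rees p R))
  rw [Nat.add_sub_cancel' hd] at this
  exact F.toFrame.rankAtStalk_eq this 𝔭

/-- The graded module attached to idempotent matrices `e` and `e'` over `W(R)`, with a normal
frame. -/
theorem exists_normalFrame_of_idempotent [DecidableEq ι] [DecidableEq κ] (he : e * e = e)
    (he' : e' * e' = e') : ∃ N : ReesModule p R, Nonempty (NormalFrame N e e') := by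
  set ε := (Matrix.fromBlocks e 0 0 e').map (algebraMap _ (Rees p R)) with hε
  have hεε : ε * ε = ε := by
    rw [hε, ← Matrix.map_mul, Matrix.fromBlocks_multiply]
    simp [he, he']
  let dg : ι ⊕ κ → ℤ := Sum.elim (fun _ => 0) fun _ => -1
  have hdg : ∀ i k, ε i k ∈ reesGr p R (dg k - dg i) := by
    rintro (i | i) (k | k)
    · exact algebraMap_mem_reesGr _
    · simp [hε]
    · simp [hε]
    · exact algebraMap_mem_reesGr _
  obtain ⟨N, ⟨F⟩⟩ := ReesModule.exists_of_frame (rangeFrame ε hεε) dg hdg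
  refine ⟨N, ⟨⟨fun i => F.x (.inl i), fun i => F.x (.inr i),
    fun i => F.c (.inl i), fun i => F.c (.inr i), fun i => F.x_mem (.inl i),
    fun i => F.x_mem (.inr i), ?_, ?_, ?_, fun i k => F.gram _ _, fun i k => ?_, fun i k => ?_, fun i k => F.gram _ _⟩⟩⟩
  · intro i j n hn
    have := F.c_mem (.inl i) j n hn
    rwa [show dg (.inl i) = 0 from rfl, sub_zero] at this
  · intro i j n hn
    have := F.c_mem (.inr i) j n hn
    rwa [show dg (.inr i) = -1 from rfl, sub_neg_eq_add] at this
  · intro n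
    have := F.repr n
    rwa [Fintype.sum_sum_type] at this
  · exact (F.gram _ _).trans (map_zero (algebraMap (WittVector p R) (Rees p R)))
  · exact (F.gram _ _).trans (map_zero (algebraMap (WittVector p R) (Rees p R)))

variable [IsAdicComplete (Ideal.span {(p : R)}) R] {R' : Type u} [CommRing R']

/-- Vector bundles of type `μ_d` on `Re(W(R))` have base changes. -/
theorem ReesBundle.exists_baseChange {h d : ℕ} (hd : d ≤ h) (f : R →+* R')
    (N : ReesBundle p R h d) : ∃ (N' : ReesBundle p R' h d)
      (g : N.obj.carrier →ₛₗ[reesMap (p := p) f] N'.obj.carrier),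
        IsBundleMap g ∧ IsScalarExtension g := by
  obtain ⟨ι, κ, _, _, _, _, e, e', he, he', hr, hr', ⟨F⟩⟩ := ReesModule.exists_normalFrame N.property
  -- The base change is the graded module of the images of the same idempotents in W(R'); no
  -- completeness of R' is needed here.
  obtain ⟨N', ⟨F'⟩⟩ := exists_normalFrame_of_idempotent (p := p) (R := R')
    (e := e.map (WittVector.map f)) (e' := e'.map (WittVector.map f))
    (by rw [← Matrix.map_mul, he]) (by rw [← Matrix.map_mul, he'])
  have hmat : (Matrix.fromBlocks (e.map (WittVector.map f)) 0 0 (e'.map (WittVector.map f))).map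
      (algebraMap _ (Rees p R')) =
      ((Matrix.fromBlocks e 0 0 e').map (algebraMap _ (Rees p R))).map (reesMap f) := by
    ext i k
    rcases i with i | i <;> rcases k with k | k <;> simp [reesMap_algebraMap]
  let F₁ : Frame N'.carrier (((Matrix.fromBlocks e 0 0 e').map (algebraMap _ (Rees p R))).map
    (reesMap f)) := ⟨F'.toFrame.x, F'.toFrame.c, F'.toFrame.repr, fun i k => by
      rw [F'.toFrame.gram, hmat]⟩
  refine ⟨⟨N', F'.isBundle hd (hr.map _) (hr'.map _)⟩, F.toFrame.semilinearMap F₁, ?_,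
    F.toFrame.isScalarExtension_semilinearMap F₁⟩
  intro j n hn
  rw [Frame.semilinearMap_apply, Fintype.sum_sum_type]
  refine add_mem (sum_mem fun i _ => ?_) (sum_mem fun i _ => ?_)
  · have := N'.smul_mem_deg (reesMap_mem (f := f) (F.a_mem i j n hn)) (F'.l_mem i)
    rwa [add_zero] at this
  · have := N'.smul_mem_deg (reesMap_mem (f := f) (F.b_mem i j n hn)) (F'.t_mem i)
    rwa [add_neg_cancel_right] at this

end NormalBundles

/-! ### Split frames, and lifting of direct sum decompositions modulo I. -/

section SplitFrames

variable {A : Type u} [CommRing A] {I : Ideal A} {M : Type u} [AddCommGroup M] [Module A M]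
  {S : Submodule A M} {ι κ : Type*} [Fintype ι] [Fintype κ] {e : Matrix ι ι A} {e' : Matrix κ κ A}

/-- A dual basis of `M` that is adapted to a submodule of the form `S = L ⊕ I T` in a decomposition
`M = L ⊕ T`: the elements `l i` lie in `L`, the elements `t i` lie in `T`. -/
structure SplitFrame (I : Ideal A) (S : Submodule A M) (e : Matrix ι ι A) (e' : Matrix κ κ A) where
  l : ι → M
  t : κ → M
  a : ι → M →ₗ[A] A
  b : κ → M →ₗ[A] A
  mem_iff : ∀ m, m ∈ S ↔ ∀ i, b i m ∈ I
  repr : ∀ m, ∑ i, a i m • l i + ∑ i, b i m • t i = m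
  a_l : ∀ i k, a i (l k) = e i k
  a_t : ∀ i k, a i (t k) = 0
  b_l : ∀ i k, b i (l k) = 0
  b_t : ∀ i k, b i (t k) = e' i k

/-- The reduction modulo `I` of a functional. -/
def functionalModIdeal (I : Ideal A) (a : M →ₗ[A] A) :
    (M ⧸ I • (⊤ : Submodule A M)) →ₗ[A ⧸ I] A ⧸ I where
  toFun := (I • (⊤ : Submodule A M)).liftQ ((Submodule.mkQ I).comp a) (by
    refine Submodule.smul_le.mpr fun r hr m _ => ?_
    rw [LinearMap.mem_ker, LinearMap.comp_apply, map_smul, Submodule.mkQ_apply,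
      Submodule.Quotient.mk_eq_zero]
    exact I.mul_mem_right _ hr)
  map_add' := map_add _
  map_smul' r z := by
    obtain ⟨r, rfl⟩ := Ideal.Quotient.mk_surjective r
    exact map_smul _ r z

theorem functionalModIdeal_mkQ (a : M →ₗ[A] A) (m : M) :
    functionalModIdeal I a ((I • (⊤ : Submodule A M)).mkQ m) = Ideal.Quotient.mk I (a m) := rfl

theorem mkQ_smul (r : A) (m : M) : (I • (⊤ : Submodule A M)).mkQ (r • m) =
    Ideal.Quotient.mk I r • (I • (⊤ : Submodule A M)).mkQ m := rfl

theorem exists_of_mem_span_mkQ {z : M ⧸ I • (⊤ : Submodule A M)}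
    (hz : z ∈ Submodule.span (A ⧸ I) ((I • (⊤ : Submodule A M)).mkQ '' S)) :
    ∃ s ∈ S, (I • (⊤ : Submodule A M)).mkQ s = z := by
  induction hz using Submodule.span_induction with
  | mem x hx => exact hx
  | zero => exact ⟨0, zero_mem _, map_zero _⟩
  | add x y _ _ hx hy =>
    obtain ⟨s, hs, rfl⟩ := hx
    obtain ⟨s', hs', rfl⟩ := hy
    exact ⟨s + s', add_mem hs hs', map_add _ _ _⟩
  | smul r x _ hx =>
    obtain ⟨s, hs, rfl⟩ := hx
    obtain ⟨r, rfl⟩ := Ideal.Quotient.mk_surjective r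
    exact ⟨r • s, S.smul_mem r hs, rfl⟩

/-- Since S contains I M, it is the full preimage of its image. -/
theorem mem_of_mkQ_mem_span (hS : I • (⊤ : Submodule A M) ≤ S) {m : M}
    (hm : (I • (⊤ : Submodule A M)).mkQ m ∈
      Submodule.span (A ⧸ I) ((I • (⊤ : Submodule A M)).mkQ '' S)) : m ∈ S := by
  obtain ⟨s, hs, h⟩ := exists_of_mem_span_mkQ hm
  have h1 : s - m ∈ I • (⊤ : Submodule A M) := by
    rw [← Submodule.ker_mkQ (I • (⊤ : Submodule A M)), LinearMap.mem_ker, map_sub, h, sub_self]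
  have := sub_mem hs (hS h1)
  rwa [sub_sub_cancel] at this

namespace SplitFrame

variable (F : SplitFrame I S e e')

theorem l_mem (i : ι) : F.l i ∈ S := (F.mem_iff _).mpr fun k => by
  rw [F.b_l]
  exact zero_mem _

theorem smul_le (F : SplitFrame I S e e') : I • (⊤ : Submodule A M) ≤ S := by
  refine Submodule.smul_le.mpr fun r hr m _ => (F.mem_iff _).mpr fun i => ?_
  rw [map_smul]
  exact I.mul_mem_right _ hr

/-- The frame underlying a split frame. -/
def toFrame : Frame M (Matrix.fromBlocks e 0 0 e') where
  x := Sum.elim F.l F.t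
  c := Sum.elim F.a F.b
  repr n := by
    rw [Fintype.sum_sum_type]
    exact F.repr n
  gram i k := by
    rcases i with i | i <;> rcases k with k | k
    · exact F.a_l i k
    · exact F.a_t i k
    · exact F.b_l i k
    · exact F.b_t i k

theorem mkQ_repr {m : M} (hm : m ∈ S) :
    ∑ i, Ideal.Quotient.mk I (F.a i m) • (I • (⊤ : Submodule A M)).mkQ (F.l i) =
      (I • (⊤ : Submodule A M)).mkQ m := by
  conv_rhs => rw [← F.repr m, map_add, map_sum, map_sum]
  rw [Finset.sum_eq_zero (s := Finset.univ) (f := fun i : κ =>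
    (I • (⊤ : Submodule A M)).mkQ (F.b i m • F.t i)), add_zero]
  · rfl
  · intro i _
    rw [mkQ_smul, Ideal.Quotient.eq_zero_iff_mem.mpr ((F.mem_iff m).mp hm i), zero_smul]

/-- The frame of `S / I M` over `A / I`. -/
def residueFrame : Frame (Submodule.span (A ⧸ I) ((I • (⊤ : Submodule A M)).mkQ '' S))
    (e.map (Ideal.Quotient.mk I)) where
  x i := ⟨_, Submodule.subset_span ⟨F.l i, F.l_mem i, rfl⟩⟩
  c i := (functionalModIdeal I (F.a i)).comp (Submodule.subtype _)
  repr := by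
    rintro ⟨z, hz⟩
    refine Subtype.ext ?_
    obtain ⟨m, hm, rfl⟩ := exists_of_mem_span_mkQ hz
    rw [Submodule.coe_sum]
    exact F.mkQ_repr hm
  gram i k := by
    rw [Matrix.map_apply, ← F.a_l i k]
    rfl

theorem exists_isCompl (F : SplitFrame I S e e') :
    ∃ C : Submodule (A ⧸ I) (M ⧸ I • (⊤ : Submodule A M)),
    IsCompl (Submodule.span (A ⧸ I) ((I • (⊤ : Submodule A M)).mkQ '' S)) C := by
  refine ⟨⨅ i, LinearMap.ker (functionalModIdeal I (F.a i)), ⟨?_, ?_⟩⟩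
  · rw [Submodule.disjoint_def]
    intro z hz hz'
    obtain ⟨m, hm, rfl⟩ := exists_of_mem_span_mkQ hz
    rw [← F.mkQ_repr hm]
    refine Finset.sum_eq_zero fun i _ => ?_
    have := (Submodule.mem_iInf _).mp hz' i
    rw [LinearMap.mem_ker, functionalModIdeal_mkQ] at this
    rw [this, zero_smul]
  · rw [codisjoint_iff, Submodule.eq_top_iff']
    intro z
    obtain ⟨m, rfl⟩ := Submodule.mkQ_surjective _ z
    rw [← F.repr m, map_add]
    refine Submodule.add_mem_sup ?_ ?_
    · rw [map_sum]
      refine Submodule.sum_mem _ fun i _ => ?_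
      rw [mkQ_smul]
      exact Submodule.smul_mem _ _ (Submodule.subset_span ⟨F.l i, F.l_mem i, rfl⟩)
    · refine (Submodule.mem_iInf _).mpr fun i => ?_
      rw [LinearMap.mem_ker, functionalModIdeal_mkQ, map_sum, Finset.sum_eq_zero, map_zero]
      intro k _
      rw [map_smul, F.a_t, smul_zero]

end SplitFrame

/-- The split frame given by a decomposition and frames of the summands. -/
def SplitFrame.ofIsCompl {L T : Submodule A M} (h : IsCompl L T) (hS : S = L ⊔ I • T)
    (F : Frame L e) (F' : Frame T e') : SplitFrame I S e e' where
  l i := F.x i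
  t i := F'.x i
  a i := F.c i ∘ₗ L.projectionOnto T h
  b i := F'.c i ∘ₗ T.projectionOnto L h.symm
  mem_iff m := by
    subst hS
    refine ⟨fun hm i => ?_, fun hm => ?_⟩
    · obtain ⟨l, hl, t, ht, rfl⟩ := Submodule.mem_sup.mp hm
      rw [map_add, LinearMap.comp_apply, (T.projectionOnto_apply_eq_zero_iff h.symm).mpr hl,
        map_zero, zero_add]
      have : (I • T).map (F'.c i ∘ₗ T.projectionOnto L h.symm) ≤ I := by
        rw [Submodule.map_smul'']
        exact Submodule.smul_le.mpr fun r hr x _ => I.mul_mem_right _ hr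
      exact this ⟨t, ht, rfl⟩
    · have h1 : m = L.projectionOnto T h m + T.projectionOnto L h.symm m :=
        (Submodule.projection_add_projection_eq_self h m).symm
      rw [h1]
      refine Submodule.add_mem_sup (Subtype.mem _) ?_
      rw [← F'.repr (T.projectionOnto L h.symm m), Submodule.coe_sum]
      exact Submodule.sum_mem _ fun i _ => Submodule.smul_mem_smul (hm i) (Subtype.mem _)
  repr m := by
    have h1 : m = L.projectionOnto T h m + T.projectionOnto L h.symm m :=
        (Submodule.projection_add_projection_eq_self h m).symm
    conv_rhs => rw [h1, ← F.repr (L.projectionOnto T h m),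
      ← F'.repr (T.projectionOnto L h.symm m), Submodule.coe_sum, Submodule.coe_sum]
    rfl
  a_l i k := by
    rw [LinearMap.comp_apply, Submodule.projectionOnto_apply_left, F.gram]
  a_t i k := by
    rw [LinearMap.comp_apply, Submodule.projectionOnto_apply_right, map_zero]
  b_l i k := by
    rw [LinearMap.comp_apply, Submodule.projectionOnto_apply_right, map_zero]
  b_t i k := by
    rw [LinearMap.comp_apply, Submodule.projectionOnto_apply_left, F'.gram]

/-- A direct sum decomposition modulo `I` lifts along an `I`-adically complete ring. -/
theorem exists_isCompl_of_isCompl_mod [IsAdicComplete I A] [Module.Finite A M]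
    [Module.Projective A M] (hS : I • (⊤ : Submodule A M) ≤ S)
    {C : Submodule (A ⧸ I) (M ⧸ I • (⊤ : Submodule A M))}
    (hC : IsCompl (Submodule.span (A ⧸ I) ((I • (⊤ : Submodule A M)).mkQ '' S)) C) :
    ∃ L T : Submodule A M, IsCompl L T ∧ S = L ⊔ I • T := by
  obtain ⟨n, ε, ⟨F⟩⟩ := exists_frame (A := A) M
  set q := (I • (⊤ : Submodule A M)).mkQ with hq
  let π : (M ⧸ I • (⊤ : Submodule A M)) →ₗ[A] (M ⧸ I • (⊤ : Submodule A M)) :=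
    { toFun := Submodule.projection _ C hC
      map_add' := map_add _
      map_smul' := fun r z => map_smul (Submodule.projection _ C hC) (Ideal.Quotient.mk I r) z }
  -- The projection modulo I lifts to an endomorphism φ of M by projectivity; φ is idempotent only
  -- modulo I, which is why its matrix x has to be corrected.
  obtain ⟨φ, hφ⟩ := Module.projective_lifting_property q (π ∘ₗ q) (Submodule.mkQ_surjective _)
  replace hφ : ∀ m, q (φ m) = π (q m) := fun m => LinearMap.congr_fun hφ m
  have hππ : ∀ z, π (π z) = π z := fun z =>
    Submodule.projection_apply_left hC ⟨_, Submodule.projection_apply_mem hC z⟩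
  have hker : ∀ m, q m = 0 → m ∈ I • (⊤ : Submodule A M) := fun m hm => by
    rwa [← Submodule.ker_mkQ (I • (⊤ : Submodule A M)), LinearMap.mem_ker]
  have hcI : ∀ i, ∀ m ∈ I • (⊤ : Submodule A M), F.c i m ∈ I := by
    intro i m hm
    have : (I • (⊤ : Submodule A M)).map (F.c i) ≤ I := by
      rw [Submodule.map_smul'']
      exact Submodule.smul_le.mpr fun r hr x _ => I.mul_mem_right _ hr
    exact this ⟨m, hm, rfl⟩
  set x : Matrix (Fin n) (Fin n) A := Matrix.of fun i k => F.c i (φ (F.x k)) with hx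
  have hφx : ∀ i m, ∑ k, x i k * F.c k m = F.c i (φ m) := by
    intro i m
    conv_rhs => rw [← F.repr m, map_sum, map_sum]
    exact Finset.sum_congr rfl fun k _ => by
      rw [map_smul, map_smul, smul_eq_mul, mul_comm]
      rfl
  have hidem : x * x - x ∈ entriesIn (Fin n) I := by
    intro i k
    rw [Matrix.sub_apply, Matrix.mul_apply]
    have h1 : ∑ j, x i j * x j k = F.c i (φ (φ (F.x k))) := hφx i (φ (F.x k))
    rw [h1]
    change F.c i (φ (φ (F.x k))) - F.c i (φ (F.x k)) ∈ I
    rw [← map_sub]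
    refine hcI i _ (hker _ ?_)
    rw [map_sub, hφ, hφ, hππ, sub_self]
  -- M is only the image of ε in A^n, so the corrected matrix must commute with ε in order to act on
  -- M by the formula for ψ. This holds for x, and the lift inherits it from the bicommutant
  -- property.
  have hεx : ε * x = x * ε := by
    ext i k
    rw [Matrix.mul_apply, Matrix.mul_apply]
    have h1 : ∑ j, x i j * ε j k = F.c i (φ (F.x k)) := by
      rw [← hφx i (F.x k)]
      simp only [F.gram]
    rw [h1]
    exact F.c_eq i (φ (F.x k))
  obtain ⟨e, hee, hex, hcomm⟩ := exists_idempotent_lift I x hidem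
  have hεe := hcomm ε hεx
  let ψ : M →ₗ[A] M := ∑ i, ∑ k, (e i k • F.c k).smulRight (F.x i)
  have hψ : ∀ m, ψ m = ∑ i, (∑ k, e i k * F.c k m) • F.x i := by
    intro m
    simp only [ψ, LinearMap.sum_apply, LinearMap.smulRight_apply, LinearMap.smul_apply,
      smul_eq_mul, Finset.sum_smul]
  have hcψ : ∀ j m, F.c j (ψ m) = ∑ k, e j k * F.c k m := by
    intro j m
    have h1 : F.c j (ψ m) = (ε.mulVec (e.mulVec fun k => F.c k m)) j := by
      rw [hψ, map_sum]
      exact Finset.sum_congr rfl fun i _ => by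
        rw [map_smul, F.gram, smul_eq_mul, mul_comm]
        rfl
    rw [h1, Matrix.mulVec_mulVec, hεe, ← Matrix.mulVec_mulVec]
    have h2 : (ε.mulVec fun k => F.c k m) = fun k => F.c k m := funext fun k => F.c_eq k m
    rw [h2]
    rfl
  have hψψ : ∀ m, ψ (ψ m) = ψ m := by
    intro m
    rw [hψ (ψ m)]
    conv_rhs => rw [hψ m]
    refine Finset.sum_congr rfl fun i _ => ?_
    simp only [hcψ]
    congr 1
    change (e.mulVec (e.mulVec fun k => F.c k m)) i = (e.mulVec fun k => F.c k m) i
    rw [Matrix.mulVec_mulVec, hee]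
  have hqψ : ∀ m, q (ψ m) = π (q m) := by
    intro m
    rw [← hφ, ← sub_eq_zero, ← map_sub, ← F.repr (φ m), hψ, ← Finset.sum_sub_distrib,
      ← LinearMap.mem_ker, hq, Submodule.ker_mkQ]
    refine Submodule.sum_mem _ fun i _ => ?_
    rw [← hφx, ← sub_smul, ← Finset.sum_sub_distrib]
    refine Submodule.smul_mem_smul (Ideal.sum_mem _ fun k _ => ?_) trivial
    rw [← sub_mul]
    exact I.mul_mem_right _ (hex i k)
  -- ψ is an idempotent endomorphism of M that lifts the projection onto S/IM, so its image and
  -- kernel are the summands L and T.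
  refine ⟨LinearMap.range ψ, LinearMap.ker ψ, ?_, ?_⟩
  · refine IsCompl.of_eq ?_ ?_
    · rw [eq_bot_iff]
      rintro _ ⟨⟨m, rfl⟩, h⟩
      rw [SetLike.mem_coe, LinearMap.mem_ker, hψψ] at h
      exact h
    · rw [eq_top_iff]
      intro m _
      rw [← add_sub_cancel (ψ m) m]
      refine Submodule.add_mem_sup ⟨m, rfl⟩ ?_
      rw [LinearMap.mem_ker, map_sub, hψψ, sub_self]
  · refine le_antisymm (fun m hm => ?_) (sup_le ?_ ?_)
    · rw [← add_sub_cancel (ψ m) m]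
      refine Submodule.add_mem_sup ⟨m, rfl⟩ ?_
      have h1 : m - ψ m ∈ I • (⊤ : Submodule A M) := by
        refine hker _ ?_
        rw [map_sub, hqψ, sub_eq_zero]
        exact (Submodule.projection_apply_left hC ⟨_, Submodule.subset_span ⟨m, hm, rfl⟩⟩).symm
      -- The element m - ψ m lies in I M and is fixed by 1 - ψ, which maps I M into I · ker ψ; so it
      -- lies in I T.
      have h2 : (I • (⊤ : Submodule A M)).map (LinearMap.id - ψ) ≤ I • LinearMap.ker ψ := by
        rw [Submodule.map_smul'']
        refine Submodule.smul_mono le_rfl ?_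
        rintro _ ⟨y, -, rfl⟩
        rw [LinearMap.mem_ker, LinearMap.sub_apply, LinearMap.id_apply, map_sub, hψψ, sub_self]
      have h3 := h2 ⟨_, h1, rfl⟩
      rwa [LinearMap.sub_apply, LinearMap.id_apply, map_sub, hψψ, sub_self, sub_zero] at h3
    · rintro _ ⟨m, rfl⟩
      refine mem_of_mkQ_mem_span hS ?_
      rw [← hq, hqψ]
      exact Submodule.projection_apply_mem hC _
    · exact (Submodule.smul_mono le_rfl le_top).trans hS

end SplitFrames

/-! ### Normal decompositions and frames of pairs. -/

section PairFrames

variable {p : ℕ} [Fact p.Prime] {R : Type u} [CommRing R] {h d : ℕ}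

theorem Pair.exists_isNormal [IsAdicComplete (Ideal.span {(p : R)}) R] (P : Pair p R h d) :
    ∃ L T, P.IsNormal L T := by
  have := P.finite
  have := P.projective
  obtain ⟨C, hC⟩ := P.exists_isCompl
  obtain ⟨L, T, h1, h2⟩ := exists_isCompl_of_isCompl_mod P.smul_le hC
  exact ⟨L, T, h1, h2⟩

/-- A split frame of a pair. -/
abbrev PairFrame (P : Pair p R h d) {ι κ : Type*} [Fintype ι] [Fintype κ]
    (e : Matrix ι ι (WittVector p R)) (e' : Matrix κ κ (WittVector p R)) :=
  SplitFrame (augIdeal p R) P.sub e e'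

theorem Pair.IsNormal.finite_left {P : Pair p R h d} {L T} (hLT : P.IsNormal L T) :
    Module.Finite (WittVector p R) L := by
  have := P.finite
  exact Module.Finite.of_surjective _ (Submodule.projectionOnto_surjective hLT.isCompl)

theorem Pair.IsNormal.finite_right {P : Pair p R h d} {L T} (hLT : P.IsNormal L T) :
    Module.Finite (WittVector p R) T := by
  have := P.finite
  exact Module.Finite.of_surjective _ (Submodule.projectionOnto_surjective hLT.isCompl.symm)

theorem Pair.IsNormal.projective_left {P : Pair p R h d} {L T} (hLT : P.IsNormal L T) :
    Module.Projective (WittVector p R) L := by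
  have := P.projective
  exact Module.Projective.of_split L.subtype (L.projectionOnto T hLT.isCompl)
    (Submodule.projectionOnto_comp_subtype hLT.isCompl)

theorem Pair.IsNormal.projective_right {P : Pair p R h d} {L T} (hLT : P.IsNormal L T) :
    Module.Projective (WittVector p R) T := by
  have := P.projective
  exact Module.Projective.of_split T.subtype (T.projectionOnto L hLT.isCompl.symm)
    (Submodule.projectionOnto_comp_subtype hLT.isCompl.symm)

/-- The rank of L is read off from L/I L ≅ M₁/I_R M, because I_R lies in the Jacobson radical; the
rank of T is the difference, as L × T ≅ M. -/
theorem Pair.exists_pairFrame [IsAdicComplete (Ideal.span {(p : R)}) R] (hd : d ≤ h)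
    (P : Pair p R h d) :
    ∃ (n n' : ℕ) (e : Matrix (Fin n) (Fin n) (WittVector p R))
      (e' : Matrix (Fin n') (Fin n') (WittVector p R)), e * e = e ∧ e' * e' = e' ∧
      IsLocRank e d ∧ IsLocRank e' (h - d) ∧ Nonempty (PairFrame P e e') := by
  obtain ⟨L, T, hLT⟩ := P.exists_isNormal
  have := hLT.finite_left
  have := hLT.finite_right
  have := hLT.projective_left
  have := hLT.projective_right
  obtain ⟨n, e, ⟨F⟩⟩ := exists_frame (A := WittVector p R) L
  obtain ⟨n', e', ⟨F'⟩⟩ := exists_frame (A := WittVector p R) T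
  let G : PairFrame P e e' := SplitFrame.ofIsCompl hLT.isCompl hLT.sub_eq F F'
  have he : IsLocRank e d := by
    refine isLocRank_of_map_quotient F.idem (augIdeal_le_jacobson (p := p) (R := R)) ?_
    exact (G.residueFrame.hasResidualRank fun 𝔭 _ => P.sub_rank_eq 𝔭).isLocRank
      G.residueFrame.idem
  refine ⟨n, n', e, e', F.idem, F'.idem, he, ?_, ⟨G⟩⟩
  refine (F'.hasResidualRank fun 𝔭 _ => ?_).isLocRank F'.idem
  have h1 : Module.rankAtStalk (R := WittVector p R) (L × T) 𝔭 = h := by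
    rw [Module.rankAtStalk_eq_of_equiv (Submodule.prodEquivOfIsCompl L T hLT.isCompl)]
    exact P.rank_eq 𝔭
  rw [Module.rankAtStalk_prod, Pi.add_apply, F.rankAtStalk_eq he] at h1
  omega

end PairFrames

/-! ### The module M̃₁ in coordinates. -/

section Tilde

variable {p : ℕ} [Fact p.Prime] {R : Type u} [CommRing R] {h d : ℕ}

theorem verInv_zero : verInv (0 : WittVector p R) = 0 := by
  have := verInv_verschiebung (0 : WittVector p R)
  rwa [map_zero] at this

theorem verschiebung_verInv {x : WittVector p R} (hx : x ∈ augIdeal p R) :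
    WittVector.verschiebung (verInv x) = x := by
  obtain ⟨y, rfl⟩ := hx
  rw [verInv_verschiebung]

theorem verInv_add {x y : WittVector p R} (hx : x ∈ augIdeal p R) (hy : y ∈ augIdeal p R) :
    verInv (x + y) = verInv x + verInv y := by
  obtain ⟨x, rfl⟩ := hx
  obtain ⟨y, rfl⟩ := hy
  rw [← map_add, verInv_verschiebung, verInv_verschiebung, verInv_verschiebung]

theorem verInv_mul {x : WittVector p R} (w : WittVector p R) (hx : x ∈ augIdeal p R) :
    verInv (w * x) = WittVector.frobenius w * verInv x := by
  obtain ⟨x, rfl⟩ := hx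
  rw [mul_comm, ← WittVector.verschiebung_mul_frobenius, verInv_verschiebung, verInv_verschiebung,
    mul_comm]

theorem verInv_verschiebung_mul (x w : WittVector p R) :
    verInv (WittVector.verschiebung x * w) = x * WittVector.frobenius w := by
  rw [← WittVector.verschiebung_mul_frobenius, verInv_verschiebung]

namespace Pair

variable (P : Pair p R h d)

theorem tildeOne_verschiebung_smul (x : WittVector p R) (m : P.carrier)
    (hm : WittVector.verschiebung x • m ∈ P.sub) :
    P.tildeOne ⟨_, hm⟩ = x • P.tildeZero m := by
  rw [← sub_eq_zero]
  exact (Submodule.Quotient.mk_eq_zero P.tildeRel).mpr (Submodule.subset_span ⟨x, m, rfl⟩)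

/-- Take x = 1 in the defining relation: the class of m ∈ M is the class of V(1)m ∈ M₁, which is
φ(V(1)) = p times the class of m ∈ M₁. This is the source of the factor p in p b^φ. -/
theorem tildeZero_coe (m : P.sub) :
    P.tildeZero m = (p : WittVector p R) • P.tildeOne m := by
  have h1 := P.tildeOne_verschiebung_smul 1 m (P.verschiebung_smul_mem 1 m)
  have h2 := map_smulₛₗ P.tildeOne (WittVector.verschiebung (1 : WittVector p R)) m
  rw [WittVector.frobenius_verschiebung, one_mul] at h2
  rw [one_smul] at h1
  rw [← h1, ← h2]
  rfl

variable {P}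

theorem tilde_induction {motive : P.tildeObj → Prop} (one : ∀ m, motive (P.tildeOne m))
    (zero : ∀ m, motive (P.tildeZero m)) (add : ∀ x y, motive x → motive y → motive (x + y))
    (smul : ∀ (a : WittVector p R) x, motive x → motive (a • x)) (z : P.tildeObj) : motive z := by
  obtain ⟨z, rfl⟩ := Submodule.mkQ_surjective P.tildeRel z
  induction z using (isScalarExtension_pullUnit (frob p R) _).induction with
  | h0 m =>
    obtain ⟨m, m'⟩ := m
    have h1 : ((m, m') : P.sub × P.carrier) = (m, 0) + (0, m') := by simp
    rw [h1, map_add, map_add]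
    exact add _ _ (one m) (zero m')
  | hadd x y hx hy =>
    rw [map_add]
    exact add _ _ hx hy
  | hsmul a x hx =>
    rw [map_smul]
    exact smul _ _ hx

theorem tilde_hom_ext {A : Type*} [CommRing A] {ψ : WittVector p R →+* A} {Q : Type*}
    [AddCommGroup Q] [Module A Q] {k k' : P.tildeObj →ₛₗ[ψ] Q}
    (one : ∀ m, k (P.tildeOne m) = k' (P.tildeOne m))
    (zero : ∀ m, k (P.tildeZero m) = k' (P.tildeZero m)) : k = k' := by
  ext z
  induction z using tilde_induction with
  | one m => exact one m
  | zero m => exact zero m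
  | add x y hx hy => rw [map_add, map_add, hx, hy]
  | smul a x hx => rw [map_smulₛₗ, map_smulₛₗ, hx]

theorem tilde_map_one {P' : Pair p R h d} (f : P ⟶ P') (m : P.sub) :
    ((tilde p R h d).map f).hom (P.tildeOne m) = P'.tildeOne ⟨f.lin m, f.map_sub m m.2⟩ :=
  congrArg P'.tildeRel.mkQ (congrArg P'.frobSumUnit (Prod.ext rfl (map_zero f.lin)))

theorem tilde_map_zero {P' : Pair p R h d} (f : P ⟶ P') (m : P.carrier) :
    ((tilde p R h d).map f).hom (P.tildeZero m) = P'.tildeZero (f.lin m) :=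
  congrArg P'.tildeRel.mkQ (congrArg P'.frobSumUnit
    (Prod.ext (map_zero (f.lin.restrict f.map_sub)) rfl))

theorem hasMatrix {P P' : Pair p R h d} (f : P ⟶ P')
    {L T : Submodule (WittVector p R) P.carrier} {L' T' : Submodule (WittVector p R) P'.carrier}
    (hLT : P.IsNormal L T) (hLT' : P'.IsNormal L' T')
    {θ : P.tildeObj ≃ₗ[WittVector p R] (frobTwist L × frobTwist T)}
    {θ' : P'.tildeObj ≃ₗ[WittVector p R] (frobTwist L' × frobTwist T')}
    (hθ : P.IsNormalCoord L T θ) (hθ' : P'.IsNormalCoord L' T' θ') : HasMatrix f θ θ' := by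
  have hL : ∀ l : L, (l : P.carrier) ∈ P.sub := fun l =>
    hLT.sub_eq ▸ Submodule.mem_sup_left l.2
  have hL' : ∀ l : L', (l : P'.carrier) ∈ P'.sub := fun l =>
    hLT'.sub_eq ▸ Submodule.mem_sup_left l.2
  refine ⟨fun l a n y x hf => ?_, fun t b e hf => ?_⟩
  · rw [← hθ.1 l (hL l), LinearEquiv.symm_apply_apply, tilde_map_one]
    have h1 : (⟨f.lin l, f.map_sub l (hL l)⟩ : P'.sub) = ⟨a, hL' a⟩ +
        ∑ i, ⟨_, P'.verschiebung_smul_mem (y i) (x i)⟩ := by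
      refine Subtype.ext ?_
      rw [Submodule.coe_add, Submodule.coe_sum]
      exact hf
    rw [h1, map_add, map_add, map_sum, map_sum, hθ'.1]
    have h2 : ∀ i, θ' (P'.tildeOne ⟨_, P'.verschiebung_smul_mem (y i) (x i)⟩) =
        (0, y i • twistUnit T' (x i)) := by
      intro i
      rw [tildeOne_verschiebung_smul, map_smul, hθ'.2, Prod.smul_mk, smul_zero]
    simp only [h2]
    refine Prod.ext ?_ ?_
    · rw [Prod.fst_add, Prod.fst_sum]
      simp
    · rw [Prod.snd_add, Prod.snd_sum]
      simp
  · rw [← hθ.2 t, LinearEquiv.symm_apply_apply, tilde_map_zero, hf, map_add, map_add, hθ'.2,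
      tildeZero_coe P' ⟨b, hL' b⟩, map_smul, hθ'.1, Prod.smul_mk, smul_zero, Prod.mk_add_mk,
      add_zero, zero_add]

end Pair

variable {P : Pair p R h d} {ι κ : Type*} [Fintype ι] [Fintype κ]
  {e : Matrix ι ι (WittVector p R)} {e' : Matrix κ κ (WittVector p R)} (F : PairFrame P e e')

namespace PairFrame

/-- The T-coordinates of an element of M₁ are of the form V(y), and the defining relation moves
V(y)t to y times the class of t. So on M₁ the coefficients are φ on L and V^{-1} on T. -/
theorem tildeOne_eq (m : P.sub) : P.tildeOne m =
    ∑ i, WittVector.frobenius (F.a i m) • P.tildeOne ⟨F.l i, F.l_mem i⟩ +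
      ∑ i, verInv (F.b i m) • P.tildeZero (F.t i) := by
  have hb := (F.mem_iff m).mp m.2
  have h1 : m = ∑ i, F.a i m • (⟨F.l i, F.l_mem i⟩ : P.sub) +
      ∑ i, ⟨_, P.verschiebung_smul_mem (verInv (F.b i m)) (F.t i)⟩ := by
    refine Subtype.ext ?_
    rw [Submodule.coe_add, Submodule.coe_sum, Submodule.coe_sum]
    conv_lhs => rw [← F.repr m]
    refine congrArg₂ _ rfl (Finset.sum_congr rfl fun i _ => ?_)
    exact congrArg (· • F.t i) (verschiebung_verInv (hb i)).symm
  conv_lhs => rw [h1, map_add, map_sum, map_sum]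
  refine congrArg₂ _ (Finset.sum_congr rfl fun i _ => map_smulₛₗ _ _ _)
    (Finset.sum_congr rfl fun i _ => ?_)
  rw [Pair.tildeOne_verschiebung_smul]

/-- On M the coefficients are φ on T and, by `tildeZero_coe`, pφ on L. -/
theorem tildeZero_eq (m : P.carrier) : P.tildeZero m =
    ∑ i, ((p : WittVector p R) * WittVector.frobenius (F.a i m)) • P.tildeOne ⟨F.l i, F.l_mem i⟩ +
      ∑ i, WittVector.frobenius (F.b i m) • P.tildeZero (F.t i) := by
  conv_lhs => rw [← F.repr m, map_add, map_sum, map_sum]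
  refine congrArg₂ _ (Finset.sum_congr rfl fun i _ => ?_)
    (Finset.sum_congr rfl fun i _ => map_smulₛₗ _ _ _)
  rw [map_smulₛₗ, P.tildeZero_coe ⟨F.l i, F.l_mem i⟩, smul_smul, mul_comm]

variable {Q : Type u} [AddCommGroup Q] [Module (WittVector p R) Q] (q : ι → Q) (r : κ → Q)

/-- The `φ`-linear map on `M₁ ⊕ M` which defines a map on `M̃₁`. -/
def tildeDescAux : (P.sub × P.carrier) →ₛₗ[frob p R] Q where
  toFun m := (∑ i, WittVector.frobenius (F.a i m.1) • q i + ∑ i, verInv (F.b i m.1) • r i) +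
    (∑ i, ((p : WittVector p R) * WittVector.frobenius (F.a i m.2)) • q i +
      ∑ i, WittVector.frobenius (F.b i m.2) • r i)
  map_add' m m' := by
    have hb := (F.mem_iff _).mp m.1.2
    have hb' := (F.mem_iff _).mp m'.1.2
    simp only [Prod.fst_add, Prod.snd_add, Submodule.coe_add, map_add, mul_add, add_smul,
      Finset.sum_add_distrib, verInv_add (hb _) (hb' _)]
    abel
  map_smul' w m := by
    have hb := (F.mem_iff _).mp m.1.2
    simp only [Prod.smul_fst, Prod.smul_snd, Submodule.coe_smul, map_smul, smul_eq_mul, map_mul,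
      verInv_mul _ (hb _), smul_add, Finset.smul_sum, smul_smul, mul_left_comm]

/-- The relation holds for the formulas because φ(V(x)a) = p x φ(a) and V^{-1}(V(x)b) = x φ(b). -/
theorem tildeRel_le_ker :
    P.tildeRel ≤ LinearMap.ker ((isScalarExtension_pullUnit (frob p R)
      (ModuleCat.of (WittVector p R) (P.sub × P.carrier))).lift (F.tildeDescAux q r)) := by
  refine Submodule.span_le.mpr ?_
  rintro _ ⟨x, m, rfl⟩
  rw [SetLike.mem_coe, LinearMap.mem_ker, map_sub, map_smul, IsScalarExtension.lift_apply,
    IsScalarExtension.lift_apply, sub_eq_zero]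
  simp only [tildeDescAux, LinearMap.coe_mk, AddHom.coe_mk, map_smul, smul_eq_mul, map_mul,
    WittVector.frobenius_verschiebung, verInv_verschiebung_mul, Submodule.coe_zero, map_zero,
    verInv_zero, mul_zero, zero_smul, Finset.sum_const_zero, add_zero, zero_add, smul_add,
    Finset.smul_sum, smul_smul]
  congr 1
  exact Finset.sum_congr rfl fun i _ => by rw [mul_assoc]

/-- The linear map on `M̃₁` with given values on the elements of a split frame. -/
def tildeDesc : P.tildeObj →ₗ[WittVector p R] Q :=
  P.tildeRel.liftQ _ (F.tildeRel_le_ker q r)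

theorem tildeDesc_one (m : P.sub) : F.tildeDesc q r (P.tildeOne m) =
    ∑ i, WittVector.frobenius (F.a i m) • q i + ∑ i, verInv (F.b i m) • r i := by
  have h1 := (isScalarExtension_pullUnit (frob p R)
    (ModuleCat.of (WittVector p R) (P.sub × P.carrier))).lift_apply (F.tildeDescAux q r) (m, 0)
  refine Eq.trans h1 ?_
  simp [tildeDescAux]

theorem tildeDesc_zero (m : P.carrier) : F.tildeDesc q r (P.tildeZero m) =
    ∑ i, ((p : WittVector p R) * WittVector.frobenius (F.a i m)) • q i +
      ∑ i, WittVector.frobenius (F.b i m) • r i := by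
  have h1 := (isScalarExtension_pullUnit (frob p R)
    (ModuleCat.of (WittVector p R) (P.sub × P.carrier))).lift_apply (F.tildeDescAux q r) (0, m)
  refine Eq.trans h1 ?_
  simp [tildeDescAux, verInv_zero]

end PairFrame

/-- The inverse η comes from the universal properties of L^φ and T^φ. A map out of M̃₁ is harder to
define, so θ is given by coefficients with respect to dual bases of L and T; that the two are
inverse is checked on generators. -/
theorem Pair.IsNormal.exists_isNormalCoord {L T : Submodule (WittVector p R) P.carrier}
    (hLT : P.IsNormal L T) : ∃ θ, P.IsNormalCoord L T θ := by
  have := hLT.finite_left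
  have := hLT.finite_right
  have := hLT.projective_left
  have := hLT.projective_right
  obtain ⟨n, e, ⟨F⟩⟩ := exists_frame (A := WittVector p R) L
  obtain ⟨n', e', ⟨F'⟩⟩ := exists_frame (A := WittVector p R) T
  let G : PairFrame P e e' := SplitFrame.ofIsCompl hLT.isCompl hLT.sub_eq F F'
  have hL : L ≤ P.sub := hLT.sub_eq ▸ le_sup_left
  let q : Fin n → frobTwist L × frobTwist T := fun i => (twistUnit L (F.x i), 0)
  let r : Fin n' → frobTwist L × frobTwist T := fun i => (0, twistUnit T (F'.x i))
  let θ := G.tildeDesc q r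
  have hLe := isScalarExtension_pullUnit (frob p R) (ModuleCat.of (WittVector p R) L)
  have hTe := isScalarExtension_pullUnit (frob p R) (ModuleCat.of (WittVector p R) T)
  let η : (frobTwist L × frobTwist T) →ₗ[WittVector p R] P.tildeObj :=
    (hLe.lift (P.tildeOne.comp (Submodule.inclusion hL))).coprod
      (hTe.lift (P.tildeZero.comp T.subtype))
  have haL : ∀ i (l : L), G.a i l = F.c i l := fun i l =>
    congrArg (F.c i) (Submodule.projectionOnto_apply_left hLT.isCompl l)
  have hbL : ∀ i (l : L), G.b i l = 0 := fun i l =>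
    (congrArg (F'.c i) (Submodule.projectionOnto_apply_right hLT.isCompl.symm l)).trans (map_zero _)
  have haT : ∀ i (t : T), G.a i t = 0 := fun i t =>
    (congrArg (F.c i) (Submodule.projectionOnto_apply_right hLT.isCompl t)).trans (map_zero _)
  have hbT : ∀ i (t : T), G.b i t = F'.c i t := fun i t =>
    congrArg (F'.c i) (Submodule.projectionOnto_apply_left hLT.isCompl.symm t)
  have hθ1 : ∀ l : L, θ (P.tildeOne ⟨l, hL l.2⟩) = (twistUnit L l, 0) := by
    intro l
    rw [G.tildeDesc_one]
    simp only [haL, hbL, verInv_zero, zero_smul, Finset.sum_const_zero, add_zero, q]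
    refine Prod.ext ?_ ?_
    · rw [Prod.fst_sum]
      conv_rhs => rw [← F.repr l, map_sum]
      exact Finset.sum_congr rfl fun i _ => (map_smulₛₗ (twistUnit L) _ _).symm
    · rw [Prod.snd_sum]
      exact Finset.sum_eq_zero fun i _ => smul_zero _
  have hθ2 : ∀ t : T, θ (P.tildeZero t) = (0, twistUnit T t) := by
    intro t
    rw [G.tildeDesc_zero]
    simp only [haT, hbT, map_zero, mul_zero, zero_smul, Finset.sum_const_zero, zero_add, r]
    refine Prod.ext ?_ ?_
    · rw [Prod.fst_sum]
      exact Finset.sum_eq_zero fun i _ => smul_zero _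
    · rw [Prod.snd_sum]
      conv_rhs => rw [← F'.repr t, map_sum]
      exact Finset.sum_congr rfl fun i _ => (map_smulₛₗ (twistUnit T) _ _).symm
  have hη1 : ∀ l : L, η (twistUnit L l, 0) = P.tildeOne ⟨l, hL l.2⟩ := by
    intro l
    simp only [η, LinearMap.coprod_apply, map_zero, add_zero]
    exact hLe.lift_apply _ l
  have hη2 : ∀ t : T, η (0, twistUnit T t) = P.tildeZero t := by
    intro t
    simp only [η, LinearMap.coprod_apply, map_zero, zero_add]
    exact hTe.lift_apply _ t
  have h1 : θ ∘ₗ η = LinearMap.id := by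
    refine LinearMap.prod_ext (hLe.hom_ext fun l => ?_) (hTe.hom_ext fun t => ?_)
    · exact (congrArg θ (hη1 l)).trans (hθ1 l)
    · exact (congrArg θ (hη2 t)).trans (hθ2 t)
  have h2 : η ∘ₗ θ = LinearMap.id := by
    refine Pair.tilde_hom_ext (fun m => ?_) fun m => ?_
    · rw [LinearMap.comp_apply, LinearMap.id_apply, G.tildeDesc_one, map_add, map_sum, map_sum]
      conv_rhs => rw [G.tildeOne_eq m]
      exact congrArg₂ _
        (Finset.sum_congr rfl fun i _ => (map_smul η _ _).trans (congrArg _ (hη1 _)))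
        (Finset.sum_congr rfl fun i _ => (map_smul η _ _).trans (congrArg _ (hη2 _)))
    · rw [LinearMap.comp_apply, LinearMap.id_apply, G.tildeDesc_zero, map_add, map_sum, map_sum]
      conv_rhs => rw [G.tildeZero_eq m]
      exact congrArg₂ _
        (Finset.sum_congr rfl fun i _ => (map_smul η _ _).trans (congrArg _ (hη1 _)))
        (Finset.sum_congr rfl fun i _ => (map_smul η _ _).trans (congrArg _ (hη2 _)))
  exact ⟨LinearEquiv.ofLinearMap θ η h1 h2, fun l _ => hθ1 l, hθ2⟩

end Tilde

/-! ### The pullbacks τ^*N and σ^*N of a bundle with a normal frame. -/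

section TauSigma

variable {p : ℕ} [Fact p.Prime] {R : Type u} [CommRing R] {N : ReesModule p R}
  {M : Type u} [AddCommGroup M] [Module (WittVector p R) M]
  {u : N.carrier →ₛₗ[tauHom p R] M}
  {ι κ : Type} [Fintype ι] [Fintype κ] {e : Matrix ι ι (WittVector p R)}
  {e' : Matrix κ κ (WittVector p R)}

/-- The image of the component of degree `0` in `τ^* N`. -/
def degZeroImage (u : N.carrier →ₛₗ[tauHom p R] M) : Submodule (WittVector p R) M where
  carrier := u '' N.deg 0
  zero_mem' := ⟨0, zero_mem _, map_zero u⟩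
  add_mem' := by
    rintro _ _ ⟨m, hm, rfl⟩ ⟨n, hn, rfl⟩
    exact ⟨m + n, add_mem hm hn, map_add u m n⟩
  smul_mem' := by
    rintro w _ ⟨n, hn, rfl⟩
    refine ⟨algebraMap _ (Rees p R) w • n, ?_, ?_⟩
    · have := N.smul_mem_deg (algebraMap_mem_reesGr w) hn
      rwa [add_zero] at this
    · rw [map_smulₛₗ, tauHom_algebraMap]

namespace NormalFrame

theorem semilinear_ext (F : NormalFrame N e e') {A : Type*} [CommRing A] {ψ : Rees p R →+* A}
    {Q : Type*} [AddCommGroup Q] [Module A Q] {k k' : N.carrier →ₛₗ[ψ] Q}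
    (h0 : ∀ n ∈ N.deg 0, k n = k' n) (h1 : ∀ n ∈ N.deg (-1), k n = k' n) : k = k' := by
  ext n
  rw [← F.repr n]
  simp only [map_add, map_sum, map_smulₛₗ, h0 _ (F.l_mem _), h1 _ (F.t_mem _)]

/-- The semilinear combination of given elements, with coefficients given by a normal frame. -/
def combination (F : NormalFrame N e e') {A : Type*} [CommRing A] (ψ : Rees p R →+* A) {Q : Type*}
    [AddCommGroup Q] [Module A Q] (q : ι → Q) (r : κ → Q) : N.carrier →ₛₗ[ψ] Q where
  toFun n := ∑ i, ψ (F.a i n) • q i + ∑ i, ψ (F.b i n) • r i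
  map_add' m n := by
    simp only [map_add, add_smul, Finset.sum_add_distrib]
    abel
  map_smul' b n := by
    simp only [map_smul, smul_eq_mul, map_mul, mul_smul, smul_add, Finset.smul_sum]

theorem combination_apply (F : NormalFrame N e e') {A : Type*} [CommRing A] (ψ : Rees p R →+* A)
    {Q : Type*} [AddCommGroup Q] [Module A Q] (q : ι → Q) (r : κ → Q) (n : N.carrier) :
    F.combination ψ q r n = ∑ i, ψ (F.a i n) • q i + ∑ i, ψ (F.b i n) • r i := rfl

/-- The extension of a functional on `N` to `τ^* N`. -/
def tauFunctional (hu : IsScalarExtension u) (c : N.carrier →ₗ[Rees p R] Rees p R) :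
    M →ₗ[WittVector p R] WittVector p R :=
  hu.lift
    { toFun := fun n => tauHom p R (c n)
      map_add' := fun m n => by rw [map_add, map_add]
      map_smul' := fun b n => by rw [map_smul, smul_eq_mul, map_mul, smul_eq_mul] }

theorem tauFunctional_apply (hu : IsScalarExtension u) (c : N.carrier →ₗ[Rees p R] Rees p R)
    (n : N.carrier) : tauFunctional hu c (u n) = tauHom p R (c n) := hu.lift_apply _ n

theorem tau_repr (F : NormalFrame N e e') (hu : IsScalarExtension u) (m : M) :
    ∑ i, tauFunctional hu (F.a i) m • u (F.l i) + ∑ i, tauFunctional hu (F.b i) m • u (F.t i) =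
      m := by
  induction m using hu.induction with
  | h0 n =>
    conv_rhs => rw [← F.repr n]
    simp only [tauFunctional_apply, map_add, map_sum, map_smulₛₗ]
  | hadd x y hx hy =>
    conv_rhs => rw [← hx, ← hy]
    simp only [map_add, add_smul, Finset.sum_add_distrib]
    abel
  | hsmul w x hx =>
    conv_rhs => rw [← hx]
    simp only [map_smul, smul_eq_mul, mul_smul, smul_add, Finset.smul_sum]

/-- The split frame of `τ^* N` given by a normal frame of `N`. -/
def splitFrame (F : NormalFrame N e e') (hu : IsScalarExtension u)
    {S : Submodule (WittVector p R) M} (hS : S = degZeroImage u) :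
    SplitFrame (augIdeal p R) S e e' where
  l i := u (F.l i)
  t i := u (F.t i)
  a i := tauFunctional hu (F.a i)
  b i := tauFunctional hu (F.b i)
  mem_iff m := by
    subst hS
    refine ⟨?_, fun hm => ?_⟩
    · rintro ⟨n, hn, rfl⟩ i
      rw [tauFunctional_apply]
      exact tauHom_mem_augIdeal (F.b_mem i 0 n hn)
    · rw [← F.tau_repr hu m]
      refine add_mem (sum_mem fun i _ => Submodule.smul_mem _ _ ⟨_, F.l_mem i, rfl⟩)
        (sum_mem fun i _ => ?_)
      obtain ⟨y, hy⟩ := hm i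
      refine ⟨reesV y • F.t i, ?_, ?_⟩
      · have := N.smul_mem_deg (reesV_mem y) (F.t_mem i)
        rwa [add_neg_cancel] at this
      · rw [map_smulₛₗ, tauHom_reesV, ← hy]
  repr := F.tau_repr hu
  a_l i k := by rw [tauFunctional_apply, F.a_l, tauHom_algebraMap]
  a_t i k := by rw [tauFunctional_apply, F.a_t, map_zero]
  b_l i k := by rw [tauFunctional_apply, F.b_l, map_zero]
  b_t i k := by rw [tauFunctional_apply, F.b_t, tauHom_algebraMap]

/-- All generators can be moved to degree -1: the t_i are already there, and the l_i are multiplied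
by t, which τ sends to 1. -/
theorem exists_deg_neg_one (F : NormalFrame N e e') (hu : IsScalarExtension u) (m : M) :
    ∃ n ∈ N.deg (-1), u n = m := by
  refine ⟨∑ i, (algebraMap _ (Rees p R) (tauFunctional hu (F.a i) m) * reesT p R) • F.l i +
    ∑ i, algebraMap _ (Rees p R) (tauFunctional hu (F.b i) m) • F.t i,
    add_mem (sum_mem fun i _ => ?_) (sum_mem fun i _ => ?_), ?_⟩
  · exact N.smul_mem_deg (i := -1) (j := 0) (by
      have := SetLike.mul_mem_graded (algebraMap_mem_reesGr (tauFunctional hu (F.a i) m))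
        (reesT_mem (p := p) (R := R))
      rwa [zero_add] at this) (F.l_mem i)
  · have := N.smul_mem_deg (algebraMap_mem_reesGr (tauFunctional hu (F.b i) m)) (F.t_mem i)
    rwa [zero_add] at this
  · conv_rhs => rw [← F.tau_repr hu m]
    simp only [map_add, map_sum, map_smulₛₗ, map_mul, tauHom_algebraMap, tauHom_reesT, mul_one]

/-- The coordinates of an element of degree j ≤ 0 have degrees j and j + 1, both at most 1, where τ
is injective. -/
theorem injOn_of_le_zero (F : NormalFrame N e e') (hu : IsScalarExtension u) {j : ℤ} (hj : j ≤ 0)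
    {n n' : N.carrier} (hn : n ∈ N.deg j) (hn' : n' ∈ N.deg j) (h : u n = u n') : n = n' := by
  have h1 : u (n - n') = 0 := by rw [map_sub, h, sub_self]
  have hm := sub_mem hn hn'
  rw [← sub_eq_zero, ← F.repr (n - n')]
  have ha : ∀ i, F.a i (n - n') = 0 := fun i => by
    refine tauHom_injOn (show j ≤ 1 by omega) (F.a_mem i j _ hm) ?_
    rw [← tauFunctional_apply hu, h1, map_zero]
  have hb : ∀ i, F.b i (n - n') = 0 := fun i => by
    refine tauHom_injOn (show j + 1 ≤ 1 by omega) (F.b_mem i j _ hm) ?_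
    rw [← tauFunctional_apply hu, h1, map_zero]
  simp only [ha, hb, zero_smul, Finset.sum_const_zero, add_zero]

variable {h d : ℕ} {P : Pair p R h d} {u : N.carrier →ₛₗ[tauHom p R] P.carrier}
  {Q : Type u} [AddCommGroup Q] [Module (WittVector p R) Q] {s : N.carrier →ₛₗ[sigmaHom p R] Q}

/-- The identification of `σ^* N` with `M̃₁`, where `M = τ^* N` and `M₁` is the image of `N_0`. -/
theorem exists_sigmaEquiv (F : NormalFrame N e e') (hu : IsScalarExtension u)
    (hP : P.sub = degZeroImage u) (hs : IsScalarExtension s) :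
    ∃ Ξ : Q ≃ₗ[WittVector p R] P.tildeObj,
      (∀ n ∈ N.deg 0, ∀ hm, Ξ (s n) = P.tildeOne ⟨u n, hm⟩) ∧
      ∀ n ∈ N.deg (-1), Ξ (s n) = P.tildeZero (u n) := by
  obtain ⟨G, hGa, hGb⟩ : ∃ G : PairFrame P e e', (∀ i n, G.a i (u n) = tauHom p R (F.a i n)) ∧
      ∀ i n, G.b i (u n) = tauHom p R (F.b i n) :=
    ⟨F.splitFrame hu hP, fun i n => tauFunctional_apply hu _ n,
      fun i n => tauFunctional_apply hu _ n⟩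
  have hverInv : ∀ b ∈ reesGr p R 1, verInv (tauHom p R b) = sigmaHom p R b := fun b hb => by
    rw [← verschiebung_sigmaHom hb, verInv_verschiebung]
  -- For n of degree 0 the coordinates have degrees 0 and 1, so the coefficients φ and V^{-1} of M₁
  -- → M̃₁ become σ of the graded coordinates. The target is arbitrary because the identity serves
  -- for both directions of the isomorphism.
  have hone : ∀ n ∈ N.deg 0, ∀ (Q' : Type u) [AddCommGroup Q'] [Module (WittVector p R) Q']
      (q : ι → Q') (r : κ → Q'),
      ∑ i, WittVector.frobenius (G.a i (u n)) • q i + ∑ i, verInv (G.b i (u n)) • r i =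
      ∑ i, sigmaHom p R (F.a i n) • q i + ∑ i, sigmaHom p R (F.b i n) • r i := by
    intro n hn Q' _ _ q r
    refine congrArg₂ _ (Finset.sum_congr rfl fun i _ => ?_) (Finset.sum_congr rfl fun i _ => ?_)
    · rw [hGa, sigmaHom_of_deg_zero (F.a_mem i 0 n hn)]
    · have hm := F.b_mem i 0 n hn
      rw [zero_add] at hm
      rw [hGb, hverInv _ hm]
  -- For n of degree -1 the coordinates have degrees -1 and 0, and the coefficients pφ and φ of M →
  -- M̃₁ become σ.
  have hzero : ∀ n ∈ N.deg (-1), ∀ (Q' : Type u) [AddCommGroup Q'] [Module (WittVector p R) Q']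
      (q : ι → Q') (r : κ → Q'),
      ∑ i, ((p : WittVector p R) * WittVector.frobenius (G.a i (u n))) • q i +
        ∑ i, WittVector.frobenius (G.b i (u n)) • r i =
      ∑ i, sigmaHom p R (F.a i n) • q i + ∑ i, sigmaHom p R (F.b i n) • r i := by
    intro n hn Q' _ _ q r
    refine congrArg₂ _ (Finset.sum_congr rfl fun i _ => ?_) (Finset.sum_congr rfl fun i _ => ?_)
    · rw [hGa, sigmaHom_of_deg_neg_one (F.a_mem i (-1) n hn)]
    · have hm := F.b_mem i (-1) n hn
      rw [neg_add_cancel] at hm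
      rw [hGb, sigmaHom_of_deg_zero hm]
  let q : ι → P.tildeObj := fun i => P.tildeOne ⟨G.l i, G.l_mem i⟩
  let r : κ → P.tildeObj := fun i => P.tildeZero (G.t i)
  let k := F.combination (sigmaHom p R) q r
  let Ξ := hs.lift k
  have hΞ0 : ∀ n ∈ N.deg 0, ∀ hm, Ξ (s n) = P.tildeOne ⟨u n, hm⟩ := by
    intro n hn hm
    rw [hs.lift_apply, F.combination_apply, PairFrame.tildeOne_eq G ⟨u n, hm⟩]
    exact (hone n hn _ q r).symm
  have hΞ1 : ∀ n ∈ N.deg (-1), Ξ (s n) = P.tildeZero (u n) := by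
    intro n hn
    rw [hs.lift_apply, F.combination_apply, PairFrame.tildeZero_eq G (u n)]
    exact (hzero n hn _ q r).symm
  let Θ := PairFrame.tildeDesc G (fun i => s (F.l i)) fun i => s (F.t i)
  have hrepr : ∀ n, ∑ i, sigmaHom p R (F.a i n) • s (F.l i) +
      ∑ i, sigmaHom p R (F.b i n) • s (F.t i) = s n := by
    intro n
    conv_rhs => rw [← F.repr n]
    simp only [map_add, map_sum, map_smulₛₗ]
  have hΘ0 : ∀ n ∈ N.deg 0, ∀ hm, Θ (P.tildeOne ⟨u n, hm⟩) = s n := by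
    intro n hn hm
    rw [PairFrame.tildeDesc_one, ← hrepr n]
    exact hone n hn _ _ _
  have hΘ1 : ∀ n ∈ N.deg (-1), Θ (P.tildeZero (u n)) = s n := by
    intro n hn
    rw [PairFrame.tildeDesc_zero, ← hrepr n]
    exact hzero n hn _ _ _
  have hmem : ∀ n ∈ N.deg 0, u n ∈ P.sub := fun n hn => hP ▸ ⟨n, hn, rfl⟩
  -- M₁ is the image of N_0 and M is the image of N_{-1}, so the generators of M̃₁ all come from
  -- these two degrees, which also generate N.
  refine ⟨LinearEquiv.ofLinearMap Ξ Θ ?_ ?_, hΞ0, hΞ1⟩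
  · refine Pair.tilde_hom_ext (fun m => ?_) fun m => ?_
    · obtain ⟨m, hm⟩ := m
      obtain ⟨n, hn, rfl⟩ : m ∈ degZeroImage u := hP ▸ hm
      rw [LinearMap.comp_apply, LinearMap.id_apply, hΘ0 n hn, hΞ0 n hn hm]
    · obtain ⟨n, hn, rfl⟩ := F.exists_deg_neg_one hu m
      rw [LinearMap.comp_apply, LinearMap.id_apply, hΘ1 n hn, hΞ1 n hn]
  · refine hs.hom_ext fun n => ?_
    have h1 : (Θ ∘ₗ Ξ).comp s = s := by
      refine F.semilinear_ext (fun n hn => ?_) fun n hn => ?_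
      · exact (congrArg Θ (hΞ0 n hn (hmem n hn))).trans (hΘ0 n hn _)
      · exact (congrArg Θ (hΞ1 n hn)).trans (hΘ1 n hn)
    exact LinearMap.congr_fun h1 n

end NormalFrame
end TauSigma

/-! ### Functoriality of the category of objects with a gluing isomorphism. -/

namespace IsoInserter

variable {C C' D : Type*} [Category* C] [Category* C'] [Category* D] {S T : C ⥤ D}
  {S' T' : C' ⥤ D}

/-- Isomorphisms in the category of pairs `(X, Φ)`. -/
def isoMk {X Y : IsoInserter S T} (i : X.obj ≅ Y.obj)
    (hi : S.map i.hom ≫ Y.iso.hom = X.iso.hom ≫ T.map i.hom) : X ≅ Y where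
  hom := ⟨i.hom, hi⟩
  inv := ⟨i.inv, by
    rw [← cancel_epi (S.map i.hom), ← Category.assoc, ← S.map_comp, i.hom_inv_id, S.map_id,
      Category.id_comp, ← Category.assoc, hi, Category.assoc, ← T.map_comp, i.hom_inv_id,
      T.map_id, Category.comp_id]⟩
  hom_inv_id := Hom.ext i.hom_inv_id
  inv_hom_id := Hom.ext i.inv_hom_id

/-- The functor on isomorphism inserters induced by a functor `K : C ⥤ C'` that is compatible with
`S, T` and `S', T'`. -/
def mapFunctor (K : C ⥤ C') (σ : S ≅ K ⋙ S') (τ : T ≅ K ⋙ T') :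
    IsoInserter S T ⥤ IsoInserter S' T' where
  obj X := ⟨K.obj X.obj, (σ.app X.obj).symm ≪≫ X.iso ≪≫ τ.app X.obj⟩
  map {X Y} f := ⟨K.map f.hom, by
    have h1 := σ.inv.naturality f.hom
    have h2 := τ.hom.naturality f.hom
    have h3 := f.comm
    simp only [Functor.comp_map] at h1 h2
    simp only [Iso.trans_hom, Iso.symm_hom, Iso.app_inv, Iso.app_hom, Category.assoc]
    rw [← Category.assoc, h1, Category.assoc, ← Category.assoc (S.map f.hom), h3, Category.assoc,
      h2]⟩
  map_id X := Hom.ext (K.map_id _)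
  map_comp _ _ := Hom.ext (K.map_comp _ _)

variable (K : C ⥤ C') (σ : S ≅ K ⋙ S') (τ : T ≅ K ⋙ T')

theorem mapFunctor_iso_hom (X : IsoInserter S T) :
    X.iso.hom ≫ τ.hom.app X.obj ≫ T'.map (𝟙 (K.obj X.obj)) =
      σ.hom.app X.obj ≫ S'.map (𝟙 (K.obj X.obj)) ≫ ((mapFunctor K σ τ).obj X).iso.hom := by
  simp [mapFunctor]

instance [K.Faithful] : (mapFunctor K σ τ).Faithful where
  map_injective {_ _ _ _} hfg := Hom.ext (K.map_injective (congrArg Hom.hom hfg))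

instance [K.Full] : (mapFunctor K σ τ).Full where
  map_surjective {X Y} f := by
    obtain ⟨g, hg⟩ := K.map_surjective (X := X.obj) (Y := Y.obj) f.hom
    refine ⟨⟨g, ?_⟩, Hom.ext hg⟩
    have h1 := σ.inv.naturality g
    have h2 := τ.hom.naturality g
    have h3 : S'.map (K.map g) ≫ ((σ.app Y.obj).symm ≪≫ Y.iso ≪≫ τ.app Y.obj).hom =
        ((σ.app X.obj).symm ≪≫ X.iso ≪≫ τ.app X.obj).hom ≫ T'.map (K.map g) := by
      rw [hg]
      exact f.comm
    simp only [Functor.comp_map] at h1 h2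
    simp only [Iso.trans_hom, Iso.symm_hom, Iso.app_inv, Iso.app_hom, Category.assoc] at h3
    rw [← Category.assoc, h1, Category.assoc, cancel_epi, ← h2] at h3
    rw [← cancel_mono (τ.hom.app Y.obj), Category.assoc, Category.assoc]
    exact h3

instance [K.EssSurj] : (mapFunctor K σ τ).EssSurj where
  mem_essImage Y := by
    let i := K.objObjPreimageIso Y.obj
    -- The gluing isomorphism of Y is transported to a preimage of its underlying object.
    refine ⟨⟨K.objPreimage Y.obj, σ.app _ ≪≫ S'.mapIso i ≪≫ Y.iso ≪≫ (T'.mapIso i).symm ≪≫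
      (τ.app _).symm⟩, ⟨isoMk i ?_⟩⟩
    simp [mapFunctor]

instance [K.IsEquivalence] : (mapFunctor K σ τ).IsEquivalence where

end IsoInserter

/-! ### Isomorphism of pairs with the same Gram matrices. -/

section SplitFrameMaps

variable {A : Type u} [CommRing A] {I : Ideal A} {M M' : Type u} [AddCommGroup M] [Module A M]
  [AddCommGroup M'] [Module A M'] {S : Submodule A M} {S' : Submodule A M'}
  {ι κ : Type*} [Fintype ι] [Fintype κ] {e : Matrix ι ι A} {e' : Matrix κ κ A}

/-- The linear map between modules with split frames with the same Gram matrix. -/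
def SplitFrame.linearMap (F : SplitFrame I S e e') (F' : SplitFrame I S' e e') : M →ₗ[A] M' :=
  ∑ i, (F.a i).smulRight (F'.l i) + ∑ i, (F.b i).smulRight (F'.t i)

theorem SplitFrame.linearMap_apply (F : SplitFrame I S e e') (F' : SplitFrame I S' e e') (m : M) :
    F.linearMap F' m = ∑ i, F.a i m • F'.l i + ∑ i, F.b i m • F'.t i := by
  simp only [linearMap, LinearMap.add_apply, LinearMap.sum_apply, LinearMap.smulRight_apply]

theorem SplitFrame.a_linearMap (F : SplitFrame I S e e') (F' : SplitFrame I S' e e') (i : ι)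
    (m : M) : F'.a i (F.linearMap F' m) = F.a i m := by
  conv_rhs => rw [← F.repr m]
  simp only [F.linearMap_apply, map_add, map_sum, map_smul, F.a_l, F.a_t, F'.a_l, F'.a_t]

theorem SplitFrame.b_linearMap (F : SplitFrame I S e e') (F' : SplitFrame I S' e e') (i : κ)
    (m : M) : F'.b i (F.linearMap F' m) = F.b i m := by
  conv_rhs => rw [← F.repr m]
  simp only [F.linearMap_apply, map_add, map_sum, map_smul, F.b_l, F.b_t, F'.b_l, F'.b_t]

theorem SplitFrame.linearMap_mem (F : SplitFrame I S e e') (F' : SplitFrame I S' e e') {m : M}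
    (hm : m ∈ S) : F.linearMap F' m ∈ S' :=
  (F'.mem_iff _).mpr fun i => by
    rw [F.b_linearMap]
    exact (F.mem_iff m).mp hm i

theorem SplitFrame.linearMap_linearMap (F : SplitFrame I S e e') (F' : SplitFrame I S' e e')
    (m : M) : F'.linearMap F (F.linearMap F' m) = m := by
  rw [F'.linearMap_apply]
  simp only [F.a_linearMap, F.b_linearMap, F.repr]

variable {p : ℕ} [Fact p.Prime] {R : Type u} [CommRing R] {h d : ℕ}

/-- Pairs with split frames with the same Gram matrix are isomorphic. -/
def PairFrame.iso {P P' : Pair p R h d} {e : Matrix ι ι (WittVector p R)}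
    {e' : Matrix κ κ (WittVector p R)} (F : PairFrame P e e') (F' : PairFrame P' e e') :
    P ≅ P' where
  hom := ⟨F.linearMap F', fun _ => F.linearMap_mem F'⟩
  inv := ⟨F'.linearMap F, fun _ => F'.linearMap_mem F⟩
  hom_inv_id := Pair.Hom.ext (LinearMap.ext (F.linearMap_linearMap F'))
  inv_hom_id := Pair.Hom.ext (LinearMap.ext (F'.linearMap_linearMap F))

end SplitFrameMaps

/-! ### The equivalence between bundles on Re(W(R)) and pairs. -/

section ToPair

variable {p : ℕ} [Fact p.Prime] {R : Type u} [CommRing R] {h d : ℕ}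

/-- The canonical map `N → τ^* N`. -/
abbrev tauUnit (N : ReesBundle p R h d) :
    N.obj.carrier →ₛₗ[tauHom p R] (tauPull p R h d).obj N :=
  pullUnit (tauHom p R) ((ReesModule.toModuleCat p R).obj N.obj)

/-- The canonical map `N → σ^* N`. -/
abbrev sigmaUnit (N : ReesBundle p R h d) :
    N.obj.carrier →ₛₗ[sigmaHom p R] (sigmaPull p R h d).obj N :=
  pullUnit (sigmaHom p R) ((ReesModule.toModuleCat p R).obj N.obj)

theorem isScalarExtension_tauUnit (N : ReesBundle p R h d) : IsScalarExtension (tauUnit N) :=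
  isScalarExtension_pullUnit _ _

theorem isScalarExtension_sigmaUnit (N : ReesBundle p R h d) : IsScalarExtension (sigmaUnit N) :=
  isScalarExtension_pullUnit _ _

theorem tauPull_map_unit {N N' : ReesBundle p R h d} (f : N ⟶ N') (n : N.obj.carrier) :
    ((tauPull p R h d).map f).hom (tauUnit N n) = tauUnit N' (f.hom.lin n) := rfl

variable [IsAdicComplete (Ideal.span {(p : R)}) R] (hd : d ≤ h)

/-- The pair `(τ^* N, N_0)` attached to a vector bundle `N` of type `μ_d`. -/
def pairOfBundle (N : ReesBundle p R h d) : Pair p R h d where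
  carrier := (tauPull p R h d).obj N
  finite := by
    obtain ⟨_, _, _, _, _, _, _, _, _, _, _, _, ⟨F⟩⟩ := ReesModule.exists_normalFrame N.property
    exact (F.splitFrame (isScalarExtension_tauUnit N) rfl).toFrame.finite
  projective := by
    obtain ⟨_, _, _, _, _, _, _, _, _, _, _, _, ⟨F⟩⟩ := ReesModule.exists_normalFrame N.property
    exact (F.splitFrame (isScalarExtension_tauUnit N) rfl).toFrame.projective
  rank_eq := by
    obtain ⟨_, _, _, _, _, _, _, _, _, _, he, he', ⟨F⟩⟩ :=
      ReesModule.exists_normalFrame N.property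
    have h1 := he.fromBlocks he'
    rw [Nat.add_sub_cancel' hd] at h1
    exact (F.splitFrame (isScalarExtension_tauUnit N) rfl).toFrame.rankAtStalk_eq h1
  sub := degZeroImage (tauUnit N)
  smul_le := by
    obtain ⟨_, _, _, _, _, _, _, _, _, _, _, _, ⟨F⟩⟩ := ReesModule.exists_normalFrame N.property
    exact (F.splitFrame (isScalarExtension_tauUnit N) rfl).smul_le
  exists_isCompl := by
    obtain ⟨_, _, _, _, _, _, _, _, _, _, _, _, ⟨F⟩⟩ := ReesModule.exists_normalFrame N.property
    exact (F.splitFrame (isScalarExtension_tauUnit N) rfl).exists_isCompl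
  sub_rank_eq := by
    obtain ⟨_, _, _, _, _, _, _, _, _, _, he, _, ⟨F⟩⟩ :=
      ReesModule.exists_normalFrame N.property
    exact (F.splitFrame (isScalarExtension_tauUnit N) rfl).residueFrame.rankAtStalk_eq (he.map _)

variable (p R) in
/-- The functor `N ↦ (τ^* N, N_0)`. -/
def pairFunctor : ReesBundle p R h d ⥤ Pair p R h d where
  obj := pairOfBundle hd
  map {N N'} f := ⟨((tauPull p R h d).map f).hom, by
    rintro _ ⟨n, hn, rfl⟩
    exact ⟨f.hom.lin n, f.hom.map_deg 0 n hn, (tauPull_map_unit f n).symm⟩⟩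
  map_id N := Pair.Hom.ext (congrArg ModuleCat.Hom.hom ((tauPull p R h d).map_id N))
  map_comp f g := Pair.Hom.ext (congrArg ModuleCat.Hom.hom ((tauPull p R h d).map_comp f g))

/-- N is generated in degrees 0 and -1, and N' → τ^*N' is injective in these degrees. -/
instance : (pairFunctor p R hd).Faithful where
  map_injective {N N' f g} hfg := by
    obtain ⟨_, _, _, _, _, _, _, _, _, _, _, _, ⟨F⟩⟩ := ReesModule.exists_normalFrame N.property
    obtain ⟨_, _, _, _, _, _, _, _, _, _, _, _, ⟨F'⟩⟩ := ReesModule.exists_normalFrame N'.property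
    have h1 : ∀ n, tauUnit N' (f.hom.lin n) = tauUnit N' (g.hom.lin n) := fun n =>
      LinearMap.congr_fun (congrArg Pair.Hom.lin hfg) (tauUnit N n)
    have hN' := isScalarExtension_tauUnit N'
    refine ObjectProperty.hom_ext _ (ReesModule.Hom.ext (F.semilinear_ext (fun n hn => ?_)
      fun n hn => ?_))
    · exact F'.injOn_of_le_zero hN' le_rfl (f.hom.map_deg _ _ hn) (g.hom.map_deg _ _ hn) (h1 n)
    · exact F'.injOn_of_le_zero hN' (by omega) (f.hom.map_deg _ _ hn) (g.hom.map_deg _ _ hn) (h1 n)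

/-- The image of l_i lies in M₁', hence comes from N'_0, and the image of t_i comes from N'_{-1},
which surjects onto τ^*N'. A graded map is built from these lifts using the coordinates of the
frame. -/
instance : (pairFunctor p R hd).Full where
  map_surjective {N N'} γ := by
    obtain ⟨ι, κ, _, _, _, _, e, e', _, _, _, _, ⟨F⟩⟩ :=
      ReesModule.exists_normalFrame N.property
    obtain ⟨_, _, _, _, _, _, _, _, _, _, _, _, ⟨F'⟩⟩ := ReesModule.exists_normalFrame N'.property
    let γ' : (tauPull p R h d).obj N →ₗ[WittVector p R] (tauPull p R h d).obj N' := γ.lin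
    have hl : ∀ i, ∃ n ∈ N'.obj.deg 0, tauUnit N' n = γ' (tauUnit N (F.l i)) := fun i =>
      γ.map_sub _ ⟨F.l i, F.l_mem i, rfl⟩
    have ht : ∀ i, ∃ n ∈ N'.obj.deg (-1), tauUnit N' n = γ' (tauUnit N (F.t i)) := fun i =>
      F'.exists_deg_neg_one (isScalarExtension_tauUnit N') _
    choose l' hl'mem hl' using hl
    choose t' ht'mem ht' using ht
    let g : N.obj ⟶ N'.obj := ⟨F.combination (RingHom.id _) l' t', fun j n hn => by
      rw [F.combination_apply]
      refine add_mem (sum_mem fun i _ => ?_) (sum_mem fun i _ => ?_)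
      · have := N'.obj.smul_mem_deg (F.a_mem i j n hn) (hl'mem i)
        rwa [add_zero] at this
      · have := N'.obj.smul_mem_deg (F.b_mem i j n hn) (ht'mem i)
        rwa [add_neg_cancel_right] at this⟩
    refine ⟨ObjectProperty.homMk g, Pair.Hom.ext
      ((isScalarExtension_tauUnit N).hom_ext fun n => ?_)⟩
    have h1 : tauUnit N' (F.combination (RingHom.id _) l' t' n) = γ' (tauUnit N n) := by
      conv_rhs => rw [← F.repr n]
      simp only [F.combination_apply, map_add, map_sum, map_smulₛₗ, RingHom.id_apply, hl', ht']
    exact h1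

/-- The Gram matrices of a frame of P define a bundle whose pair has a frame with the same Gram
matrices. -/
instance : (pairFunctor p R hd).EssSurj where
  mem_essImage P := by
    obtain ⟨n, n', e, e', he, he', hr, hr', ⟨G⟩⟩ := P.exists_pairFrame hd
    obtain ⟨N, ⟨F⟩⟩ := exists_normalFrame_of_idempotent he he'
    let N₀ : ReesBundle p R h d := ⟨N, F.isBundle hd hr hr'⟩
    let F' : PairFrame (pairOfBundle hd N₀) e e' :=
      NormalFrame.splitFrame (N := N) F (isScalarExtension_tauUnit N₀) rfl
    exact ⟨N₀, ⟨F'.iso G⟩⟩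

instance : (pairFunctor p R hd).IsEquivalence where

end ToPair

/-! ### The comparison functors and the identification of σ^*N with M̃₁. -/

section ComparisonConstruction

variable {p : ℕ} [Fact p.Prime] {R : Type u} [CommRing R] {h d : ℕ}
  [IsAdicComplete (Ideal.span {(p : R)}) R] (hd : d ≤ h)

/-- The canonical map `N → τ^* N`, as a map to the pair attached to `N`. -/
abbrev pairUnit (N : ReesBundle p R h d) :
    N.obj.carrier →ₛₗ[tauHom p R] (pairOfBundle hd N).carrier := tauUnit N

theorem isScalarExtension_pairUnit (N : ReesBundle p R h d) :
    IsScalarExtension (pairUnit hd N) := isScalarExtension_tauUnit N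

theorem exists_sigmaEquiv (N : ReesBundle p R h d) :
    ∃ Ξ : (sigmaPull p R h d).obj N ≃ₗ[WittVector p R] (pairOfBundle hd N).tildeObj,
      (∀ n ∈ N.obj.deg 0, ∀ hm, Ξ (sigmaUnit N n) =
        (pairOfBundle hd N).tildeOne ⟨pairUnit hd N n, hm⟩) ∧
      ∀ n ∈ N.obj.deg (-1), Ξ (sigmaUnit N n) =
        (pairOfBundle hd N).tildeZero (pairUnit hd N n) := by
  obtain ⟨_, _, _, _, _, _, _, _, _, _, _, _, ⟨F⟩⟩ := ReesModule.exists_normalFrame N.property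
  exact F.exists_sigmaEquiv (P := pairOfBundle hd N) (isScalarExtension_pairUnit hd N) rfl
    (isScalarExtension_sigmaUnit N)

/-- The isomorphism `σ^* N ≅ M̃₁` for the pair `(M, M₁)` attached to `N`. -/
def sigmaEquiv (N : ReesBundle p R h d) :
    (sigmaPull p R h d).obj N ≃ₗ[WittVector p R] (pairOfBundle hd N).tildeObj :=
  (exists_sigmaEquiv hd N).choose

theorem sigmaEquiv_deg_zero (N : ReesBundle p R h d) {n : N.obj.carrier} (hn : n ∈ N.obj.deg 0)
    (hm : pairUnit hd N n ∈ (pairOfBundle hd N).sub) :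
    sigmaEquiv hd N (sigmaUnit N n) = (pairOfBundle hd N).tildeOne ⟨pairUnit hd N n, hm⟩ :=
  (exists_sigmaEquiv hd N).choose_spec.1 n hn hm

theorem sigmaEquiv_deg_neg_one (N : ReesBundle p R h d) {n : N.obj.carrier}
    (hn : n ∈ N.obj.deg (-1)) :
    sigmaEquiv hd N (sigmaUnit N n) = (pairOfBundle hd N).tildeZero (pairUnit hd N n) :=
  (exists_sigmaEquiv hd N).choose_spec.2 n hn

theorem pairUnit_mem (N : ReesBundle p R h d) {n : N.obj.carrier} (hn : n ∈ N.obj.deg 0) :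
    pairUnit hd N n ∈ (pairOfBundle hd N).sub := ⟨n, hn, rfl⟩

/-- The isomorphism is obtained by choice, but it is determined by its values on N_0 and N_{-1};
both composites are compared there. -/
theorem sigmaEquiv_naturality {N N' : ReesBundle p R h d} (f : N ⟶ N')
    (z : (sigmaPull p R h d).obj N) :
    sigmaEquiv hd N' (((sigmaPull p R h d).map f).hom z) =
      ((Pair.tilde p R h d).map ((pairFunctor p R hd).map f)).hom (sigmaEquiv hd N z) := by
  obtain ⟨_, _, _, _, _, _, _, _, _, _, _, _, ⟨F⟩⟩ := ReesModule.exists_normalFrame N.property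
  let k₁ : (sigmaPull p R h d).obj N →ₗ[WittVector p R] (pairOfBundle hd N').tildeObj :=
    (sigmaEquiv hd N').toLinearMap ∘ₗ ((sigmaPull p R h d).map f).hom
  let k₂ : (sigmaPull p R h d).obj N →ₗ[WittVector p R] (pairOfBundle hd N').tildeObj :=
    ((Pair.tilde p R h d).map ((pairFunctor p R hd).map f)).hom ∘ₗ (sigmaEquiv hd N).toLinearMap
  have hk : k₁.comp (sigmaUnit N) = k₂.comp (sigmaUnit N) := by
    refine F.semilinear_ext (fun n hn => ?_) fun n hn => ?_
    · change sigmaEquiv hd N' (sigmaUnit N' (f.hom.lin n)) =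
        ((Pair.tilde p R h d).map ((pairFunctor p R hd).map f)).hom
          (sigmaEquiv hd N (sigmaUnit N n))
      rw [sigmaEquiv_deg_zero hd N hn (pairUnit_mem hd N hn),
        sigmaEquiv_deg_zero hd N' (f.hom.map_deg _ _ hn)
          (pairUnit_mem hd N' (f.hom.map_deg _ _ hn))]
      exact (Pair.tilde_map_one (P := pairOfBundle hd N) (P' := pairOfBundle hd N')
        ((pairFunctor p R hd).map f) ⟨pairUnit hd N n, pairUnit_mem hd N hn⟩).symm
    · change sigmaEquiv hd N' (sigmaUnit N' (f.hom.lin n)) =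
        ((Pair.tilde p R h d).map ((pairFunctor p R hd).map f)).hom
          (sigmaEquiv hd N (sigmaUnit N n))
      rw [sigmaEquiv_deg_neg_one hd N hn, sigmaEquiv_deg_neg_one hd N' (f.hom.map_deg _ _ hn)]
      exact (Pair.tilde_map_zero (P := pairOfBundle hd N) (P' := pairOfBundle hd N')
        ((pairFunctor p R hd).map f) (pairUnit hd N n)).symm
  have hk' : k₁ = k₂ :=
    (isScalarExtension_sigmaUnit N).hom_ext fun n => LinearMap.congr_fun hk n
  exact LinearMap.congr_fun hk' z

variable (p R)

/-- The identification of the pullback along `τ` with `(M, M₁) ↦ M`. -/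
def tauIso : tauPull p R h d ≅ pairFunctor p R hd ⋙ Pair.forget p R h d :=
  NatIso.ofComponents (fun N => Iso.refl ((tauPull p R h d).obj N)) fun f => by
    rw [Iso.refl_hom, Iso.refl_hom]
    exact (Category.comp_id _).trans (Category.id_comp _).symm

/-- The identification of the pullback along `σ` with `(M, M₁) ↦ M̃₁`. -/
def sigmaIso : sigmaPull p R h d ≅ pairFunctor p R hd ⋙ Pair.tilde p R h d :=
  NatIso.ofComponents
    (fun N => (sigmaEquiv hd N).toModuleIso (X₁ := (sigmaPull p R h d).obj N)
      (X₂ := (pairOfBundle hd N).tildeObj))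
    fun f => ModuleCat.hom_ext (LinearMap.ext fun z => sigmaEquiv_naturality hd f z)

/-- The comparison of vector bundles with pairs and displays. -/
def comparison : Comparison p R h d where
  toPair := pairFunctor p R hd
  toDisplay := IsoInserter.mapFunctor (pairFunctor p R hd) (sigmaIso p R hd) (tauIso p R hd)
  tau := tauIso p R hd
  sigma := sigmaIso p R hd
  under := Iso.refl _

instance : (comparison p R hd).toPair.IsEquivalence :=
  inferInstanceAs (pairFunctor p R hd).IsEquivalence

instance : (comparison p R hd).toDisplay.IsEquivalence :=
  inferInstanceAs
    (IsoInserter.mapFunctor (pairFunctor p R hd) (sigmaIso p R hd) (tauIso p R hd)).IsEquivalence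

theorem comparison_isGluingCompatible : (comparison p R hd).IsGluingCompatible := fun X =>
  IsoInserter.mapFunctor_iso_hom (pairFunctor p R hd) (sigmaIso p R hd) (tauIso p R hd) X

end ComparisonConstruction

/-! ### Compatibility with base change. -/

section Naturality

variable {p : ℕ} [Fact p.Prime] {R R' : Type u} [CommRing R] [CommRing R'] {h d : ℕ}
  {f : R →+* R'} {N : ReesBundle p R h d} {N' : ReesBundle p R' h d}
  (g : N.obj.carrier →ₛₗ[reesMap (p := p) f] N'.obj.carrier)

theorem exists_tauMap : ∃ t : (tauPull p R h d).obj N →ₛₗ[WittVector.map (p := p) f]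
    (tauPull p R' h d).obj N', ∀ n, t (tauUnit N n) = tauUnit N' (g n) := by
  refine (isScalarExtension_tauUnit N).exists_lift (WittVector.map f)
    ((tauUnit N').toAddMonoidHom.comp g.toAddMonoidHom) fun b n => ?_
  change tauUnit N' (g (b • n)) = _ • tauUnit N' (g n)
  rw [map_smulₛₗ, map_smulₛₗ, tauHom_reesMap]

theorem exists_sigmaMap : ∃ s : (sigmaPull p R h d).obj N →ₛₗ[WittVector.map (p := p) f]
    (sigmaPull p R' h d).obj N', ∀ n, s (sigmaUnit N n) = sigmaUnit N' (g n) := by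
  refine (isScalarExtension_sigmaUnit N).exists_lift (WittVector.map f)
    ((sigmaUnit N').toAddMonoidHom.comp g.toAddMonoidHom) fun b n => ?_
  change sigmaUnit N' (g (b • n)) = _ • sigmaUnit N' (g n)
  rw [map_smulₛₗ, map_smulₛₗ, sigmaHom_reesMap]

variable {g}
variable {t : (tauPull p R h d).obj N →ₛₗ[WittVector.map (p := p) f] (tauPull p R' h d).obj N'}
  {s : (sigmaPull p R h d).obj N →ₛₗ[WittVector.map (p := p) f] (sigmaPull p R' h d).obj N'}

theorem isScalarExtension_tauMap (ht : ∀ n, t (tauUnit N n) = tauUnit N' (g n))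
    (hg : IsScalarExtension g) : IsScalarExtension t :=
  hg.of_square (fun b => (tauHom_reesMap f b).symm) (isScalarExtension_tauUnit N)
    (isScalarExtension_tauUnit N') ht

theorem isScalarExtension_sigmaMap (hs : ∀ n, s (sigmaUnit N n) = sigmaUnit N' (g n))
    (hg : IsScalarExtension g) : IsScalarExtension s :=
  hg.of_square (fun b => (sigmaHom_reesMap f b).symm) (isScalarExtension_sigmaUnit N)
    (isScalarExtension_sigmaUnit N') hs

variable [IsAdicComplete (Ideal.span {(p : R)}) R] [IsAdicComplete (Ideal.span {(p : R')}) R']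
  (hd : d ≤ h)

/-- The map `M̃₁ → M̃₁'` corresponding to a map `σ^* N → σ^* N'`. -/
def tildeMap (s : (sigmaPull p R h d).obj N →ₛₗ[WittVector.map (p := p) f]
    (sigmaPull p R' h d).obj N') :
    (pairOfBundle hd N).tildeObj →ₛₗ[WittVector.map (p := p) f] (pairOfBundle hd N').tildeObj :=
  (sigmaEquiv hd N').toLinearMap.comp (s.comp (sigmaEquiv hd N).symm.toLinearMap)

theorem tildeMap_sigmaEquiv (z : (sigmaPull p R h d).obj N) :
    tildeMap hd s (sigmaEquiv hd N z) = sigmaEquiv hd N' (s z) := by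
  change sigmaEquiv hd N' (s ((sigmaEquiv hd N).symm (sigmaEquiv hd N z))) = _
  rw [LinearEquiv.symm_apply_apply]

/-- M₁ and M are the images of N_0 and N_{-1}. A degree-preserving map respects these components, on
which the identification with M̃₁ is explicit for both bundles. -/
theorem isPairMap_tildeMap (hg : IsBundleMap g) (ht : ∀ n, t (tauUnit N n) = tauUnit N' (g n))
    (hs : ∀ n, s (sigmaUnit N n) = sigmaUnit N' (g n)) :
    IsPairMap (P := pairOfBundle hd N) (P' := pairOfBundle hd N') t (tildeMap hd s) := by
  obtain ⟨_, _, _, _, _, _, _, _, _, _, _, _, ⟨F⟩⟩ := ReesModule.exists_normalFrame N.property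
  refine ⟨?_, fun m => ?_⟩
  · rintro ⟨_, n, hn, rfl⟩
    have hn' := hg 0 n hn
    have hm : t (tauUnit N n) ∈ (pairOfBundle hd N').sub := ⟨g n, hn', (ht n).symm⟩
    refine ⟨hm, ?_⟩
    refine (congrArg (tildeMap hd s)
      (sigmaEquiv_deg_zero hd N hn (pairUnit_mem hd N hn)).symm).trans ?_
    rw [tildeMap_sigmaEquiv, hs, sigmaEquiv_deg_zero hd N' hn' (pairUnit_mem hd N' hn')]
    exact congrArg _ (Subtype.ext (ht n).symm)
  · obtain ⟨n, hn, rfl⟩ := F.exists_deg_neg_one (isScalarExtension_pairUnit hd N) m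
    refine (congrArg (tildeMap hd s) (sigmaEquiv_deg_neg_one hd N hn).symm).trans ?_
    rw [tildeMap_sigmaEquiv, hs, sigmaEquiv_deg_neg_one hd N' (hg _ n hn)]
    exact congrArg _ (ht n).symm

theorem isPairBaseChange_of_isScalarExtension (hg : IsBundleMap g)
    (ht : ∀ n, t (tauUnit N n) = tauUnit N' (g n)) (hgs : IsScalarExtension g) :
    IsPairBaseChange (P := pairOfBundle hd N) (P' := pairOfBundle hd N') t := by
  obtain ⟨ι, κ, _, _, _, _, _, _, _, _, _, _, ⟨F⟩⟩ := ReesModule.exists_normalFrame N.property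
  refine ⟨isScalarExtension_tauMap ht hgs, le_antisymm ?_ (sup_le ?_ (pairOfBundle hd N').smul_le)⟩
  · rintro _ ⟨n', hn', rfl⟩
    -- N' is spanned by the images of the l_i and t_i. Taking the part of degree 0, the coefficients
    -- become homogeneous of degrees 0 and 1: the first sum lands in the span of the image of M₁,
    -- the second in I_{R'}M' because τ maps degree 1 into I_{R'}.
    obtain ⟨β, β', hβ⟩ : ∃ (β : ι → Rees p R') (β' : κ → Rees p R'),
        n' = ∑ i, β i • g (F.l i) + ∑ i, β' i • g (F.t i) := by
      clear hn'
      induction n' using hgs.induction with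
      | h0 n =>
        refine ⟨fun i => reesMap f (F.a i n), fun i => reesMap f (F.b i n), ?_⟩
        conv_lhs => rw [← F.repr n]
        simp only [map_add, map_sum, map_smulₛₗ]
      | hadd x y hx hy =>
        obtain ⟨β, β', rfl⟩ := hx
        obtain ⟨δ, δ', rfl⟩ := hy
        refine ⟨β + δ, β' + δ', ?_⟩
        simp only [Pi.add_apply, add_smul, Finset.sum_add_distrib]
        abel
      | hsmul b x hx =>
        obtain ⟨β, β', rfl⟩ := hx
        refine ⟨b • β, b • β', ?_⟩
        simp only [Pi.smul_apply, smul_eq_mul, mul_smul, smul_add, Finset.smul_sum]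
    have hn0 := homPart_of_mem hn'
    rw [hβ, map_add, map_sum, map_sum] at hn0
    simp only [homPart_smul_right N'.obj 0 _ (hg _ _ (F.l_mem _)),
      homPart_smul_right N'.obj 0 _ (hg _ _ (F.t_mem _)), zero_sub, neg_neg, neg_zero] at hn0
    rw [hβ, ← hn0, map_add, map_sum, map_sum]
    refine Submodule.add_mem_sup (Submodule.sum_mem _ fun i _ => ?_)
      (Submodule.sum_mem _ fun i _ => ?_)
    · rw [map_smulₛₗ, ← ht]
      exact Submodule.smul_mem _ _ (Submodule.subset_span ⟨_, ⟨_, F.l_mem i, rfl⟩, rfl⟩)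
    · rw [map_smulₛₗ]
      exact Submodule.smul_mem_smul (tauHom_mem_augIdeal (homPart_mem _ _ _)) trivial
  · refine Submodule.span_le.mpr ?_
    rintro _ ⟨_, ⟨n, hn, rfl⟩, rfl⟩
    exact ⟨g n, hg 0 n hn, (ht n).symm⟩

theorem comparison_isNatural (f : R →+* R') :
    (comparison p R hd).IsNatural f (comparison p R' hd) := by
  refine ⟨fun N N' g hg => ?_, fun X X' g hg => ?_⟩
  · obtain ⟨t, ht⟩ := exists_tauMap g
    obtain ⟨s, hs⟩ := exists_sigmaMap g
    refine ⟨t, tildeMap hd s, isPairMap_tildeMap hd hg ht hs, ht, fun n => ?_,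
      isPairBaseChange_of_isScalarExtension hd hg ht⟩
    exact (tildeMap_sigmaEquiv hd (sigmaUnit N n)).trans (congrArg (sigmaEquiv hd N') (hs n))
  · obtain ⟨hg, s, t, hs, ht, hst⟩ := hg
    refine ⟨t, tildeMap hd s, isPairMap_tildeMap hd hg ht hs, fun z => ?_, ht,
      isPairBaseChange_of_isScalarExtension hd hg ht⟩
    obtain ⟨y, rfl⟩ := (sigmaEquiv hd X.obj).surjective z
    refine (congrArg _ (tildeMap_sigmaEquiv hd y)).trans ?_
    -- By construction Ψ is Φ precomposed with the inverse of the identification σ^*N ≅ M̃₁, while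
    -- τ^*N = M on the nose.
    have h1 : ∀ (R₀ : Type u) [CommRing R₀] [IsAdicComplete (Ideal.span {(p : R₀)}) R₀]
        (X₀ : DispBundle p R₀ h d) (y : (sigmaPull p R₀ h d).obj X₀.obj),
        (((comparison p R₀ hd).toDisplay.obj X₀).iso.hom.hom (sigmaEquiv hd X₀.obj y)) =
          X₀.iso.hom.hom y := by
      intro R₀ _ _ X₀ y
      change X₀.iso.hom.hom ((sigmaEquiv hd X₀.obj).symm (sigmaEquiv hd X₀.obj y)) = _
      rw [LinearEquiv.symm_apply_apply]
    exact ((h1 R' X' (s y)).trans (hst y)).trans (congrArg t (h1 R X y).symm)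

end Naturality

/-! ### Base change of bundles on R^Disp. -/

section DispBaseChange

variable {p : ℕ} [Fact p.Prime] {R R' : Type u} [CommRing R] [CommRing R'] {h d : ℕ}
  [IsAdicComplete (Ideal.span {(p : R)}) R]

theorem IsScalarExtension.comp_equiv {A A' : Type u} [CommRing A] [CommRing A'] {f : A →+* A'}
    {M₀ M M' : Type u} [AddCommGroup M₀] [AddCommGroup M] [AddCommGroup M'] [Module A M₀]
    [Module A M] [Module A' M'] {g : M →ₛₗ[f] M'} (hg : IsScalarExtension g) (i : M₀ ≃ₗ[A] M) :
    IsScalarExtension (g.comp i.toLinearMap) := by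
  intro Q _ _ k
  obtain ⟨l, hl, huniq⟩ := hg Q (k.comp i.symm.toLinearMap)
  refine ⟨l, fun m => (hl (i m)).trans (congrArg k (i.symm_apply_apply m)), fun l' hl' =>
    huniq l' fun m => ?_⟩
  have := hl' (i.symm m)
  rwa [LinearMap.comp_apply, LinearEquiv.coe_coe, LinearEquiv.apply_symm_apply] at this

/-- Vector bundles of type `μ_d` on `R^Disp` have base changes. -/
theorem DispBundle.exists_baseChange (hd : d ≤ h) (f : R →+* R') (X : DispBundle p R h d) :
    ∃ (X' : DispBundle p R' h d)
      (g : X.obj.obj.carrier →ₛₗ[reesMap (p := p) f] X'.obj.obj.carrier),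
        IsDispBundleMap g ∧ IsScalarExtension g := by
  obtain ⟨N', g, hg, hgs⟩ := ReesBundle.exists_baseChange hd f X.obj
  obtain ⟨t, ht⟩ := exists_tauMap g
  obtain ⟨s, hs⟩ := exists_sigmaMap g
  -- Both σ^*N' and, through the given isomorphism σ^*N ≅ τ^*N, also τ^*N' are scalar extensions of
  -- σ^*N; the comparison between them is the gluing isomorphism of the base change.
  obtain ⟨Φ, hΦ⟩ := (isScalarExtension_sigmaMap hs hgs).exists_equiv
    ((isScalarExtension_tauMap ht hgs).comp_equiv X.iso.toLinearEquiv)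
  let X' : DispBundle p R' h d := ⟨N', Φ.toModuleIso (X₁ := (sigmaPull p R' h d).obj N')
    (X₂ := (tauPull p R' h d).obj N')⟩
  exact ⟨X', g, ⟨hg, s, t, hs, ht, hΦ⟩, hgs⟩

end DispBaseChange
end WittDisplay
end

theorem mainTheorem12 (p : ℕ) [Fact p.Prime] (h d : ℕ) (hd : d ≤ h) :
    -- the description of `M̃₁` through normal decompositions
    (∀ (R : Type u) [CommRing R] [IsAdicComplete (Ideal.span {(p : R)}) R],
      (∀ P : WittDisplay.Pair p R h d, ∃ L T, P.IsNormal L T) ∧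
      (∀ (P : WittDisplay.Pair p R h d) (L T), P.IsNormal L T → ∃ θ, P.IsNormalCoord L T θ) ∧
      (∀ (P P' : WittDisplay.Pair p R h d) (f : P ⟶ P') (L T L' T'),
        P.IsNormal L T → P'.IsNormal L' T' → ∀ θ θ', P.IsNormalCoord L T θ →
          P'.IsNormalCoord L' T' θ' → WittDisplay.Pair.HasMatrix f θ θ')) ∧
    -- existence of base changes of vector bundles on `Re(W(R))` and on `R^Disp`
    (∀ (R R' : Type u) [CommRing R] [CommRing R'] [IsAdicComplete (Ideal.span {(p : R)}) R]
      [IsAdicComplete (Ideal.span {(p : R')}) R'] (f : R →+* R'),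
      (∀ N : WittDisplay.ReesBundle p R h d, ∃ (N' : WittDisplay.ReesBundle p R' h d)
        (g : N.obj.carrier →ₛₗ[WittDisplay.reesMap (p := p) f] N'.obj.carrier),
          WittDisplay.IsBundleMap g ∧ WittDisplay.IsScalarExtension g) ∧
      (∀ X : WittDisplay.DispBundle p R h d, ∃ (X' : WittDisplay.DispBundle p R' h d)
        (g : X.obj.obj.carrier →ₛₗ[WittDisplay.reesMap (p := p) f] X'.obj.obj.carrier),
          WittDisplay.IsDispBundleMap g ∧ WittDisplay.IsScalarExtension g)) ∧
    -- the equivalences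
    ∃ C : ∀ (R : Type u) [CommRing R] [IsAdicComplete (Ideal.span {(p : R)}) R],
        WittDisplay.Comparison p R h d,
      (∀ (R : Type u) [CommRing R] [IsAdicComplete (Ideal.span {(p : R)}) R],
        (C R).toPair.IsEquivalence ∧ (C R).toDisplay.IsEquivalence ∧
          (C R).IsGluingCompatible) ∧
      (∀ (R R' : Type u) [CommRing R] [CommRing R'] [IsAdicComplete (Ideal.span {(p : R)}) R]
        [IsAdicComplete (Ideal.span {(p : R')}) R'] (f : R →+* R'),
        WittDisplay.Comparison.IsNatural f (C R) (C R')) := by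
  refine ⟨fun R _ _ => ⟨fun P => P.exists_isNormal, fun P L T hLT => hLT.exists_isNormalCoord,
    fun P P' f L T L' T' hLT hLT' θ θ' hθ hθ' =>
      WittDisplay.Pair.hasMatrix f hLT hLT' hθ hθ'⟩,
    fun R R' _ _ _ _ f => ⟨fun N => WittDisplay.ReesBundle.exists_baseChange hd f N,
      fun X => WittDisplay.DispBundle.exists_baseChange hd f X⟩,
    fun R _ _ => WittDisplay.comparison p R hd, fun R _ _ => ⟨inferInstance, inferInstance,
      WittDisplay.comparison_isGluingCompatible p R hd⟩,
    fun R R' _ _ _ _ f => WittDisplay.comparison_isNatural hd f⟩
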